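/- **Model.** Let $p\ge 1$, let $m_1,\dots,m_p:[0,1]\to\mathbb R$ be continuous, $m(\mathbf x)=\sum_{j=1}^p m_j(\mathbf x^{(j)})$, and $\sigma^2>0$. For each $n$ let $(\mathbf X_i,\varepsilon_i,\mathbf M_i)$, $i=1,\dots,n$, be i.i.d. with $\mathbf X_i$ uniform on $[0,1]^p$, $\varepsilon_i\sim\mathcal N(0,\sigma^2)$, $\mathbf M_i\in\{0,1\}^p$, the three being independent, and let $Y_i=m(\mathbf X_i)+\varepsilon_i$. The coordinate $\mathbf X_i^{(h)}$ is missing when $\mathbf M_i^{(h)}=1$ (missing completely at random); the observed data are the $\mathbf M_i$, the $Y_i$ and the non-missing coordinates. The law of $\mathbf M_i$ may depend on $n$; assume $p_n^{(h)}=\mathbb P[\mathbf M_i^{(h)}=1]\to c^{(h)}\in(0,1)$ for every $h$, and $\liminf_n \mathbb P[\mathbf M_i=0]>0$ (a positive proportion of fully observed points; automatic if $\mathbf M_i^{(1)},\dots,\mathbf M_i^{(p)}$ are independent). **Forest.** Fix the number of trees $T\ge1$ and $\mathtt{mtry}\in\{1,\dots,p\}$, and let $a_n\le n$, $q_n\ge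 1$, $\mathtt{nodesize}_n$ be integers with, for all large $n$, $2q_n\le a_n$ and $2q_n-1\le \mathtt{nodesize}_n\le a_n$. Each tree is built as follows, with independent randomization independent of the data. Draw $a_n$ observations uniformly without replacement; they all belong to the root cell $[0,1]^p$. A cell $A=\prod_h[a^{(h)},b^{(h)}]$ with set $I(A)$ of observations is final if $q_n\le |I(A)|\le\mathtt{nodesize}_n$, or if it has no admissible split. Otherwise draw uniformly a set $\mathcal M_{try}\subset\{1,\dots,p\}$ of cardinality $\mathtt{mtry}$ (independently at each cell) and choose a cut $(h,z)$, $h\in\mathcal M_{try}$, $a^{(h)}\le z\le b^{(h)}$, together with an assignation $w$ of each observation of $I(A)$ missing in direction $h$ to the left cell $A_L=\{\mathbf x\in A:\mathbf x^{(h)}\le z\}$ or to the right cell $A_R=\{\mathbf x\in A:\mathbf x^{(h)}>z\}$ (the observations of $I(A)$ observed in direction $h$ go to $A_L$ or $A_R$ according to the value of this coordinate), so that each of $I(A_L)$, $I(A_R)$ has at least $q_n$ elements (admissible split), maximizing over all admissible splits $$L_n(A,(h,z),w)=\frac1{|I(A)|}\Big[\sum_{i\in I(A)}(Y_i-\widehat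 Y_A)^2-\sum_{i\in I(A_L)}(Y_i-\widehat Y_{A_L})^2-\sum_{i\in I(A_R)}(Y_i-\widehat Y_{A_R})^2\Big],$$ where $\widehat Y_B$ is the mean of the $Y_i$, $i\in I(B)$; ties are broken by any measurable deterministic rule that depends only on the observed data, on $A$, $I(A)$ and on $\mathcal M_{try}$. The tree estimate at $\mathbf x$ is $\widehat Y_A$ for the final cell $A$ containing $\mathbf x$, and the forest estimate $m_n(\mathbf x)$ is the average of the $T$ tree estimates. **Theorem.** If $q_n\to\infty$ and $\mathtt{nodesize}_n/a_n\to0$, then the random forest is consistent in probability: if $\mathbf X$ is uniform on $[0,1]^p$ and independent of the training sample and of the randomization, then for all $\xi,\rho>0$ there is $N$ such that for all $n>N$ $$\mathbb P\big[|m_n(\mathbf X)-m(\mathbf X)|\le\xi\big]\ge 1-\rho .$$ -/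

import Mathlib

open MeasureTheory ProbabilityTheory Filter Topology
open scoped NNReal ENNReal

namespace MissingForest

/-! ### Observed data -/

/-- What the statistician sees of a sample of size `n`: for every observation and every coordinate
the missingness flag (`true` = missing) together with the recorded value, and the response. -/
abbrev Data (n p : ℕ) := Fin n → (Fin p → Bool × ℝ) × ℝ

variable {n p : ℕ}

/-- Coordinate `h` of observation `i` is missing. -/
def IsMissing (D : Data n p) (i : Fin n) (h : Fin p) : Prop := ((D i).1 h).1 = true

/-- The recorded value of coordinate `h` of observation `i` (meaningful only if not missing). -/
def value (D : Data n p) (i : Fin n) (h : Fin p) : ℝ := ((D i).1 h).2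

/-- The response of observation `i`. -/
def resp (D : Data n p) (i : Fin n) : ℝ := (D i).2

/-- The observed data obtained from the full covariates `x`, the missingness indicators `m` and the
responses `y`: the value of a missing coordinate is erased (replaced by the dummy value `0`). -/
noncomputable def observe (x : Fin n → Fin p → ℝ) (m : Fin n → Fin p → Bool) (y : Fin n → ℝ) :
    Data n p :=
  fun i => (fun h => (m i h, if m i h = true then 0 else x i h), y i)

/-! ### Cells, splits with assignation, and the CART criterion -/

/-- A cell `∏ₕ [a⁽ʰ⁾, b⁽ʰ⁾]`, given by its lower and its upper bounds. -/
abbrev Cell (p : ℕ) := (Fin p → ℝ) × (Fin p → ℝ)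

/-- A split of a cell with an assignation: the direction `h`, the position `z`, and the set `W` of
the observations missing in the direction `h` that are assigned to the left cell
(those with `wᵢ = 1`). -/
abbrev Split (n p : ℕ) := Fin p × ℝ × Finset (Fin n)

open Classical in
/-- The observations, among those `I` belonging to the current cell, which belong to the left cell
`{x⁽ʰ⁾ ≤ z}`: those observed in the direction `h` with a value at most `z`, and those missing in
the direction `h` and assigned to the left (their `h`-th coordinate is imputed by `[a⁽ʰ⁾, z]`). -/
noncomputable def leftObs (D : Data n p) (I : Finset (Fin n)) (c : Split n p) : Finset (Fin n) :=
  I.filter fun i => (¬ IsMissing D i c.1 ∧ value D i c.1 ≤ c.2.1) ∨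
    (IsMissing D i c.1 ∧ i ∈ c.2.2)

open Classical in
/-- The observations, among those `I` belonging to the current cell, which belong to the right cell
`{x⁽ʰ⁾ > z}`: those observed in the direction `h` with a value larger than `z`, and those missing
in the direction `h` and assigned to the right (their `h`-th coordinate is imputed by
`[z, b⁽ʰ⁾]`). -/
noncomputable def rightObs (D : Data n p) (I : Finset (Fin n)) (c : Split n p) : Finset (Fin n) :=
  I.filter fun i => (¬ IsMissing D i c.1 ∧ c.2.1 < value D i c.1) ∨
    (IsMissing D i c.1 ∧ i ∉ c.2.2)

/-- The left cell of a split. -/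
def leftCell (A : Cell p) (c : Split n p) : Cell p := (A.1, Function.update A.2 c.1 c.2.1)

/-- The right cell of a split. -/
def rightCell (A : Cell p) (c : Split n p) : Cell p := (Function.update A.1 c.1 c.2.1, A.2)

/-- The empirical mean of the responses of the observations in `J` (`0` if `J` is empty). -/
noncomputable def meanResp (D : Data n p) (J : Finset (Fin n)) : ℝ :=
  (∑ i ∈ J, resp D i) / (J.card : ℝ)

/-- The CART criterion `Lₙ(A, d, w)` of a split with assignation of a cell whose observations
are `I`. -/
noncomputable def cart (D : Data n p) (I : Finset (Fin n)) (c : Split n p) : ℝ :=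
  (∑ i ∈ I, (resp D i - meanResp D I) ^ 2) / (I.card : ℝ)
    - (∑ i ∈ leftObs D I c, (resp D i - meanResp D (leftObs D I c)) ^ 2) / (I.card : ℝ)
    - (∑ i ∈ rightObs D I c, (resp D i - meanResp D (rightObs D I c)) ^ 2) / (I.card : ℝ)

/-- The admissible splits with assignation of the cell `A` with observations `I`: the direction is
one of the candidate directions `H`, the position lies between the bounds of the cell, the
assignation concerns the observations of the cell missing in that direction, and both resulting
cells have at least `q` observations. -/
def IsAdmissible (q : ℕ) (D : Data n p) (I : Finset (Fin n)) (A : Cell p) (H : Finset (Fin p))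
    (c : Split n p) : Prop :=
  c.1 ∈ H ∧ A.1 c.1 ≤ c.2.1 ∧ c.2.1 ≤ A.2 c.1 ∧
    (∀ i ∈ c.2.2, i ∈ I ∧ IsMissing D i c.1) ∧
    q ≤ (leftObs D I c).card ∧ q ≤ (rightObs D I c).card

/-- A rule choosing a split with assignation, from the observed data, the observations of the cell,
the cell and the candidate directions. -/
abbrev SplitRule (n p : ℕ) :=
  Data n p → Finset (Fin n) → Cell p → Finset (Fin p) → Split n p

/-- The rule maximizes the CART criterion over all admissible splits with assignation whenever
there are any. (Ties are broken in any way.) -/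
def IsCartRule (q : ℕ) (rule : SplitRule n p) : Prop :=
  ∀ D I A H, (∃ c, IsAdmissible q D I A H c) →
    IsAdmissible q D I A H (rule D I A H) ∧
      ∀ c, IsAdmissible q D I A H c → cart D I c ≤ cart D I (rule D I A H)

/-- The rule (that is, its way of breaking ties) is measurable in the data and the cell. -/
def IsMeasurableRule (rule : SplitRule n p) : Prop :=
  ∀ I H, Measurable fun u : Data n p × Cell p => rule u.1 I u.2 H

/-! ### Trees and forests -/

/-- A regression tree: a leaf is a final cell and carries the set of the observations that belong
to it; an inner node carries the direction and the position of its split. -/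
inductive CartTree (n p : ℕ) where
  | leaf (I : Finset (Fin n)) : CartTree n p
  | node (h : Fin p) (z : ℝ) (left right : CartTree n p) : CartTree n p

/-- The observations in the final cell that contains `x`. -/
noncomputable def CartTree.finalObs (x : Fin p → ℝ) : CartTree n p → Finset (Fin n)
  | .leaf I => I
  | .node h z l r => if x h ≤ z then l.finalObs x else r.finalObs x

open Classical in
/-- The subtree below the cell `A` with observations `I`, at the node reached from the root by the
path `v` (`false` = left, `true` = right, last step first). A cell is final if its number of
observations is between `q` and `nodesize`, or if it has no admissible split. Otherwise it is split
by the rule, with candidate directions `dirs v`. The first numerical argument bounds the height;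
as each split leaves at least `q ≥ 1` observations on each side, a bound of at least the
cardinality of `I` is never reached. -/
noncomputable def grow (rule : SplitRule n p) (q nodesize : ℕ) (D : Data n p)
    (dirs : List Bool → Finset (Fin p)) :
    ℕ → List Bool → Finset (Fin n) → Cell p → CartTree n p
  | 0, _, I, _ => .leaf I
  | k + 1, v, I, A =>
    if (q ≤ I.card ∧ I.card ≤ nodesize) ∨ ¬ ∃ c, IsAdmissible q D I A (dirs v) c then .leaf I
    else
      .node (rule D I A (dirs v)).1 (rule D I A (dirs v)).2.1
        (grow rule q nodesize D dirs k (false :: v)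
          (leftObs D I (rule D I A (dirs v))) (leftCell A (rule D I A (dirs v))))
        (grow rule q nodesize D dirs k (true :: v)
          (rightObs D I (rule D I A (dirs v))) (rightCell A (rule D I A (dirs v))))

/-- The randomization `Θ` of a tree: the subsampled observations, and the candidate directions
at each node. -/
abbrev Theta (n p : ℕ) := Finset (Fin n) × (List Bool → Finset (Fin p))

/-- The tree built with the randomization `θ`, from the root cell `[0,1]ᵖ`. -/
noncomputable def buildTree (rule : SplitRule n p) (q nodesize : ℕ) (D : Data n p)
    (θ : Theta n p) : CartTree n p :=
  grow rule q nodesize D θ.2 n [] θ.1 (0, 1)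

/-- The tree estimate at `x`: the mean response over the final cell containing `x`. -/
noncomputable def treeEstimate (rule : SplitRule n p) (q nodesize : ℕ) (D : Data n p)
    (θ : Theta n p) (x : Fin p → ℝ) : ℝ :=
  meanResp D ((buildTree rule q nodesize D θ).finalObs x)

/-- The random forest estimate at `x`: the average of the `T` tree estimates. -/
noncomputable def forestEstimate {T : ℕ} (rule : SplitRule n p) (q nodesize : ℕ) (D : Data n p)
    (θ : Fin T → Theta n p) (x : Fin p → ℝ) : ℝ :=
  (∑ k, treeEstimate rule q nodesize D (θ k) x) / (T : ℝ)

/-! ### Laws -/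

/-- The uniform law on the subsets of cardinality `k` of a set with `N` elements. -/
noncomputable def uniformSubset (N k : ℕ) (hk : k ≤ N) : Measure (Finset (Fin N)) :=
  (PMF.uniformOfFinset ((Finset.univ : Finset (Fin N)).powersetCard k)
    (Finset.powersetCard_nonempty.2 (by simpa using hk))).toMeasure

/-- The law of `Θ`: `a` observations drawn uniformly without replacement, and independently at each
node `mtry` directions drawn uniformly without replacement. -/
noncomputable def thetaLaw (n p a mtry : ℕ) (ha : a ≤ n) (hm : mtry ≤ p) : Measure (Theta n p) :=
  (uniformSubset n a ha).prod (Measure.infinitePi fun _ : List Bool => uniformSubset p mtry hm)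

/-- The uniform law on `[0,1]ᵖ`. -/
noncomputable def unifCube (p : ℕ) : Measure (Fin p → ℝ) := volume.restrict (Set.Icc 0 1)

/-- The law of (covariates, noise, missingness indicators) for a sample of `n` independent
observations: uniform covariates, centered Gaussian noise of variance `σ2` independent of the
covariates, and missingness indicators of law `miss` independent of both (MCAR). -/
noncomputable def sampleLaw (n p : ℕ) (σ2 : ℝ≥0) (miss : Measure (Fin p → Bool)) :
    Measure (Fin n → (Fin p → ℝ) × ℝ × (Fin p → Bool)) :=
  Measure.pi fun _ => (unifCube p).prod ((gaussianReal 0 σ2).prod miss)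

/-- The joint law of the training sample, the randomizations of the `T` trees and the query
point: the three are independent, the randomizations are i.i.d. and the query point is uniform. -/
noncomputable def forestLaw (n p T a mtry : ℕ) (ha : a ≤ n) (hm : mtry ≤ p) (σ2 : ℝ≥0)
    (miss : Measure (Fin p → Bool)) :
    Measure ((Fin n → (Fin p → ℝ) × ℝ × (Fin p → Bool)) × (Fin T → Theta n p) × (Fin p → ℝ)) :=
  (sampleLaw n p σ2 miss).prod
    ((Measure.pi fun _ : Fin T => thetaLaw n p a mtry ha hm).prod (unifCube p))

end MissingForest

open MissingForest

/-!
# Consistency of random forests with missing covariates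

**Entropy.** A tree grown on `a` observations has at most `a / q = o(a)` leaves, so the unions of
leaves of such partitions have at most `exp (o(a))` traces on a set of `O(a)` given points
(`card_tracesLE_le`, proved by a generating function). Statistics with deviation probabilities
`exp (-γ a)` are therefore controlled on all these unions at once, although the tree depends on
the data. This is used twice, each time through a symmetry of the law that preserves the points.
Flipping the signs of the Gaussian noise shows that the noise is balanced on the unions of leaves
(`measureReal_noiseEvent_le`). Exchanging covariates with independent copies of them, the ghosts,
shows that complete observations and their ghosts are distributed alike over the unions of leaves
(`measureReal_ghostEvent_le`).

**Settled cells.** Call a cell settled if none of its admissible splits, in any direction, has a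
CART gain above `η`. The assignation being free, a cut at the lower edge of the cell can isolate
the observations missing a given coordinate whose response is above, or below, the cell mean; so
in a settled cell the incomplete observations have responses near the mean, and the complete ones
are balanced below every threshold in every coordinate. Testing the deviation `m - Ȳ` of the
regression function from the cell mean against itself, the additivity of `m` and the approximation
of its components by step functions give that `m` is nearly constant on the complete observations
of the cell (`IsSettled.sum_sq_regression_sub_le`). Every subtree of this cell then predicts well
(`IsSettled.sum_error_le`).

**Budget.** In a cell that is not settled, the candidate directions contain one with a gain above
`η` with probability at least `1 / (p choose mtry)`, and the split then lowers the residual sum of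
squares in proportion to the size of the cell. The residual sum of squares is `O(a)` at the root,
so few observations pass through `K` unsettled cells (`integral_stray_le`). The at most `2 ^ K`
cells of fewer than `s` observations met on the way hold few observations when `s` is a small
multiple of `a`, and larger cells can always be split because the coordinates are almost surely
distinct.

**Conclusion.** The tree predicts well at most complete observations, hence at most of their
ghosts (`ghostErrorCount_le`, applied in each level bin of `m` to the union of the leaves whose
mean is far from the level). A positive proportion of the observations is complete, and each ghost
is distributed like the query point given the tree, which bounds the error at the query point
(`mul_measureReal_badEvent_le`, `eventually_measureReal_badEvent_le`).
-/

namespace MissingForest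

/-! ### Traces of cut trees and their number -/

/-- A binary tree of axis-parallel cuts of `ℝᵖ` whose leaves carry a label. It describes a union of
leaves of a tree partition, namely the points that end in a leaf labelled `true`. -/
inductive CutTree (p : ℕ) where
  | leaf (b : Bool) : CutTree p
  | node (h : Fin p) (z : ℝ) (left right : CutTree p) : CutTree p

/-- The label of the leaf that contains `x`. -/
noncomputable def CutTree.eval {p : ℕ} (x : Fin p → ℝ) : CutTree p → Bool
  | .leaf b => b
  | .node h z l r => if x h ≤ z then l.eval x else r.eval x

/-- The number of leaves. -/
def CutTree.leaves {p : ℕ} : CutTree p → ℕ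
  | .leaf _ => 1
  | .node _ _ l r => l.leaves + r.leaves

/-- `IsTrace w k S C`: among the points `w j`, `j ∈ S`, those with `j ∈ C` form a union of leaves
of a cut tree with `k` leaves. Only the order of the coordinates of the points enters, which makes
the property measurable in `w`. -/
inductive IsTrace {p : ℕ} {J : Type*} [DecidableEq J] (w : J → Fin p → ℝ) :
    ℕ → Finset J → Finset J → Prop
  | empty (S : Finset J) : IsTrace w 1 S ∅
  | full (S : Finset J) : IsTrace w 1 S S
  | node (h : Fin p) {k₁ k₂ : ℕ} {S₁ S₂ C₁ C₂ : Finset J}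
      (hlt : ∀ i ∈ S₁, ∀ j ∈ S₂, w i h < w j h)
      (h₁ : IsTrace w k₁ S₁ C₁) (h₂ : IsTrace w k₂ S₂ C₂) :
      IsTrace w (k₁ + k₂) (S₁ ∪ S₂) (C₁ ∪ C₂)

section Trace

variable {p : ℕ} {J : Type*} [DecidableEq J]

lemma isTrace_filter_eval (w : J → Fin p → ℝ) (t : CutTree p) (S : Finset J) :
    IsTrace w t.leaves S (S.filter fun j => t.eval (w j) = true) := by
  induction t generalizing S with
  | leaf b =>
    cases b
    · simpa [CutTree.eval, CutTree.leaves] using IsTrace.empty (w := w) S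
    · simpa [CutTree.eval, CutTree.leaves] using IsTrace.full (w := w) S
  | node h z l r hl hr =>
    have h1 := hl (S.filter fun j => w j h ≤ z)
    have h2 := hr (S.filter fun j => ¬ w j h ≤ z)
    have := IsTrace.node h (by
      intro i hi j hj
      simp only [Finset.mem_filter, not_le] at hi hj
      linarith [hi.2, hj.2]) h1 h2
    rw [Finset.filter_union_filter_not_eq] at this
    have he : (S.filter fun j => (CutTree.node h z l r).eval (w j) = true) =
        ((S.filter fun j => w j h ≤ z).filter fun j => l.eval (w j) = true) ∪
          ((S.filter fun j => ¬ w j h ≤ z).filter fun j => r.eval (w j) = true) := by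
      ext j
      by_cases hj : w j h ≤ z
      · simp [CutTree.eval, hj]
      · simp [CutTree.eval, hj, lt_of_not_ge hj]
    rw [he]
    exact this

lemma IsTrace.pos {w : J → Fin p → ℝ} {k : ℕ} {S C : Finset J} (h : IsTrace w k S C) : 1 ≤ k := by
  induction h with
  | empty S => exact le_rfl
  | full S => exact le_rfl
  | node h hlt h₁ h₂ ih₁ ih₂ => omega

lemma IsTrace.subset {w : J → Fin p → ℝ} {k : ℕ} {S C : Finset J} (h : IsTrace w k S C) :
    C ⊆ S := by
  induction h with
  | empty S => simp
  | full S => exact subset_rfl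
  | node h hlt h₁ h₂ ih₁ ih₂ => exact Finset.union_subset_union ih₁ ih₂

lemma isTrace_iff {w : J → Fin p → ℝ} {k : ℕ} {S C : Finset J} :
    IsTrace w k S C ↔ (k = 1 ∧ (C = ∅ ∨ C = S)) ∨
      ∃ (h : Fin p) (S₁ : Finset J) (k₁ k₂ : ℕ) (C₁ C₂ : Finset J),
        (S₁ ⊆ S ∧ k₁ + k₂ = k ∧ C₁ ∪ C₂ = C) ∧ (∀ i ∈ S₁, ∀ j ∈ S \ S₁, w i h < w j h) ∧
          IsTrace w k₁ S₁ C₁ ∧ IsTrace w k₂ (S \ S₁) C₂ := by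
  constructor
  · intro hC
    cases hC with
    | empty S => exact Or.inl ⟨rfl, Or.inl rfl⟩
    | full S => exact Or.inl ⟨rfl, Or.inr rfl⟩
    | @node h k₁ k₂ S₁ S₂ C₁ C₂ hlt h₁ h₂ =>
      have hd : (S₁ ∪ S₂) \ S₁ = S₂ := by
        ext j
        simp only [Finset.mem_sdiff, Finset.mem_union]
        constructor
        · tauto
        · exact fun hj => ⟨Or.inr hj, fun hj' => lt_irrefl _ (hlt j hj' j hj)⟩
      exact Or.inr ⟨h, S₁, k₁, k₂, C₁, C₂, ⟨Finset.subset_union_left, rfl, rfl⟩, by rwa [hd], h₁,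
        by rwa [hd]⟩
  · rintro (⟨rfl, rfl | rfl⟩ | ⟨h, S₁, k₁, k₂, C₁, C₂, ⟨hS, rfl, rfl⟩, hlt, h₁, h₂⟩)
    · exact .empty S
    · exact .full _
    · have := IsTrace.node h hlt h₁ h₂
      rwa [Finset.union_sdiff_of_subset hS] at this

lemma measurable_isTrace [Finite J] (k : ℕ) (S C : Finset J) :
    Measurable fun w : J → Fin p → ℝ => IsTrace w k S C := by
  induction k using Nat.strong_induction_on generalizing S C with
  | _ k ih =>
    -- the recursive occurrences have fewer leaves, as no tree has zero leaves
    have hrw : (fun w : J → Fin p → ℝ => IsTrace w k S C) = fun w => (k = 1 ∧ (C = ∅ ∨ C = S)) ∨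
      ∃ (h : Fin p) (S₁ : Finset J) (k₁ k₂ : ℕ) (C₁ C₂ : Finset J),
        (S₁ ⊆ S ∧ k₁ + k₂ = k ∧ C₁ ∪ C₂ = C) ∧ (∀ i ∈ S₁, ∀ j ∈ S \ S₁, w i h < w j h) ∧
          (k₁ < k ∧ IsTrace w k₁ S₁ C₁) ∧ (k₂ < k ∧ IsTrace w k₂ (S \ S₁) C₂) := by
      ext w
      rw [isTrace_iff]
      refine or_congr_right ?_
      constructor
      · rintro ⟨h, S₁, k₁, k₂, C₁, C₂, hh, hlt, h1, h2⟩
        have := h1.pos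
        have := h2.pos
        exact ⟨h, S₁, k₁, k₂, C₁, C₂, hh, hlt, ⟨by omega, h1⟩, ⟨by omega, h2⟩⟩
      · rintro ⟨h, S₁, k₁, k₂, C₁, C₂, hh, hlt, h1, h2⟩
        exact ⟨h, S₁, k₁, k₂, C₁, C₂, hh, hlt, h1.2, h2.2⟩
    rw [hrw]
    have hm : ∀ k' S C, Measurable fun w : J → Fin p → ℝ => k' < k ∧ IsTrace w k' S C := by
      intro k' S C
      by_cases hk : k' < k
      · simpa [hk] using ih k' hk S C
      · simp [hk]
    refine measurable_const.or (Measurable.exists fun h => Measurable.exists fun S₁ =>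
      Measurable.exists fun k₁ => Measurable.exists fun k₂ => Measurable.exists fun C₁ =>
      Measurable.exists fun C₂ => measurable_const.and (Measurable.and ?_
        ((hm _ _ _).and (hm _ _ _))))
    refine Measurable.forall fun i => measurable_const.imp (Measurable.forall fun j =>
      measurable_const.imp ?_)
    exact measurableSet_setOfPred.1 (measurableSet_lt (by fun_prop) (by fun_prop))

open Classical in
/-- The traces with exactly `k` leaves on the set `S` of points. -/
noncomputable def traces (w : J → Fin p → ℝ) (k : ℕ) (S : Finset J) : Finset (Finset J) :=
  S.powerset.filter (IsTrace w k S)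

lemma mem_traces {w : J → Fin p → ℝ} {k : ℕ} {S C : Finset J} :
    C ∈ traces w k S ↔ IsTrace w k S C := by
  simp only [traces, Finset.mem_filter, Finset.mem_powerset]
  exact ⟨fun h => h.2, fun h => ⟨h.subset, h⟩⟩

end Trace

section TraceCount

/-- A bound for the number of traces with `k` leaves on `s` points: `traceBound p d k s` satisfies
the recursion of the number of cut trees of height at most `d`, counted by the numbers of points in
their leaves. -/
def traceBound (p : ℕ) : ℕ → ℕ → ℕ → ℝ
  | 0, _, _ => 0
  | d + 1, k, s => (if k = 1 then 2 else 0) +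
      p * ∑ κ ∈ Finset.HasAntidiagonal.antidiagonal k,
        ∑ σ ∈ Finset.HasAntidiagonal.antidiagonal s,
        traceBound p d κ.1 σ.1 * traceBound p d κ.2 σ.2

lemma traceBound_nonneg (p d k s : ℕ) : 0 ≤ traceBound p d k s := by
  induction d generalizing k s with
  | zero => exact le_rfl
  | succ d ih =>
    have : 0 ≤ ∑ κ ∈ Finset.HasAntidiagonal.antidiagonal k,
        ∑ σ ∈ Finset.HasAntidiagonal.antidiagonal s,
        traceBound p d κ.1 σ.1 * traceBound p d κ.2 σ.2 :=
      Finset.sum_nonneg fun κ _ => Finset.sum_nonneg fun σ _ => mul_nonneg (ih _ _) (ih _ _)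
    simp only [traceBound]
    split_ifs <;> positivity

lemma sum_range_antidiagonal_le (F : ℕ → ℕ → ℝ) (hF : ∀ i j, 0 ≤ F i j) (N : ℕ) :
    ∑ n ∈ Finset.range N, ∑ κ ∈ Finset.HasAntidiagonal.antidiagonal n, F κ.1 κ.2 ≤
      ∑ i ∈ Finset.range N, ∑ j ∈ Finset.range N, F i j := by
  rw [← Finset.sum_product', ← Finset.sum_biUnion]
  · refine Finset.sum_le_sum_of_subset_of_nonneg ?_ fun _ _ _ => hF _ _
    intro κ hκ
    simp only [Finset.mem_biUnion, Finset.mem_range, Finset.HasAntidiagonal.mem_antidiagonal,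
      Finset.mem_product] at hκ ⊢
    omega
  · intro i _ j _ hij
    rw [Function.onFun, Finset.disjoint_left]
    intro κ h1 h2
    rw [Finset.HasAntidiagonal.mem_antidiagonal] at h1 h2
    exact hij (h1.symm.trans h2)

/-- The generating function of the bounds is at most `4y/(1-x)`: the recursion turns into the
quadratic inequality `G ≤ 2y/(1-x) + p G²`. -/
lemma sum_traceBound_le (p : ℕ) {x y : ℝ} (hx0 : 0 < x) (hx1 : x < 1) (hy : 0 < y)
    (hxy : 8 * p * y ≤ 1 - x) (d K N : ℕ) :
    ∑ k ∈ Finset.range K, ∑ s ∈ Finset.range N, traceBound p d k s * x ^ s * y ^ k ≤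
      4 * y / (1 - x) := by
  have h1x : 0 < 1 - x := by linarith
  induction d with
  | zero => simp [traceBound]; positivity
  | succ d ih =>
    set G := ∑ k ∈ Finset.range K, ∑ s ∈ Finset.range N, traceBound p d k s * x ^ s * y ^ k with hG
    have hG0 : 0 ≤ G := Finset.sum_nonneg fun k _ => Finset.sum_nonneg fun s _ => by
      have := traceBound_nonneg p d k s
      positivity
    have hgeo : ∑ s ∈ Finset.range N, x ^ s ≤ 1 / (1 - x) := by
      rw [geom_sum_eq hx1.ne, ← neg_div_neg_eq, neg_sub, neg_sub]
      have : 0 ≤ x ^ N := by positivity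
      gcongr
      linarith
    have hleaf : ∑ k ∈ Finset.range K, ∑ s ∈ Finset.range N,
        (if k = 1 then (2 : ℝ) else 0) * x ^ s * y ^ k ≤ 2 * y / (1 - x) := by
      calc _ = ∑ k ∈ Finset.range K, if k = 1 then 2 * y * ∑ s ∈ Finset.range N, x ^ s else 0 := by
            refine Finset.sum_congr rfl fun k _ => ?_
            split_ifs with hk
            · rw [Finset.mul_sum]
              exact Finset.sum_congr rfl fun s _ => by rw [hk]; ring
            · simp
        _ ≤ 2 * y * ∑ s ∈ Finset.range N, x ^ s := by
            have : 0 ≤ ∑ s ∈ Finset.range N, x ^ s := Finset.sum_nonneg fun s _ => by positivity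
            rw [Finset.sum_ite_eq']
            split_ifs
            · exact le_rfl
            · positivity
        _ ≤ 2 * y * (1 / (1 - x)) := by gcongr
        _ = _ := by ring
    have hprod : ∑ k ∈ Finset.range K, ∑ s ∈ Finset.range N,
        (∑ κ ∈ Finset.HasAntidiagonal.antidiagonal k,
          ∑ σ ∈ Finset.HasAntidiagonal.antidiagonal s,
          traceBound p d κ.1 σ.1 * traceBound p d κ.2 σ.2) * x ^ s * y ^ k ≤ G ^ 2 := by
      set f : ℕ → ℕ → ℝ := fun k s => traceBound p d k s * x ^ s * y ^ k with hf
      have hf0 : ∀ k s, 0 ≤ f k s := fun k s => by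
        have := traceBound_nonneg p d k s
        simp only [hf]; positivity
      calc _ = ∑ k ∈ Finset.range K, ∑ κ ∈ Finset.HasAntidiagonal.antidiagonal k,
            ∑ s ∈ Finset.range N, ∑ σ ∈ Finset.HasAntidiagonal.antidiagonal s,
              f κ.1 σ.1 * f κ.2 σ.2 := by
            refine Finset.sum_congr rfl fun k _ => ?_
            rw [Finset.sum_comm]
            refine Finset.sum_congr rfl fun s _ => ?_
            rw [Finset.sum_mul, Finset.sum_mul]
            refine Finset.sum_congr rfl fun κ hκ => ?_
            rw [Finset.sum_mul, Finset.sum_mul]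
            refine Finset.sum_congr rfl fun σ hσ => ?_
            rw [← Finset.HasAntidiagonal.mem_antidiagonal.1 hκ,
              ← Finset.HasAntidiagonal.mem_antidiagonal.1 hσ]
            simp only [hf]; ring
        _ ≤ ∑ k ∈ Finset.range K, ∑ κ ∈ Finset.HasAntidiagonal.antidiagonal k,
            ∑ s ∈ Finset.range N, ∑ s' ∈ Finset.range N, f κ.1 s * f κ.2 s' :=
            Finset.sum_le_sum fun k _ => Finset.sum_le_sum fun κ _ =>
              sum_range_antidiagonal_le (fun s s' => f κ.1 s * f κ.2 s')
                (fun s s' => mul_nonneg (hf0 _ _) (hf0 _ _)) N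
        _ ≤ ∑ k ∈ Finset.range K, ∑ k' ∈ Finset.range K,
            ∑ s ∈ Finset.range N, ∑ s' ∈ Finset.range N, f k s * f k' s' :=
            sum_range_antidiagonal_le
              (fun k k' => ∑ s ∈ Finset.range N, ∑ s' ∈ Finset.range N, f k s * f k' s')
              (fun k k' => Finset.sum_nonneg fun s _ => Finset.sum_nonneg fun s' _ =>
                mul_nonneg (hf0 _ _) (hf0 _ _)) K
        _ = G ^ 2 := by
            rw [sq, hG, Finset.sum_mul_sum]
            refine Finset.sum_congr rfl fun k _ => Finset.sum_congr rfl fun k' _ => ?_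
            rw [Finset.sum_mul_sum]
    calc _ = ∑ k ∈ Finset.range K, ∑ s ∈ Finset.range N,
            (if k = 1 then (2 : ℝ) else 0) * x ^ s * y ^ k +
          p * ∑ k ∈ Finset.range K, ∑ s ∈ Finset.range N,
            (∑ κ ∈ Finset.HasAntidiagonal.antidiagonal k,
              ∑ σ ∈ Finset.HasAntidiagonal.antidiagonal s,
              traceBound p d κ.1 σ.1 * traceBound p d κ.2 σ.2) * x ^ s * y ^ k := by
          rw [Finset.mul_sum, ← Finset.sum_add_distrib]
          refine Finset.sum_congr rfl fun k _ => ?_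
          rw [Finset.mul_sum, ← Finset.sum_add_distrib]
          refine Finset.sum_congr rfl fun s _ => ?_
          simp only [traceBound]; ring
      _ ≤ 2 * y / (1 - x) + p * G ^ 2 := by gcongr
      _ ≤ 2 * y / (1 - x) + p * (4 * y / (1 - x)) ^ 2 := by gcongr
      _ = 2 * y / (1 - x) + (8 * p * y) * (2 * y / (1 - x) ^ 2) := by
          rw [div_pow]; ring
      _ ≤ 2 * y / (1 - x) + (1 - x) * (2 * y / (1 - x) ^ 2) := by gcongr
      _ = 4 * y / (1 - x) := by field_simp; ring

variable {p : ℕ} {J : Type*} [DecidableEq J]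

open Classical in
/-- The subsets of `S` that a cut orthogonal to the direction `h` puts on its left. They form a
chain, hence are determined by their cardinality. -/
noncomputable def cutSets (w : J → Fin p → ℝ) (h : Fin p) (S : Finset J) : Finset (Finset J) :=
  S.powerset.filter fun S₁ => ∀ i ∈ S₁, ∀ j ∈ S \ S₁, w i h < w j h

lemma card_injOn_cutSets (w : J → Fin p → ℝ) (h : Fin p) (S : Finset J) :
    Set.InjOn Finset.card (cutSets w h S : Set (Finset J)) := by
  intro S₁ h₁ S₂ h₂ hc
  simp only [cutSets, Finset.coe_filter, Finset.mem_powerset, Set.mem_ofPred_eq,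
    Finset.mem_sdiff] at h₁ h₂
  by_contra hne
  have h12 : ¬ S₁ ⊆ S₂ := fun hs => hne (Finset.eq_of_subset_of_card_le hs hc.ge)
  have h21 : ¬ S₂ ⊆ S₁ := fun hs => hne (Finset.eq_of_subset_of_card_le hs hc.le).symm
  obtain ⟨i, hi1, hi2⟩ := Finset.not_subset.1 h12
  obtain ⟨j, hj2, hj1⟩ := Finset.not_subset.1 h21
  exact lt_asymm (h₁.2 i hi1 j ⟨h₂.1 hj2, hj1⟩) (h₂.2 j hj2 i ⟨h₁.1 hi1, hi2⟩)

lemma sum_cutSets_le (w : J → Fin p → ℝ) (h : Fin p) (S : Finset J) (F : ℕ → ℕ → ℝ)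
    (hF : ∀ i j, 0 ≤ F i j) :
    ∑ S₁ ∈ cutSets w h S, F S₁.card (S \ S₁).card ≤
      ∑ σ ∈ Finset.HasAntidiagonal.antidiagonal S.card, F σ.1 σ.2 := by
  have hinj : Set.InjOn (fun S₁ : Finset J => (S₁.card, (S \ S₁).card))
      (cutSets w h S : Set (Finset J)) := fun S₁ h₁ S₂ h₂ he =>
    card_injOn_cutSets w h S h₁ h₂ (Prod.ext_iff.1 he).1
  rw [← Finset.sum_image (f := fun σ : ℕ × ℕ => F σ.1 σ.2) hinj]
  refine Finset.sum_le_sum_of_subset_of_nonneg ?_ fun _ _ _ => hF _ _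
  intro σ hσ
  obtain ⟨S₁, hS, rfl⟩ := Finset.mem_image.1 hσ
  simp only [cutSets, Finset.mem_filter, Finset.mem_powerset] at hS
  rw [Finset.HasAntidiagonal.mem_antidiagonal, add_comm]
  exact Finset.card_sdiff_add_card_eq_card hS.1

lemma card_traces_le_traceBound (w : J → Fin p → ℝ) (d k : ℕ) (hk : k ≤ d) (S : Finset J) :
    ((traces w k S).card : ℝ) ≤ traceBound p d k S.card := by
  induction d generalizing k S with
  | zero =>
    have : traces w k S = ∅ := Finset.eq_empty_of_forall_notMem fun C hC => by
      have := (mem_traces.1 hC).pos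
      omega
    simp [this, traceBound]
  | succ d ih =>
    have hsub : traces w k S ⊆ (if k = 1 then {∅, S} else ∅) ∪
        (Finset.univ : Finset (Fin p)).biUnion fun h =>
          (Finset.HasAntidiagonal.antidiagonal k).biUnion fun κ =>
            (cutSets w h S).biUnion fun S₁ =>
              Finset.image₂ (· ∪ ·) (traces w κ.1 S₁) (traces w κ.2 (S \ S₁)) := by
      intro C hC
      rw [mem_traces, isTrace_iff] at hC
      rcases hC with ⟨rfl, hC⟩ | ⟨h, S₁, k₁, k₂, C₁, C₂, ⟨hS, hk', rfl⟩, hlt, h1, h2⟩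
      · refine Finset.mem_union_left _ ?_
        simpa using hC
      · refine Finset.mem_union_right _ ?_
        simp only [Finset.mem_biUnion, Finset.mem_univ, true_and]
        refine ⟨h, (k₁, k₂), by simpa using hk', S₁, ?_, Finset.mem_image₂_of_mem
          (mem_traces.2 h1) (mem_traces.2 h2)⟩
        simp only [cutSets, Finset.mem_filter, Finset.mem_powerset]
        exact ⟨hS, hlt⟩
    have hb := traceBound_nonneg p d
    have hterm : ∀ κ ∈ Finset.HasAntidiagonal.antidiagonal k, ∀ S₁ : Finset J,
        ((Finset.image₂ (· ∪ ·) (traces w κ.1 S₁) (traces w κ.2 (S \ S₁))).card : ℝ) ≤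
          traceBound p d κ.1 S₁.card * traceBound p d κ.2 (S \ S₁).card := by
      intro κ hκ S₁
      have hκ' := Finset.HasAntidiagonal.mem_antidiagonal.1 hκ
      have hzero : ∀ S' : Finset J, traces w 0 S' = ∅ := fun S' =>
        Finset.eq_empty_of_forall_notMem fun C hC => by
          have := (mem_traces.1 hC).pos
          omega
      rcases Nat.eq_zero_or_pos κ.1 with h0 | h0
      · rw [h0, hzero]
        simpa using mul_nonneg (hb _ _) (hb _ _)
      rcases Nat.eq_zero_or_pos κ.2 with h0' | h0'
      · rw [h0', hzero]
        simpa using mul_nonneg (hb _ _) (hb _ _)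
      calc _ ≤ ((traces w κ.1 S₁).card : ℝ) * (traces w κ.2 (S \ S₁)).card := by
            exact_mod_cast Finset.card_image₂_le _ _ _
        _ ≤ _ := mul_le_mul (ih _ (by omega) _) (ih _ (by omega) _) (by positivity) (hb _ _)
    calc ((traces w k S).card : ℝ)
        ≤ ((if k = 1 then {∅, S} else ∅ : Finset (Finset J)).card : ℝ) +
          ∑ h : Fin p, ∑ κ ∈ Finset.HasAntidiagonal.antidiagonal k, ∑ S₁ ∈ cutSets w h S,
            ((Finset.image₂ (· ∪ ·) (traces w κ.1 S₁) (traces w κ.2 (S \ S₁))).card : ℝ) := by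
          have := (Finset.card_le_card hsub).trans (Finset.card_union_le _ _)
          refine le_trans (Nat.cast_le.2 this) ?_
          push_cast
          gcongr
          refine le_trans (Nat.cast_le.2 Finset.card_biUnion_le) ?_
          push_cast
          refine Finset.sum_le_sum fun h _ => le_trans (Nat.cast_le.2 Finset.card_biUnion_le) ?_
          push_cast
          refine Finset.sum_le_sum fun κ _ => le_trans (Nat.cast_le.2 Finset.card_biUnion_le) ?_
          push_cast
          exact le_rfl
      _ ≤ (if k = 1 then 2 else 0) + ∑ h : Fin p, ∑ κ ∈ Finset.HasAntidiagonal.antidiagonal k,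
          ∑ σ ∈ Finset.HasAntidiagonal.antidiagonal S.card,
            traceBound p d κ.1 σ.1 * traceBound p d κ.2 σ.2 := by
          refine add_le_add ?_ (Finset.sum_le_sum fun h _ => Finset.sum_le_sum fun κ hκ => ?_)
          · split_ifs
            · exact_mod_cast Finset.card_le_two
            · simp
          · exact (Finset.sum_le_sum fun S₁ _ => hterm κ hκ S₁).trans
              (sum_cutSets_le w h S (fun i j => traceBound p d κ.1 i * traceBound p d κ.2 j)
                fun i j => mul_nonneg (hb _ _) (hb _ _))
      _ = traceBound p (d + 1) k S.card := by
          simp [traceBound]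

/-- The traces with at most `k` leaves on the set `S` of points. -/
noncomputable def tracesLE (w : J → Fin p → ℝ) (k : ℕ) (S : Finset J) : Finset (Finset J) :=
  (Finset.range (k + 1)).biUnion fun k' => traces w k' S

lemma mem_tracesLE {w : J → Fin p → ℝ} {k : ℕ} {S C : Finset J} :
    C ∈ tracesLE w k S ↔ ∃ k' ≤ k, IsTrace w k' S C := by
  simp only [tracesLE, Finset.mem_biUnion, Finset.mem_range, mem_traces, Nat.lt_succ_iff]

/-- The number of traces with at most `k` leaves on `s` points is at most
`(1 - θ)⁻ˢ (8p/θ)ᵏ`, hence `exp(o(s))` when `k = o(s)`. A tree is determined by its shape, the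
directions of its cuts, its labels and the numbers of points in its leaves; this replaces the much
larger number of thresholds. -/
lemma card_tracesLE_le (hp : 1 ≤ p) (w : J → Fin p → ℝ) (k : ℕ) (S : Finset J) {θ : ℝ}
    (hθ0 : 0 < θ) (hθ1 : θ < 1) :
    ((tracesLE w k S).card : ℝ) ≤ ((1 - θ)⁻¹) ^ S.card * (8 * p / θ) ^ k := by
  have hp' : (1 : ℝ) ≤ p := by exact_mod_cast hp
  have hx : 0 < 1 - θ := by linarith
  set y : ℝ := θ / (8 * p) with hy
  have hy0 : 0 < y := by positivity
  have hy1 : y ≤ 1 := by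
    rw [hy, div_le_one (by positivity)]
    linarith
  have hsum : ((tracesLE w k S).card : ℝ) * ((1 - θ) ^ S.card * y ^ k) ≤ 1 := by
    calc ((tracesLE w k S).card : ℝ) * ((1 - θ) ^ S.card * y ^ k)
        ≤ (∑ k' ∈ Finset.range (k + 1), traceBound p k k' S.card) *
            ((1 - θ) ^ S.card * y ^ k) := by
          gcongr
          refine le_trans (Nat.cast_le.2 Finset.card_biUnion_le) ?_
          push_cast
          refine Finset.sum_le_sum fun k' hk' => card_traces_le_traceBound w k k' ?_ S
          exact Nat.lt_succ_iff.1 (Finset.mem_range.1 hk')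
      _ ≤ ∑ k' ∈ Finset.range (k + 1), traceBound p k k' S.card * (1 - θ) ^ S.card * y ^ k' := by
          rw [Finset.sum_mul]
          refine Finset.sum_le_sum fun k' hk' => ?_
          have := traceBound_nonneg p k k' S.card
          rw [← mul_assoc]
          exact mul_le_mul_of_nonneg_left
            (pow_le_pow_of_le_one hy0.le hy1 (Nat.lt_succ_iff.1 (Finset.mem_range.1 hk')))
            (by positivity)
      _ ≤ ∑ k' ∈ Finset.range (k + 1), ∑ s ∈ Finset.range (S.card + 1),
            traceBound p k k' s * (1 - θ) ^ s * y ^ k' := by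
          refine Finset.sum_le_sum fun k' _ => ?_
          refine Finset.single_le_sum
            (f := fun s => traceBound p k k' s * (1 - θ) ^ s * y ^ k') (fun s _ => ?_)
            (Finset.self_mem_range_succ _)
          have := traceBound_nonneg p k k' s
          positivity
      _ ≤ 4 * y / (1 - (1 - θ)) := sum_traceBound_le p hx (by linarith) hy0 (by
          rw [hy]; field_simp; linarith) _ _ _
      _ ≤ 1 := by
          rw [hy, div_le_one (by linarith)]
          field_simp
          nlinarith
  have h2 : ((1 - θ)⁻¹) ^ S.card * (8 * p / θ) ^ k = ((1 - θ) ^ S.card * y ^ k)⁻¹ := by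
    rw [mul_inv, ← inv_pow, ← inv_pow, hy, inv_div]
  rw [h2]
  rwa [← one_div, le_div_iff₀ (by positivity)]

end TraceCount

/-! ### Random signs -/

lemma sum_exp_sum_sign {n : ℕ} (c : Fin n → ℝ) :
    ∑ τ : Fin n → Bool, Real.exp (∑ i, if τ i then c i else - c i) ≤
      2 ^ n * Real.exp ((∑ i, c i ^ 2) / 2) := by
  calc ∑ τ : Fin n → Bool, Real.exp (∑ i, if τ i then c i else - c i)
      = ∑ τ : Fin n → Bool, ∏ i, Real.exp (if τ i then c i else - c i) := by
        simp_rw [Real.exp_sum]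
    _ = ∏ i, ∑ b : Bool, Real.exp (if b then c i else - c i) := by
        rw [Finset.prod_univ_sum, Fintype.piFinset_univ]
    _ = ∏ i, (2 * Real.cosh (c i)) := by
        refine Finset.prod_congr rfl fun i _ => ?_
        rw [Real.cosh_eq]
        simp
        ring
    _ ≤ ∏ i : Fin n, (2 * Real.exp (c i ^ 2 / 2)) := by
        refine Finset.prod_le_prod (fun i _ => ?_) fun i _ => ?_
        · have := Real.cosh_pos (c i)
          positivity
        · gcongr
          exact Real.cosh_le_exp_half_sq _
    _ = 2 ^ n * Real.exp ((∑ i, c i ^ 2) / 2) := by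
        rw [Finset.prod_mul_distrib, ← Real.exp_sum, Finset.sum_div]
        simp

/-- Hoeffding's inequality for random signs. -/
lemma card_sign_sum_gt_le {n : ℕ} (c : Fin n → ℝ) {t V : ℝ} (ht : 0 ≤ t) (hV : 0 < V)
    (hc : ∑ i, c i ^ 2 ≤ V) :
    ((Finset.univ.filter fun τ : Fin n → Bool =>
      t < |∑ i, if τ i then c i else - c i|).card : ℝ) ≤
      2 ^ n * (2 * Real.exp (- (t ^ 2 / (2 * V)))) := by
  set u : (Fin n → Bool) → ℝ := fun τ => ∑ i, if τ i then c i else - c i with hu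
  -- the optimal exponent in the Chernoff bound
  set l := t / V with hl
  have hl0 : 0 ≤ l := by positivity
  have key : ∀ s : ℝ, s ^ 2 = 1 → ∑ τ : Fin n → Bool, Real.exp (s * l * u τ) ≤
      2 ^ n * Real.exp (l ^ 2 * V / 2) := by
    intro s hs
    have h := sum_exp_sum_sign fun i => s * l * c i
    have h1 : ∀ τ : Fin n → Bool, ∑ i, (if τ i then s * l * c i else - (s * l * c i)) =
        s * l * u τ := by
      intro τ
      rw [hu, Finset.mul_sum]
      refine Finset.sum_congr rfl fun i _ => ?_
      split_ifs <;> ring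
    simp_rw [h1] at h
    refine h.trans ?_
    have h2 : ∑ i, (s * l * c i) ^ 2 = l ^ 2 * ∑ i, c i ^ 2 := by
      rw [Finset.mul_sum]
      refine Finset.sum_congr rfl fun i _ => ?_
      rw [mul_pow, mul_pow, hs, one_mul]
    rw [h2]
    gcongr
  have hpt : ∀ τ ∈ Finset.univ.filter fun τ : Fin n → Bool => t < |u τ|,
      Real.exp (l * t) ≤ Real.exp (1 * l * u τ) + Real.exp (-1 * l * u τ) := by
    intro τ hτ
    have h := (Finset.mem_filter.1 hτ).2
    rcases lt_abs.1 h with h | h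
    · have : Real.exp (l * t) ≤ Real.exp (1 * l * u τ) := by
        rw [one_mul]; gcongr
      linarith [Real.exp_pos (-1 * l * u τ)]
    · have : Real.exp (l * t) ≤ Real.exp (-1 * l * u τ) := by
        rw [Real.exp_le_exp]; nlinarith
      linarith [Real.exp_pos (1 * l * u τ)]
  have hsum : ((Finset.univ.filter fun τ : Fin n → Bool => t < |u τ|).card : ℝ) *
      Real.exp (l * t) ≤ 2 * (2 ^ n * Real.exp (l ^ 2 * V / 2)) := by
    rw [← nsmul_eq_mul]
    calc _ ≤ ∑ τ ∈ Finset.univ.filter fun τ : Fin n → Bool => t < |u τ|,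
          (Real.exp (1 * l * u τ) + Real.exp (-1 * l * u τ)) :=
          Finset.card_nsmul_le_sum _ _ _ hpt
      _ ≤ ∑ τ : Fin n → Bool, (Real.exp (1 * l * u τ) + Real.exp (-1 * l * u τ)) :=
          Finset.sum_le_sum_of_subset_of_nonneg (Finset.subset_univ _) fun _ _ _ => by positivity
      _ ≤ _ := by
          rw [Finset.sum_add_distrib, two_mul]
          exact add_le_add (key 1 (by norm_num)) (key (-1) (by norm_num))
  have hfin : 2 ^ n * (2 * Real.exp (- (t ^ 2 / (2 * V)))) * Real.exp (l * t) =
      2 * (2 ^ n * Real.exp (l ^ 2 * V / 2)) := by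
    have : Real.exp (- (t ^ 2 / (2 * V))) * Real.exp (l * t) = Real.exp (l ^ 2 * V / 2) := by
      rw [← Real.exp_add, hl]
      congr 1
      field_simp
      ring
    rw [← this]; ring
  rw [← hfin] at hsum
  exact le_of_mul_le_mul_right hsum (Real.exp_pos _)

/-! ### The CART criterion -/

section Cart

variable {n p : ℕ} (D : Data n p)

/-- The residual sum of squares of the responses over `J`. -/
noncomputable def residual (J : Finset (Fin n)) : ℝ :=
  ∑ i ∈ J, (resp D i - meanResp D J) ^ 2

lemma residual_nonneg (J : Finset (Fin n)) : 0 ≤ residual D J :=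
  Finset.sum_nonneg fun _ _ => sq_nonneg _

lemma card_mul_meanResp (J : Finset (Fin n)) :
    (J.card : ℝ) * meanResp D J = ∑ i ∈ J, resp D i := by
  rcases J.eq_empty_or_nonempty with rfl | hJ
  · simp
  · have : (J.card : ℝ) ≠ 0 := by exact_mod_cast hJ.card_pos.ne'
    rw [meanResp]
    field_simp

lemma sum_resp_sub (J : Finset (Fin n)) (u : ℝ) :
    ∑ i ∈ J, (resp D i - u) = J.card * (meanResp D J - u) := by
  rw [Finset.sum_sub_distrib, ← card_mul_meanResp]
  simp
  ring

lemma sum_sq_sub_eq (J : Finset (Fin n)) (u : ℝ) :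
    ∑ i ∈ J, (resp D i - u) ^ 2 = residual D J + (∑ i ∈ J, (resp D i - u)) ^ 2 / J.card := by
  rcases J.eq_empty_or_nonempty with rfl | hJ
  · simp [residual]
  have hc : (J.card : ℝ) ≠ 0 := by exact_mod_cast hJ.card_pos.ne'
  have h0 : ∑ i ∈ J, (resp D i - meanResp D J) = 0 := by
    rw [sum_resp_sub, sub_self, mul_zero]
  have h1 : ∑ i ∈ J, (resp D i - u) ^ 2 = residual D J +
      2 * (meanResp D J - u) * ∑ i ∈ J, (resp D i - meanResp D J) +
        J.card * (meanResp D J - u) ^ 2 := by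
    have h2 : (J.card : ℝ) * (meanResp D J - u) ^ 2 = ∑ i ∈ J, (meanResp D J - u) ^ 2 := by
      simp
    rw [h2, residual, Finset.mul_sum, ← Finset.sum_add_distrib, ← Finset.sum_add_distrib]
    refine Finset.sum_congr rfl fun i _ => ?_
    ring
  rw [h1, h0, sum_resp_sub]
  field_simp
  ring

lemma residual_le_sum_sq_sub (J : Finset (Fin n)) (u : ℝ) :
    residual D J ≤ ∑ i ∈ J, (resp D i - u) ^ 2 := by
  rw [sum_sq_sub_eq D J u]
  have : 0 ≤ (∑ i ∈ J, (resp D i - u)) ^ 2 / (J.card : ℝ) := by positivity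
  linarith

lemma residual_le_sum_sq (J : Finset (Fin n)) : residual D J ≤ ∑ i ∈ J, resp D i ^ 2 := by
  simpa using residual_le_sum_sq_sub D J 0

variable (I : Finset (Fin n)) (c : Split n p)

open Classical in
lemma leftObs_subset : leftObs D I c ⊆ I := Finset.filter_subset _ _

lemma rightObs_eq : rightObs D I c = I \ leftObs D I c := by
  ext i
  simp only [rightObs, leftObs, Finset.mem_filter, Finset.mem_sdiff]
  by_cases hm : IsMissing D i c.1
  · simp [hm]
    tauto
  · simp [hm]
    tauto

open Classical in
lemma rightObs_subset : rightObs D I c ⊆ I := Finset.filter_subset _ _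

lemma sum_left_add_sum_right (f : Fin n → ℝ) :
    ∑ i ∈ leftObs D I c, f i + ∑ i ∈ rightObs D I c, f i = ∑ i ∈ I, f i := by
  rw [rightObs_eq, add_comm, Finset.sum_sdiff (leftObs_subset D I c)]

lemma card_left_add_card_right :
    (leftObs D I c).card + (rightObs D I c).card = I.card := by
  rw [rightObs_eq, add_comm, Finset.card_sdiff_add_card_eq_card (leftObs_subset D I c)]

lemma card_mul_cart :
    I.card * cart D I c = residual D I - residual D (leftObs D I c) -
      residual D (rightObs D I c) := by
  rcases I.eq_empty_or_nonempty with rfl | hI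
  · simp [residual, leftObs, rightObs]
  · have : (I.card : ℝ) ≠ 0 := by exact_mod_cast hI.card_pos.ne'
    simp only [cart, residual]
    field_simp

lemma residual_left_add_right_le :
    residual D (leftObs D I c) + residual D (rightObs D I c) ≤ residual D I := by
  have h1 := residual_le_sum_sq_sub D (leftObs D I c) (meanResp D I)
  have h2 := residual_le_sum_sq_sub D (rightObs D I c) (meanResp D I)
  have h3 := sum_left_add_sum_right D I c fun i => (resp D i - meanResp D I) ^ 2
  simp only [residual] at *
  linarith

/-- The criterion controls how far the left cell is from the mean of the cell. -/
lemma sq_sum_left_le :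
    (∑ i ∈ leftObs D I c, (resp D i - meanResp D I)) ^ 2 ≤ (I.card : ℝ) ^ 2 * cart D I c := by
  set S := ∑ i ∈ leftObs D I c, (resp D i - meanResp D I) with hS
  rcases (leftObs D I c).eq_empty_or_nonempty with hL | hL
  · have h1 := card_mul_cart D I c
    have h2 := residual_left_add_right_le D I c
    have h3 : 0 ≤ (I.card : ℝ) * (I.card * cart D I c) := by
      have : 0 ≤ (I.card : ℝ) * cart D I c := by linarith
      positivity
    rw [hS, hL, Finset.sum_empty]
    nlinarith
  have hLpos : (0 : ℝ) < (leftObs D I c).card := by exact_mod_cast hL.card_pos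
  have hLI : ((leftObs D I c).card : ℝ) ≤ I.card := by
    exact_mod_cast Finset.card_le_card (leftObs_subset D I c)
  have e1 := sum_sq_sub_eq D (leftObs D I c) (meanResp D I)
  have e2 := residual_le_sum_sq_sub D (rightObs D I c) (meanResp D I)
  have e3 := sum_left_add_sum_right D I c fun i => (resp D i - meanResp D I) ^ 2
  have e4 := card_mul_cart D I c
  have e5 : S ^ 2 / (leftObs D I c).card ≤ I.card * cart D I c := by
    rw [← hS] at e1
    simp only [residual] at *
    linarith
  have e6 : S ^ 2 / I.card ≤ S ^ 2 / (leftObs D I c).card := by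
    gcongr
  have hI : (0 : ℝ) < I.card := hLpos.trans_le hLI
  have e7 := e6.trans e5
  rw [div_le_iff₀ hI] at e7
  linarith

lemma abs_sum_left_eq_abs_sum_right :
    |∑ i ∈ leftObs D I c, (resp D i - meanResp D I)| =
      |∑ i ∈ rightObs D I c, (resp D i - meanResp D I)| := by
  have h := sum_left_add_sum_right D I c fun i => resp D i - meanResp D I
  rw [sum_resp_sub D I, sub_self, mul_zero] at h
  rw [eq_neg_of_add_eq_zero_left h, abs_neg]

lemma sq_sum_sub_le_card_mul {J : Finset (Fin n)} (hJ : J ⊆ I) :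
    (∑ i ∈ J, (resp D i - meanResp D I)) ^ 2 ≤ J.card * ∑ i ∈ I, resp D i ^ 2 := by
  calc (∑ i ∈ J, (resp D i - meanResp D I)) ^ 2
      ≤ J.card * ∑ i ∈ J, (resp D i - meanResp D I) ^ 2 := sq_sum_le_card_mul_sum_sq
    _ ≤ J.card * residual D I := by
        gcongr
        exact Finset.sum_le_sum_of_subset_of_nonneg hJ fun _ _ _ => sq_nonneg _
    _ ≤ _ := by
        gcongr
        exact residual_le_sum_sq D I

end Cart

/-! ### Cells without a good split -/

section Settled

variable {n p : ℕ} (D : Data n p)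

/-- No admissible split, in whatever direction, has a gain above `η`. -/
def IsSettled (q : ℕ) (η : ℝ) (D : Data n p) (I : Finset (Fin n)) (A : Cell p) : Prop :=
  ∀ c, IsAdmissible q D I A Finset.univ c → cart D I c ≤ η

/-- The recorded values of the observations `I` lie in the cell `A`, which is open on the left. -/
def IsInside (D : Data n p) (I : Finset (Fin n)) (A : Cell p) : Prop :=
  (∀ h, A.1 h ≤ A.2 h) ∧
    ∀ i ∈ I, ∀ h, ¬ IsMissing D i h → A.1 h < value D i h ∧ value D i h ≤ A.2 h

/-- The vector of recorded values; it is the covariate when the observation is complete. -/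
def loc (D : Data n p) (i : Fin n) : Fin p → ℝ := fun h => value D i h

/-- The observation is complete: none of its coordinates is missing. -/
def IsComplete (D : Data n p) (i : Fin n) : Prop := ∀ h, ¬ IsMissing D i h

open Classical in
/-- The complete observations of `I`. -/
noncomputable def completeObs (D : Data n p) (I : Finset (Fin n)) : Finset (Fin n) :=
  I.filter (IsComplete D)

variable {D} {q : ℕ} {η : ℝ} {I : Finset (Fin n)} {A : Cell p}

open Classical in
lemma completeObs_subset : completeObs D I ⊆ I := Finset.filter_subset _ _

lemma IsInside.left {c : Split n p} (hIn : IsInside D I A) (h₁ : A.1 c.1 ≤ c.2.1) :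
    IsInside D (leftObs D I c) (leftCell A c) := by
  refine ⟨fun h => ?_, fun i hi h hm => ?_⟩
  · by_cases hh : h = c.1
    · subst hh; simpa [leftCell] using h₁
    · simpa [leftCell, hh] using hIn.1 h
  · simp only [leftObs, Finset.mem_filter] at hi
    have := hIn.2 i hi.1 h hm
    by_cases hh : h = c.1
    · subst hh
      simp only [hm, not_false_eq_true, true_and, false_and, or_false] at hi
      simpa [leftCell] using ⟨this.1, hi.2⟩
    · simpa [leftCell, hh] using this

lemma IsInside.right {c : Split n p} (hIn : IsInside D I A) (h₂ : c.2.1 ≤ A.2 c.1) :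
    IsInside D (rightObs D I c) (rightCell A c) := by
  refine ⟨fun h => ?_, fun i hi h hm => ?_⟩
  · by_cases hh : h = c.1
    · subst hh; simpa [rightCell] using h₂
    · simpa [rightCell, hh] using hIn.1 h
  · simp only [rightObs, Finset.mem_filter] at hi
    have := hIn.2 i hi.1 h hm
    by_cases hh : h = c.1
    · subst hh
      simp only [hm, not_false_eq_true, true_and, false_and, or_false] at hi
      simpa [rightCell] using ⟨hi.2, this.2⟩
    · simpa [rightCell, hh] using this

/-- In a settled cell every set of observations that a split can isolate is balanced, even when the
split is not admissible: it then isolates fewer than `q` observations. -/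
lemma IsSettled.abs_sum_left_le (hs : IsSettled q η D I A) (hη : 0 ≤ η)
    (hq : q * ∑ i ∈ I, resp D i ^ 2 ≤ η * (I.card : ℝ) ^ 2) {c : Split n p}
    (h₁ : A.1 c.1 ≤ c.2.1) (h₂ : c.2.1 ≤ A.2 c.1)
    (hW : ∀ i ∈ c.2.2, i ∈ I ∧ IsMissing D i c.1) :
    |∑ i ∈ leftObs D I c, (resp D i - meanResp D I)| ≤ √η * I.card := by
  have hr : (√η * I.card) ^ 2 = η * (I.card : ℝ) ^ 2 := by
    rw [mul_pow, Real.sq_sqrt hη]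
  have hr0 : 0 ≤ √η * I.card := by positivity
  have hY : 0 ≤ ∑ i ∈ I, resp D i ^ 2 := Finset.sum_nonneg fun _ _ => sq_nonneg _
  by_cases hL : q ≤ (leftObs D I c).card
  · by_cases hR : q ≤ (rightObs D I c).card
    · have hc := hs c ⟨Finset.mem_univ _, h₁, h₂, hW, hL, hR⟩
      refine abs_le_of_sq_le_sq ?_ hr0
      rw [hr]
      refine (sq_sum_left_le D I c).trans ?_
      rw [mul_comm]
      gcongr
    · rw [abs_sum_left_eq_abs_sum_right]
      refine abs_le_of_sq_le_sq ?_ hr0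
      rw [hr]
      refine (sq_sum_sub_le_card_mul D I (rightObs_subset D I c)).trans (le_trans ?_ hq)
      gcongr
      exact (not_le.1 hR).le
  · refine abs_le_of_sq_le_sq ?_ hr0
    rw [hr]
    refine (sq_sum_sub_le_card_mul D I (leftObs_subset D I c)).trans (le_trans ?_ hq)
    gcongr
    exact (not_le.1 hL).le

open Classical in
/-- The observations that miss the coordinate `h` can be isolated according to the sign of their
deviation, by a cut at the lower edge of the cell; so their responses are close to the mean. -/
lemma IsSettled.sum_missing_le (hs : IsSettled q η D I A) (hη : 0 ≤ η) (hIn : IsInside D I A)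
    (hq : q * ∑ i ∈ I, resp D i ^ 2 ≤ η * (I.card : ℝ) ^ 2) (h : Fin p) :
    ∑ i ∈ I.filter (fun i => IsMissing D i h), |resp D i - meanResp D I| ≤
      2 * (√η * I.card) := by
  have key : ∀ (P : Fin n → Prop) [DecidablePred P],
      |∑ i ∈ (I.filter fun i => IsMissing D i h).filter P, (resp D i - meanResp D I)| ≤
        √η * I.card := by
    intro P _
    have h1 := hs.abs_sum_left_le hη hq
      (c := (h, A.1 h, (I.filter fun i => IsMissing D i h).filter P)) le_rfl (hIn.1 h)
      (by simp +contextual)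
    have h2 : leftObs D I (h, A.1 h, (I.filter fun i => IsMissing D i h).filter P) =
        (I.filter fun i => IsMissing D i h).filter P := by
      ext i
      simp only [leftObs, Finset.mem_filter]
      constructor
      · rintro ⟨hi, ⟨hm, hv⟩ | ⟨-, hi'⟩⟩
        · exact absurd hv (not_le.2 (hIn.2 i hi h hm).1)
        · exact hi'
      · rintro ⟨⟨hi, hm⟩, hP⟩
        exact ⟨hi, Or.inr ⟨hm, ⟨hi, hm⟩, hP⟩⟩
    rwa [h2] at h1
  have h1 := key fun i => 0 ≤ resp D i - meanResp D I
  have h2 := key fun i => ¬ 0 ≤ resp D i - meanResp D I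
  rw [← Finset.sum_filter_add_sum_filter_not _ (fun i => 0 ≤ resp D i - meanResp D I)]
  have e1 : ∑ i ∈ (I.filter fun i => IsMissing D i h).filter
      (fun i => 0 ≤ resp D i - meanResp D I), |resp D i - meanResp D I| =
      ∑ i ∈ (I.filter fun i => IsMissing D i h).filter
      (fun i => 0 ≤ resp D i - meanResp D I), (resp D i - meanResp D I) :=
    Finset.sum_congr rfl fun i hi => abs_of_nonneg (Finset.mem_filter.1 hi).2
  have e2 : ∑ i ∈ (I.filter fun i => IsMissing D i h).filter
      (fun i => ¬ 0 ≤ resp D i - meanResp D I), |resp D i - meanResp D I| =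
      - ∑ i ∈ (I.filter fun i => IsMissing D i h).filter
      (fun i => ¬ 0 ≤ resp D i - meanResp D I), (resp D i - meanResp D I) := by
    rw [← Finset.sum_neg_distrib]
    exact Finset.sum_congr rfl fun i hi => abs_of_neg (not_le.1 (Finset.mem_filter.1 hi).2)
  rw [e1, e2]
  linarith [(abs_le.1 h1).2, (abs_le.1 h2).1]

lemma IsSettled.sum_incomplete_le (hs : IsSettled q η D I A) (hη : 0 ≤ η) (hIn : IsInside D I A)
    (hq : q * ∑ i ∈ I, resp D i ^ 2 ≤ η * (I.card : ℝ) ^ 2) :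
    ∑ i ∈ I \ completeObs D I, |resp D i - meanResp D I| ≤ 2 * p * (√η * I.card) := by
  classical
  calc ∑ i ∈ I \ completeObs D I, |resp D i - meanResp D I|
      ≤ ∑ i ∈ I \ completeObs D I, ∑ h : Fin p,
          if IsMissing D i h then |resp D i - meanResp D I| else 0 := by
        refine Finset.sum_le_sum fun i hi => ?_
        simp only [Finset.mem_sdiff, completeObs, Finset.mem_filter, IsComplete, not_and,
          not_forall, not_not] at hi
        obtain ⟨h, hh⟩ := hi.2 hi.1
        refine le_trans (by rw [if_pos hh]) (Finset.single_le_sum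
          (f := fun h => if IsMissing D i h then |resp D i - meanResp D I| else 0)
          (fun h _ => ?_) (Finset.mem_univ h))
        split_ifs <;> positivity
    _ ≤ ∑ i ∈ I, ∑ h : Fin p, if IsMissing D i h then |resp D i - meanResp D I| else 0 := by
        refine Finset.sum_le_sum_of_subset_of_nonneg Finset.sdiff_subset fun i _ _ =>
          Finset.sum_nonneg fun h _ => ?_
        split_ifs <;> positivity
    _ = ∑ h : Fin p, ∑ i ∈ I.filter (fun i => IsMissing D i h), |resp D i - meanResp D I| := by
        rw [Finset.sum_comm]
        exact Finset.sum_congr rfl fun h _ => (Finset.sum_filter _ _).symm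
    _ ≤ ∑ _h : Fin p, 2 * (√η * I.card) :=
        Finset.sum_le_sum fun h _ => hs.sum_missing_le hη hIn hq h
    _ = _ := by simp; ring

lemma sum_complete_add_sum_incomplete (f : Fin n → ℝ) :
    ∑ i ∈ completeObs D I, f i + ∑ i ∈ I \ completeObs D I, f i = ∑ i ∈ I, f i := by
  rw [add_comm, Finset.sum_sdiff completeObs_subset]

open Classical in
/-- In a settled cell the complete observations below any threshold are balanced. -/
lemma IsSettled.abs_sum_complete_le (hs : IsSettled q η D I A) (hη : 0 ≤ η)
    (hIn : IsInside D I A) (hq : q * ∑ i ∈ I, resp D i ^ 2 ≤ η * (I.card : ℝ) ^ 2)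
    (h : Fin p) (t : ℝ) :
    |∑ i ∈ (completeObs D I).filter (fun i => value D i h ≤ t), (resp D i - meanResp D I)| ≤
      (1 + 2 * p) * (√η * I.card) := by
  have hr0 : 0 ≤ √η * I.card := by positivity
  by_cases ht : t < A.1 h
  · rw [Finset.filter_false_of_mem]
    · simp only [Finset.sum_empty, abs_zero]
      positivity
    · intro i hi
      have := (hIn.2 i (completeObs_subset hi) h ((Finset.mem_filter.1 hi).2 h)).1
      exact not_le.2 (ht.trans this)
  rw [not_lt] at ht
  have h1 := hs.abs_sum_left_le hη hq (c := (h, min t (A.2 h), ∅)) (le_min ht (hIn.1 h))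
    (min_le_right _ _) (by simp)
  set L := leftObs D I (h, min t (A.2 h), ∅) with hL
  have h2 : L.filter (IsComplete D) =
      (completeObs D I).filter (fun i => value D i h ≤ t) := by
    ext i
    simp only [hL, leftObs, completeObs, Finset.mem_filter, Finset.notMem_empty, and_false,
      or_false, le_min_iff]
    constructor
    · rintro ⟨⟨hi, hm, hv⟩, hc⟩
      exact ⟨⟨hi, hc⟩, hv.1⟩
    · rintro ⟨⟨hi, hc⟩, hv⟩
      exact ⟨⟨hi, hc h, hv, (hIn.2 i hi h (hc h)).2⟩, hc⟩
  rw [← Finset.sum_filter_add_sum_filter_not L (IsComplete D), h2] at h1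
  have h3 : |∑ i ∈ L.filter (fun i => ¬ IsComplete D i), (resp D i - meanResp D I)| ≤
      2 * p * (√η * I.card) := by
    refine (Finset.abs_sum_le_sum_abs _ _).trans ((Finset.sum_le_sum_of_subset_of_nonneg ?_
      fun _ _ _ => abs_nonneg _).trans (hs.sum_incomplete_le hη hIn hq))
    intro i hi
    have hi' := Finset.mem_filter.1 hi
    simp only [Finset.mem_sdiff, completeObs, Finset.mem_filter, not_and]
    exact ⟨leftObs_subset D I _ hi'.1, fun _ => hi'.2⟩
  rw [abs_le] at *
  constructor <;> linarith [h1.1, h1.2, h3.1, h3.2]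

lemma IsSettled.abs_sum_complete_all_le (hs : IsSettled q η D I A) (hη : 0 ≤ η)
    (hIn : IsInside D I A) (hq : q * ∑ i ∈ I, resp D i ^ 2 ≤ η * (I.card : ℝ) ^ 2) :
    |∑ i ∈ completeObs D I, (resp D i - meanResp D I)| ≤ 2 * p * (√η * I.card) := by
  have h := sum_complete_add_sum_incomplete (D := D) (I := I) fun i => resp D i - meanResp D I
  rw [sum_resp_sub D I, sub_self, mul_zero] at h
  rw [eq_neg_of_add_eq_zero_left h, abs_neg]
  exact (Finset.abs_sum_le_sum_abs _ _).trans (hs.sum_incomplete_le hη hIn hq)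

lemma card_mul_abs_meanResp_le :
    I.card * |meanResp D I| ≤ I.card + ∑ i ∈ I, resp D i ^ 2 := by
  calc (I.card : ℝ) * |meanResp D I| = |∑ i ∈ I, resp D i| := by
        rw [← card_mul_meanResp, abs_mul, Nat.abs_cast]
    _ ≤ ∑ i ∈ I, |resp D i| := Finset.abs_sum_le_sum_abs _ _
    _ ≤ ∑ i ∈ I, (1 + resp D i ^ 2) := Finset.sum_le_sum fun i _ => by
        rw [← sq_abs]; nlinarith [sq_nonneg (|resp D i| - 1)]
    _ = _ := by rw [Finset.sum_add_distrib]; simp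

lemma sum_abs_resp_sub_le :
    ∑ i ∈ I, |resp D i - meanResp D I| ≤ 2 * (I.card + ∑ i ∈ I, resp D i ^ 2) := by
  calc ∑ i ∈ I, |resp D i - meanResp D I|
      ≤ ∑ i ∈ I, ((1 + resp D i ^ 2) + |meanResp D I|) := Finset.sum_le_sum fun i _ => by
        have : |resp D i| ≤ 1 + resp D i ^ 2 := by
          rw [← sq_abs]; nlinarith [sq_nonneg (|resp D i| - 1)]
        linarith [abs_sub (resp D i) (meanResp D I)]
    _ = (I.card + ∑ i ∈ I, resp D i ^ 2) + I.card * |meanResp D I| := by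
        rw [Finset.sum_add_distrib, Finset.sum_add_distrib]; simp
    _ ≤ _ := by linarith [card_mul_abs_meanResp_le (D := D) (I := I)]

/-- **A settled cell has a nearly constant regression function.** The deviation
`m - Ȳ` is tested against itself: by additivity and the approximation of each component by a step
function, this reduces to the balance of the complete observations below thresholds, and the noise
averages out. No independence between the coordinates is used. -/
lemma IsSettled.sum_sq_regression_sub_le (hs : IsSettled q η D I A) (hη : 0 ≤ η)
    (hIn : IsInside D I A) (hq : q * ∑ i ∈ I, resp D i ^ 2 ≤ η * (I.card : ℝ) ^ 2)
    (mc : Fin p → ℝ → ℝ) {N : ℕ} (t : ℕ → ℝ) (α : Fin p → ℕ → ℝ) {ω Λ ν : ℝ}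
    (hΛ : ∀ h, ∑ j ∈ Finset.range N, |α h j| ≤ Λ) (hω0 : 0 ≤ ω)
    (hstep : ∀ i ∈ completeObs D I, ∀ h,
      |mc h (value D i h) - ∑ j ∈ Finset.range N, if value D i h ≤ t j then α h j else 0| ≤ ω)
    (hν : |∑ i ∈ completeObs D I, (resp D i - ∑ h, mc h (value D i h))| ≤ ν)
    (hν' : |∑ i ∈ completeObs D I,
      (∑ h, mc h (value D i h)) * (resp D i - ∑ h, mc h (value D i h))| ≤ ν) :
    ∑ i ∈ completeObs D I, (∑ h, mc h (value D i h) - meanResp D I) ^ 2 ≤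
      p * (Λ * ((1 + 2 * p) * (√η * I.card)) + ω * (2 * (I.card + ∑ i ∈ I, resp D i ^ 2))) +
        |meanResp D I| * (2 * p * (√η * I.card)) + ν + |meanResp D I| * ν := by
  classical
  set F := completeObs D I with hF
  set μ := meanResp D I with hμ
  set g : Fin n → ℝ := fun i => ∑ h, mc h (value D i h) with hg
  have hr0 : 0 ≤ √η * I.card := by positivity
  have hcomp : ∀ h, |∑ i ∈ F, mc h (value D i h) * (resp D i - μ)| ≤
      Λ * ((1 + 2 * p) * (√η * I.card)) + ω * (2 * (I.card + ∑ i ∈ I, resp D i ^ 2)) := by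
    intro h
    set s : Fin n → ℝ := fun i =>
      ∑ j ∈ Finset.range N, if value D i h ≤ t j then α h j else 0 with hsdef
    have e1 : ∑ i ∈ F, mc h (value D i h) * (resp D i - μ) =
        ∑ i ∈ F, s i * (resp D i - μ) +
          ∑ i ∈ F, (mc h (value D i h) - s i) * (resp D i - μ) := by
      rw [← Finset.sum_add_distrib]
      exact Finset.sum_congr rfl fun i _ => by ring
    have e2 : ∑ i ∈ F, s i * (resp D i - μ) = ∑ j ∈ Finset.range N, α h j *
        ∑ i ∈ F.filter (fun i => value D i h ≤ t j), (resp D i - μ) := by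
      simp_rw [hsdef, Finset.sum_mul, Finset.mul_sum]
      rw [Finset.sum_comm]
      refine Finset.sum_congr rfl fun j _ => ?_
      rw [Finset.sum_filter]
      refine Finset.sum_congr rfl fun i _ => ?_
      split_ifs <;> simp
    have e3 : |∑ i ∈ F, s i * (resp D i - μ)| ≤ Λ * ((1 + 2 * p) * (√η * I.card)) := by
      rw [e2]
      calc _ ≤ ∑ j ∈ Finset.range N, |α h j *
            ∑ i ∈ F.filter (fun i => value D i h ≤ t j), (resp D i - μ)| :=
            Finset.abs_sum_le_sum_abs _ _
        _ ≤ ∑ j ∈ Finset.range N, |α h j| * ((1 + 2 * p) * (√η * I.card)) := by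
            refine Finset.sum_le_sum fun j _ => ?_
            rw [abs_mul]
            gcongr
            exact hs.abs_sum_complete_le hη hIn hq h (t j)
        _ ≤ _ := by
            rw [← Finset.sum_mul]
            gcongr
            exact hΛ h
    have e4 : |∑ i ∈ F, (mc h (value D i h) - s i) * (resp D i - μ)| ≤
        ω * (2 * (I.card + ∑ i ∈ I, resp D i ^ 2)) := by
      calc _ ≤ ∑ i ∈ F, |(mc h (value D i h) - s i) * (resp D i - μ)| :=
            Finset.abs_sum_le_sum_abs _ _
        _ ≤ ∑ i ∈ F, ω * |resp D i - μ| := by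
            refine Finset.sum_le_sum fun i hi => ?_
            rw [abs_mul]
            gcongr
            exact hstep i hi h
        _ ≤ ω * ∑ i ∈ I, |resp D i - μ| := by
            rw [← Finset.mul_sum]
            gcongr
            exact completeObs_subset
        _ ≤ _ := by
            gcongr
            exact sum_abs_resp_sub_le
    rw [e1]
    exact (abs_add_le _ _).trans (add_le_add e3 e4)
  have hdec : ∑ i ∈ F, (g i - μ) ^ 2 = ∑ h, ∑ i ∈ F, mc h (value D i h) * (resp D i - μ) -
      μ * ∑ i ∈ F, (resp D i - μ) - ∑ i ∈ F, g i * (resp D i - g i) +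
        μ * ∑ i ∈ F, (resp D i - g i) := by
    rw [Finset.sum_comm, Finset.mul_sum, Finset.mul_sum, ← Finset.sum_sub_distrib,
      ← Finset.sum_sub_distrib, ← Finset.sum_add_distrib]
    refine Finset.sum_congr rfl fun i _ => ?_
    rw [← Finset.sum_mul]
    simp only [hg]
    ring
  have h1 : ∑ h, ∑ i ∈ F, mc h (value D i h) * (resp D i - μ) ≤
      p * (Λ * ((1 + 2 * p) * (√η * I.card)) +
        ω * (2 * (I.card + ∑ i ∈ I, resp D i ^ 2))) := by
    calc _ ≤ ∑ _h : Fin p, (Λ * ((1 + 2 * p) * (√η * I.card)) +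
        ω * (2 * (I.card + ∑ i ∈ I, resp D i ^ 2))) :=
          Finset.sum_le_sum fun h _ => (le_abs_self _).trans (hcomp h)
      _ = _ := by simp only [Finset.sum_const, Finset.card_univ, Fintype.card_fin, nsmul_eq_mul]
  have h2 : - (μ * ∑ i ∈ F, (resp D i - μ)) ≤ |μ| * (2 * p * (√η * I.card)) := by
    refine (neg_le_abs _).trans ?_
    rw [abs_mul]
    gcongr
    exact hs.abs_sum_complete_all_le hη hIn hq
  have h3 : μ * ∑ i ∈ F, (resp D i - g i) ≤ |μ| * ν := by
    refine (le_abs_self _).trans ?_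
    rw [abs_mul]
    gcongr
  have h4 := (abs_le.1 hν').1
  change ∑ i ∈ F, (g i - μ) ^ 2 ≤ _
  rw [hdec]
  change -ν ≤ ∑ i ∈ F, g i * (resp D i - g i) at h4
  linarith

end Settled

/-! ### Leaves of a regression tree -/

section Leaves

variable {n p : ℕ}

/-- The number of leaves of a regression tree. -/
def CartTree.numLeaves : CartTree n p → ℕ
  | .leaf _ => 1
  | .node _ _ l r => l.numLeaves + r.numLeaves

/-- The sum of `f` over the observation sets of the leaves. -/
noncomputable def CartTree.leafSum (f : Finset (Fin n) → ℝ) : CartTree n p → ℝ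
  | .leaf I => f I
  | .node _ _ l r => l.leafSum f + r.leafSum f

/-- The cut tree with the same cuts, whose leaves are labelled by a function of their
observations. -/
def CartTree.label (b : Finset (Fin n) → Bool) : CartTree n p → CutTree p
  | .leaf I => .leaf (b I)
  | .node h z l r => .node h z (l.label b) (r.label b)

lemma CartTree.leaves_label (b : Finset (Fin n) → Bool) (t : CartTree n p) :
    (t.label b).leaves = t.numLeaves := by
  induction t with
  | leaf I => rfl
  | node h z l r hl hr => simp [CartTree.label, CutTree.leaves, CartTree.numLeaves, hl, hr]

lemma CartTree.eval_label (b : Finset (Fin n) → Bool) (t : CartTree n p) (x : Fin p → ℝ) :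
    (t.label b).eval x = b (t.finalObs x) := by
  induction t with
  | leaf I => rfl
  | node h z l r hl hr =>
    simp only [CartTree.label, CutTree.eval, CartTree.finalObs, hl, hr]
    split_ifs <;> rfl

/-- The tree `t` distributes the observations `I` over its leaves, and the complete ones according
to their coordinates. -/
inductive Fits (D : Data n p) : Finset (Fin n) → CartTree n p → Prop
  | leaf (I : Finset (Fin n)) : Fits D I (.leaf I)
  | node {I L : Finset (Fin n)} {h : Fin p} {z : ℝ} {l r : CartTree n p} (hLI : L ⊆ I)
      (hL : ∀ i ∈ I, IsComplete D i → (i ∈ L ↔ value D i h ≤ z))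
      (hl : Fits D L l) (hr : Fits D (I \ L) r) : Fits D I (.node h z l r)

variable {D : Data n p}

lemma sum_complete_split {I L : Finset (Fin n)} (hLI : L ⊆ I) (f : Fin n → ℝ) :
    ∑ i ∈ completeObs D I, f i =
      ∑ i ∈ completeObs D L, f i + ∑ i ∈ completeObs D (I \ L), f i := by
  classical
  simp only [completeObs, Finset.sum_filter]
  rw [add_comm, Finset.sum_sdiff hLI]

lemma sum_incomplete_split {I L : Finset (Fin n)} (hLI : L ⊆ I) (f : Fin n → ℝ) :
    ∑ i ∈ I \ completeObs D I, f i =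
      ∑ i ∈ L \ completeObs D L, f i + ∑ i ∈ (I \ L) \ completeObs D (I \ L), f i := by
  have h1 := sum_complete_add_sum_incomplete (D := D) (I := I) f
  have h2 := sum_complete_add_sum_incomplete (D := D) (I := L) f
  have h3 := sum_complete_add_sum_incomplete (D := D) (I := I \ L) f
  have h4 := sum_complete_split (D := D) hLI f
  have h5 := Finset.sum_sdiff (f := f) hLI
  linarith

lemma mem_completeObs {I : Finset (Fin n)} {i : Fin n} :
    i ∈ completeObs D I ↔ i ∈ I ∧ IsComplete D i := by
  classical
  simp only [completeObs, Finset.mem_filter]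

/-- In a fitted tree, the sum over complete observations of a function of the leaf splits at the
root cut. -/
lemma sum_complete_node {β : Type*} {I L : Finset (Fin n)} {h : Fin p} {z : ℝ} (hLI : L ⊆ I)
    (hL : ∀ i ∈ I, IsComplete D i → (i ∈ L ↔ value D i h ≤ z)) (u v : (Fin p → ℝ) → β)
    (F : Fin n → β → ℝ) :
    ∑ i ∈ completeObs D I, F i (if loc D i h ≤ z then u (loc D i) else v (loc D i)) =
      ∑ i ∈ completeObs D L, F i (u (loc D i)) +
        ∑ i ∈ completeObs D (I \ L), F i (v (loc D i)) := by
  rw [sum_complete_split hLI]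
  congr 1
  · refine Finset.sum_congr rfl fun i hi => ?_
    obtain ⟨hiL, hc⟩ := mem_completeObs.1 hi
    rw [if_pos (show loc D i h ≤ z from (hL i (hLI hiL) hc).1 hiL)]
  · refine Finset.sum_congr rfl fun i hi => ?_
    obtain ⟨hiR, hc⟩ := mem_completeObs.1 hi
    obtain ⟨hiI, hiL⟩ := Finset.mem_sdiff.1 hiR
    rw [if_neg (show ¬ loc D i h ≤ z from fun hv => hiL ((hL i hiI hc).2 hv))]

lemma Fits.sum_complete_abs_sub_le {I : Finset (Fin n)} {t : CartTree n p} (ht : Fits D I t)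
    (u : ℝ) :
    ∑ i ∈ completeObs D I, |meanResp D (t.finalObs (loc D i)) - u| ≤
      t.leafSum fun J => |∑ i ∈ J, (resp D i - u)| := by
  induction ht with
  | leaf I =>
    simp only [CartTree.finalObs, CartTree.leafSum, Finset.sum_const, nsmul_eq_mul]
    rw [sum_resp_sub, abs_mul, Nat.abs_cast]
    gcongr
    exact completeObs_subset
  | @node I L h z l r hLI hL hl hr ihl ihr =>
    have e := sum_complete_node hLI hL (fun x => l.finalObs x) (fun x => r.finalObs x)
      (fun _ J => |meanResp D J - u|)
    simp only [CartTree.finalObs, CartTree.leafSum]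
    rw [e]
    exact add_le_add ihl ihr

lemma Fits.leafSum_le {I : Finset (Fin n)} {t : CartTree n p} (ht : Fits D I t) (u : ℝ)
    (g : Fin n → ℝ) :
    (t.leafSum fun J => |∑ i ∈ J, (resp D i - u)|) ≤
      ∑ i ∈ I \ completeObs D I, |resp D i - u| + ∑ i ∈ completeObs D I, |g i - u| +
        t.leafSum fun J => |∑ i ∈ completeObs D J, (resp D i - g i)| := by
  induction ht with
  | leaf I =>
    simp only [CartTree.leafSum]
    have e : ∑ i ∈ I, (resp D i - u) = ∑ i ∈ I \ completeObs D I, (resp D i - u) +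
        ∑ i ∈ completeObs D I, (g i - u) + ∑ i ∈ completeObs D I, (resp D i - g i) := by
      rw [← sum_complete_add_sum_incomplete (D := D) (I := I), add_assoc, add_comm,
        ← Finset.sum_add_distrib]
      congr 1
      exact Finset.sum_congr rfl fun i _ => by ring
    rw [e]
    refine (abs_add_le _ _).trans (add_le_add_left ((abs_add_le _ _).trans ?_) _)
    exact add_le_add (Finset.abs_sum_le_sum_abs _ _) (Finset.abs_sum_le_sum_abs _ _)
  | @node I L h z l r hLI hL hl hr ihl ihr =>
    simp only [CartTree.leafSum]
    rw [sum_incomplete_split (D := D) hLI, sum_complete_split (D := D) hLI]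
    linarith

lemma Fits.sum_complete_label {I : Finset (Fin n)} {t : CartTree n p} (ht : Fits D I t)
    (f : Fin n → ℝ) (b : Finset (Fin n) → Bool) :
    ∑ i ∈ completeObs D I, (if (t.label b).eval (loc D i) = true then f i else 0) =
      t.leafSum fun J => if b J = true then ∑ i ∈ completeObs D J, f i else 0 := by
  induction ht with
  | leaf I =>
    simp only [CartTree.label, CutTree.eval, CartTree.leafSum]
    split_ifs <;> simp
  | @node I L h z l r hLI hL hl hr ihl ihr =>
    simp only [CartTree.label, CutTree.eval, CartTree.leafSum]
    rw [sum_complete_node hLI hL (fun x => (l.label b).eval x) (fun x => (r.label b).eval x)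
      (fun i c => if c = true then f i else 0), ihl, ihr]

lemma CartTree.leafSum_add (t : CartTree n p) (f g : Finset (Fin n) → ℝ) :
    (t.leafSum fun J => f J + g J) = t.leafSum f + t.leafSum g := by
  induction t with
  | leaf I => rfl
  | node h z l r hl hr => simp only [CartTree.leafSum, hl, hr]; ring

lemma CartTree.leafSum_neg (t : CartTree n p) (f : Finset (Fin n) → ℝ) :
    (t.leafSum fun J => - f J) = - t.leafSum f := by
  induction t with
  | leaf I => rfl
  | node h z l r hl hr => simp only [CartTree.leafSum, hl, hr]; ring

/-- The sum over the complete observations of `I` of `f` is at most `ν`, in absolute value, on all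
unions of leaves of cut trees with at most `k` leaves. -/
def IsBalanced (D : Data n p) (I : Finset (Fin n)) (k : ℕ) (ν : ℝ) (f : Fin n → ℝ) : Prop :=
  ∀ t : CutTree p, t.leaves ≤ k →
    |∑ i ∈ completeObs D I, if t.eval (loc D i) = true then f i else 0| ≤ ν

lemma IsBalanced.abs_sum_le {I : Finset (Fin n)} {k : ℕ} {ν : ℝ} {f : Fin n → ℝ}
    (hb : IsBalanced D I k ν f) (hk : 1 ≤ k) : |∑ i ∈ completeObs D I, f i| ≤ ν := by
  simpa [CutTree.eval] using hb (.leaf true) hk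

lemma IsBalanced.left {I L : Finset (Fin n)} {k : ℕ} {ν : ℝ} {f : Fin n → ℝ} {h : Fin p} {z : ℝ}
    (hb : IsBalanced D I (k + 1) ν f) (hLI : L ⊆ I)
    (hL : ∀ i ∈ I, IsComplete D i → (i ∈ L ↔ value D i h ≤ z)) : IsBalanced D L k ν f := by
  intro t ht
  have h1 := hb (.node h z t (.leaf false)) (by simpa [CutTree.leaves] using ht)
  have e := sum_complete_node hLI hL (fun x => t.eval x) (fun _ => false)
    (fun i (c : Bool) => if c = true then f i else 0)
  have h2 := (congrArg abs e).symm.le.trans h1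
  simpa using h2

lemma IsBalanced.right {I L : Finset (Fin n)} {k : ℕ} {ν : ℝ} {f : Fin n → ℝ} {h : Fin p} {z : ℝ}
    (hb : IsBalanced D I (k + 1) ν f) (hLI : L ⊆ I)
    (hL : ∀ i ∈ I, IsComplete D i → (i ∈ L ↔ value D i h ≤ z)) : IsBalanced D (I \ L) k ν f := by
  intro t ht
  have h1 := hb (.node h z (.leaf false) t) (by simp only [CutTree.leaves]; omega)
  have e := sum_complete_node hLI hL (fun _ => false) (fun x => t.eval x)
    (fun i (c : Bool) => if c = true then f i else 0)
  have h2 := (congrArg abs e).symm.le.trans h1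
  simpa using h2

/-- The absolute sums over leaves are a difference of two sums over unions of leaves. -/
lemma Fits.leafSum_abs_le {I : Finset (Fin n)} {t : CartTree n p} (ht : Fits D I t) {k : ℕ} {ν : ℝ}
    {f : Fin n → ℝ} (hb : IsBalanced D I k ν f) (hk : t.numLeaves ≤ k) :
    (t.leafSum fun J => |∑ i ∈ completeObs D J, f i|) ≤ 2 * ν := by
  classical
  set b : Finset (Fin n) → Bool := fun J => decide (0 ≤ ∑ i ∈ completeObs D J, f i) with hbdef
  have h1 := hb (t.label b) (by rwa [CartTree.leaves_label])
  have h2 := hb (t.label fun J => !b J) (by rwa [CartTree.leaves_label])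
  rw [ht.sum_complete_label] at h1 h2
  have e : (fun J => |∑ i ∈ completeObs D J, f i|) = fun J =>
      (if b J = true then ∑ i ∈ completeObs D J, f i else 0) +
        -(if (!b J) = true then ∑ i ∈ completeObs D J, f i else 0) := by
    ext J
    by_cases hJ : 0 ≤ ∑ i ∈ completeObs D J, f i
    · simp [hbdef, hJ]
    · simp [hbdef, hJ, abs_of_neg (not_le.1 hJ)]
  rw [e, CartTree.leafSum_add, CartTree.leafSum_neg]
  linarith [(abs_le.1 h1).2, (abs_le.1 h2).1]

end Leaves

/-! ### Grown trees -/

section Grow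

variable {n p : ℕ} {rule : SplitRule n p} {q nodesize : ℕ} {D : Data n p}
  {dirs : List Bool → Finset (Fin p)}

lemma mem_leftObs_iff_of_isComplete {I : Finset (Fin n)} {c : Split n p} {i : Fin n} (hi : i ∈ I)
    (hc : IsComplete D i) : i ∈ leftObs D I c ↔ value D i c.1 ≤ c.2.1 := by
  classical
  simp [leftObs, hi, hc c.1]

lemma grow_fits (k : ℕ) (v : List Bool) (I : Finset (Fin n)) (A : Cell p) :
    Fits D I (grow rule q nodesize D dirs k v I A) := by
  induction k generalizing v I A with
  | zero => exact .leaf I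
  | succ k ih =>
    rw [grow]
    split_ifs
    · exact .leaf I
    · refine .node (leftObs_subset D I _) (fun i hi hc => mem_leftObs_iff_of_isComplete hi hc)
        (ih _ _ _) ?_
      rw [← rightObs_eq]
      exact ih _ _ _

lemma numLeaves_grow_mul_le (hrule : IsCartRule q rule) (k : ℕ) (v : List Bool)
    (I : Finset (Fin n)) (A : Cell p) (hI : q ≤ I.card) :
    (grow rule q nodesize D dirs k v I A).numLeaves * q ≤ I.card := by
  induction k generalizing v I A with
  | zero => simpa [grow, CartTree.numLeaves] using hI
  | succ k ih =>
    rw [grow]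
    split_ifs with h
    · simpa [CartTree.numLeaves] using hI
    · push Not at h
      have hadm := (hrule D I A (dirs v) h.2).1
      rw [CartTree.numLeaves, add_mul, ← card_left_add_card_right D I (rule D I A (dirs v))]
      exact add_le_add (ih _ _ _ hadm.2.2.2.2.1) (ih _ _ _ hadm.2.2.2.2.2)

/-- The error of the tree estimate at the complete observations of a settled cell, whatever the
tree grown below this cell. -/
lemma IsSettled.sum_error_le {η : ℝ} {I : Finset (Fin n)} {A : Cell p}
    (hs : IsSettled q η D I A) (hη : 0 ≤ η)
    (hIn : IsInside D I A) (hq : q * ∑ i ∈ I, resp D i ^ 2 ≤ η * (I.card : ℝ) ^ 2)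
    (mc : Fin p → ℝ → ℝ) {N : ℕ} (t : ℕ → ℝ) (α : Fin p → ℕ → ℝ) {ω Λ ν ζ b : ℝ}
    (hΛ : ∀ h, ∑ j ∈ Finset.range N, |α h j| ≤ Λ) (hΛ0 : 0 ≤ Λ) (hω0 : 0 ≤ ω) (hζ : 0 < ζ)
    (hν0 : 0 ≤ ν)
    (hstep : ∀ i ∈ completeObs D I, ∀ h,
      |mc h (value D i h) - ∑ j ∈ Finset.range N, if value D i h ≤ t j then α h j else 0| ≤ ω)
    {k : ℕ} (hk : 1 ≤ k)
    (hν : IsBalanced D I k ν fun i => resp D i - ∑ h, mc h (value D i h))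
    (hν' : IsBalanced D I k ν fun i =>
      (∑ h, mc h (value D i h)) * (resp D i - ∑ h, mc h (value D i h)))
    (hb : |meanResp D I| ≤ b) {T : CartTree n p} (hT : Fits D I T) (hTk : T.numLeaves ≤ k) :
    ∑ i ∈ completeObs D I, |meanResp D (T.finalObs (loc D i)) - ∑ h, mc h (value D i h)| ≤
      (2 * p * √η + 2 * ζ + 2 / ζ * (p * (Λ * (1 + 2 * p)) * √η + 2 * p * ω + 2 * p * √η)) *
        (I.card + ∑ i ∈ I, resp D i ^ 2) + ν * (2 + 2 / ζ * (1 + b)) := by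
  set g : Fin n → ℝ := fun i => ∑ h, mc h (value D i h) with hg
  set μ := meanResp D I with hμ
  set Y2 := ∑ i ∈ I, resp D i ^ 2 with hY2
  have hY0 : 0 ≤ Y2 := Finset.sum_nonneg fun _ _ => sq_nonneg _
  set Q := ∑ i ∈ completeObs D I, (g i - μ) ^ 2 with hQ
  have hQle := hs.sum_sq_regression_sub_le hη hIn hq mc t α hΛ hω0 hstep (hν.abs_sum_le hk)
    (hν'.abs_sum_le hk)
  change Q ≤ _ at hQle
  have hc : ((completeObs D I).card : ℝ) ≤ I.card := by
    exact_mod_cast Finset.card_le_card completeObs_subset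
  have h1 : ∑ i ∈ completeObs D I, |g i - μ| ≤ ζ * I.card + Q / ζ := by
    calc ∑ i ∈ completeObs D I, |g i - μ|
        ≤ ∑ i ∈ completeObs D I, (ζ + (g i - μ) ^ 2 / ζ) := by
          refine Finset.sum_le_sum fun i _ => ?_
          rw [← sq_abs, ← sub_nonneg]
          have : ζ + |g i - μ| ^ 2 / ζ - |g i - μ| =
            ((ζ - |g i - μ|) ^ 2 + ζ * |g i - μ|) / ζ := by field_simp; ring
          rw [this]
          positivity
      _ = ζ * (completeObs D I).card + Q / ζ := by
          rw [Finset.sum_add_distrib, ← Finset.sum_div, hQ]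
          simp [mul_comm]
      _ ≤ _ := by gcongr
  have h2 : ∑ i ∈ completeObs D I, |meanResp D (T.finalObs (loc D i)) - μ| ≤
      2 * p * (√η * I.card) + ∑ i ∈ completeObs D I, |g i - μ| + 2 * ν :=
    (hT.sum_complete_abs_sub_le μ).trans ((hT.leafSum_le μ g).trans
      (add_le_add (add_le_add_left (hs.sum_incomplete_le hη hIn hq) _)
        (hT.leafSum_abs_le hν hTk)))
  have h3 : ∑ i ∈ completeObs D I, |meanResp D (T.finalObs (loc D i)) - g i| ≤
      ∑ i ∈ completeObs D I, |meanResp D (T.finalObs (loc D i)) - μ| +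
        ∑ i ∈ completeObs D I, |g i - μ| := by
    rw [← Finset.sum_add_distrib]
    refine Finset.sum_le_sum fun i _ => ?_
    rw [abs_sub_comm (g i) μ]
    exact abs_sub_le _ _ _
  have hm := card_mul_abs_meanResp_le (D := D) (I := I)
  rw [← hμ, ← hY2] at hm
  have hN0 : (0 : ℝ) ≤ I.card := by positivity
  have hμ0 := abs_nonneg μ
  have hs0 : 0 ≤ √η := Real.sqrt_nonneg η
  have hQ2 : Q ≤ (p * (Λ * (1 + 2 * p)) * √η + 2 * p * ω + 2 * p * √η) * (I.card + Y2) +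
      ν * (1 + b) := by
    have e1 : p * (Λ * ((1 + 2 * p) * (√η * I.card))) ≤
        p * (Λ * (1 + 2 * p)) * √η * (I.card + Y2) := by
      calc _ = p * (Λ * (1 + 2 * p)) * √η * I.card := by ring
        _ ≤ _ := by gcongr; linarith
    have e2 : |μ| * (2 * p * (√η * I.card)) ≤ 2 * p * √η * (I.card + Y2) := by
      calc _ = 2 * p * √η * (I.card * |μ|) := by ring
        _ ≤ _ := by gcongr
    have e3 : |μ| * ν ≤ b * ν := by gcongr
    calc Q ≤ _ := hQle
      _ = p * (Λ * ((1 + 2 * p) * (√η * I.card))) + |μ| * (2 * p * (√η * I.card)) +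
        2 * p * ω * (I.card + Y2) + ν + |μ| * ν := by ring
      _ ≤ p * (Λ * (1 + 2 * p)) * √η * (I.card + Y2) + 2 * p * √η * (I.card + Y2) +
        2 * p * ω * (I.card + Y2) + ν + b * ν := by gcongr
      _ = _ := by ring
  calc _ ≤ _ := h3
    _ ≤ (2 * p * (√η * I.card) + (ζ * I.card + Q / ζ) + 2 * ν) + (ζ * I.card + Q / ζ) := by
        linarith
    _ = 2 * p * √η * I.card + 2 * ζ * I.card + 2 / ζ * Q + 2 * ν := by ring
    _ ≤ 2 * p * √η * (I.card + Y2) + 2 * ζ * (I.card + Y2) + 2 / ζ *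
        ((p * (Λ * (1 + 2 * p)) * √η + 2 * p * ω + 2 * p * √η) * (I.card + Y2) +
          ν * (1 + b)) + 2 * ν := by
        gcongr <;> linarith
    _ = _ := by ring

open Classical in
/-- The number of observations below a node that, within the next `K` levels, do not meet any
settled cell, or meet a cell with fewer than `s` observations before a settled one. -/
noncomputable def stray (rule : SplitRule n p) (q s : ℕ) (η : ℝ) (D : Data n p)
    (dirs : List Bool → Finset (Fin p)) : ℕ → List Bool → Finset (Fin n) → Cell p → ℕ
  | 0, _, I, _ => I.card
  | K + 1, v, I, A =>
    if I.card < s then I.card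
    else if IsSettled q η D I A then 0
    else
      stray rule q s η D dirs K (false :: v)
          (leftObs D I (rule D I A (dirs v))) (leftCell A (rule D I A (dirs v))) +
        stray rule q s η D dirs K (true :: v)
          (rightObs D I (rule D I A (dirs v))) (rightCell A (rule D I A (dirs v)))

lemma stray_le_card (s : ℕ) (η : ℝ) (K : ℕ) (v : List Bool) (I : Finset (Fin n)) (A : Cell p) :
    stray rule q s η D dirs K v I A ≤ I.card := by
  induction K generalizing v I A with
  | zero => exact le_rfl
  | succ K ih =>
    rw [stray]
    split_ifs
    · exact le_rfl
    · exact Nat.zero_le _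
    · rw [← card_left_add_card_right D I (rule D I A (dirs v))]
      exact add_le_add (ih _ _ _) (ih _ _ _)

/-- The number of complete observations of `I` at which the tree `T` has an error above `ξ`. -/
noncomputable def errorCount (D : Data n p) (g : (Fin p → ℝ) → ℝ) (ξ : ℝ) (I : Finset (Fin n))
    (T : CartTree n p) : ℝ :=
  ∑ i ∈ completeObs D I,
    if ξ < |meanResp D (T.finalObs (loc D i)) - g (loc D i)| then (1 : ℝ) else 0

lemma errorCount_le_card (g : (Fin p → ℝ) → ℝ) (ξ : ℝ) (I : Finset (Fin n)) (T : CartTree n p) :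
    errorCount D g ξ I T ≤ I.card := by
  calc errorCount D g ξ I T ≤ ∑ i ∈ completeObs D I, (1 : ℝ) :=
        Finset.sum_le_sum fun i _ => by split_ifs <;> norm_num
    _ = (completeObs D I).card := by simp
    _ ≤ I.card := by exact_mod_cast Finset.card_le_card completeObs_subset

lemma errorCount_le_div (g : (Fin p → ℝ) → ℝ) {ξ : ℝ} (hξ : 0 < ξ) (I : Finset (Fin n))
    (T : CartTree n p) :
    errorCount D g ξ I T ≤
      (∑ i ∈ completeObs D I, |meanResp D (T.finalObs (loc D i)) - g (loc D i)|) / ξ := by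
  rw [Finset.sum_div]
  refine Finset.sum_le_sum fun i _ => ?_
  split_ifs with h
  · rw [le_div_iff₀ hξ]
    linarith
  · positivity

/-- The complete observations with a large error are stray or lie in settled cells, where the total
error is controlled. -/
lemma errorCount_grow_le (hrule : IsCartRule q rule) (hq1 : 1 ≤ q) {s : ℕ} (hns : nodesize < s)
    {η ξ β ν ν' : ℝ} (hξ : 0 < ξ) (hβ : 0 ≤ β) (hν' : 0 ≤ ν') {k₀ : ℕ}
    (g : (Fin p → ℝ) → ℝ) (f₁ f₂ : Fin n → ℝ) {S : Finset (Fin n)}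
    (hsettled : ∀ I A T, I ⊆ S → IsSettled q η D I A → IsInside D I A → s ≤ I.card →
      IsBalanced D I k₀ ν f₁ → IsBalanced D I k₀ ν f₂ → Fits D I T → T.numLeaves ≤ k₀ →
      ∑ i ∈ completeObs D I, |meanResp D (T.finalObs (loc D i)) - g (loc D i)| ≤
        β * (I.card + ∑ i ∈ I, resp D i ^ 2) + ν')
    (hsplit : ∀ v I A, IsInside D I A → s ≤ I.card → ∃ c, IsAdmissible q D I A (dirs v) c)
    (hS : S.card < (k₀ + 1) * q) (K k : ℕ) (v : List Bool) (I : Finset (Fin n)) (A : Cell p)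
    (hIS : I ⊆ S) (hIn : IsInside D I A) (hIk : I.card ≤ k) (hqI : q ≤ I.card)
    (hb₁ : IsBalanced D I (k₀ + K) ν f₁) (hb₂ : IsBalanced D I (k₀ + K) ν f₂) :
    errorCount D g ξ I (grow rule q nodesize D dirs k v I A) ≤
      stray rule q s η D dirs K v I A +
        (β * (I.card + ∑ i ∈ I, resp D i ^ 2) + 2 ^ K * ν') / ξ := by
  have hextra : ∀ (K : ℕ) (I : Finset (Fin n)),
      0 ≤ (β * (I.card + ∑ i ∈ I, resp D i ^ 2) + 2 ^ K * ν') / ξ := by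
    intro K I
    have : 0 ≤ ∑ i ∈ I, resp D i ^ 2 := Finset.sum_nonneg fun _ _ => sq_nonneg _
    positivity
  induction K generalizing k v I A with
  | zero =>
    have h1 := errorCount_le_card (D := D) g ξ I (grow rule q nodesize D dirs k v I A)
    have h2 := hextra 0 I
    simp only [stray]
    linarith
  | succ K ih =>
    rw [stray]
    split_ifs with hs hset
    · have h1 := errorCount_le_card (D := D) g ξ I (grow rule q nodesize D dirs k v I A)
      have h2 := hextra (K + 1) I
      linarith
    · rw [not_lt] at hs
      have hmono : ∀ f, IsBalanced D I (k₀ + (K + 1)) ν f → IsBalanced D I k₀ ν f :=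
        fun f hf t ht => hf t (by omega)
      have hleaves : (grow rule q nodesize D dirs k v I A).numLeaves ≤ k₀ := by
        have h1 := numLeaves_grow_mul_le (nodesize := nodesize) (D := D) (dirs := dirs) hrule k v I
          A hqI
        have h2 := (h1.trans (Finset.card_le_card hIS)).trans_lt hS
        exact Nat.lt_succ_iff.1 (lt_of_mul_lt_mul_right h2 (Nat.zero_le q))
      have h1 := hsettled I A _ hIS hset hIn hs (hmono _ hb₁) (hmono _ hb₂)
        (grow_fits (rule := rule) (q := q) (nodesize := nodesize) (dirs := dirs) k v I A) hleaves
      refine (errorCount_le_div g hξ I _).trans ?_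
      rw [Nat.cast_zero, zero_add]
      gcongr
      refine h1.trans ?_
      gcongr
      exact le_mul_of_one_le_left hν' (one_le_pow₀ (by norm_num))
    · rw [not_lt] at hs
      obtain ⟨k', rfl⟩ : ∃ k', k = k' + 1 := ⟨k - 1, by omega⟩
      have hex := hsplit v I A hIn hs
      have hadm := (hrule D I A (dirs v) hex).1
      have hfin : ¬ ((q ≤ I.card ∧ I.card ≤ nodesize) ∨
          ¬ ∃ c, IsAdmissible q D I A (dirs v) c) := by
        rintro (h | h)
        · omega
        · exact h hex
      rw [grow, if_neg hfin]
      set c := rule D I A (dirs v) with hc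
      obtain ⟨-, hA1, hA2, -, hqL, hqR⟩ := hadm
      have hcard := card_left_add_card_right D I c
      have hL : ∀ i ∈ I, IsComplete D i → (i ∈ leftObs D I c ↔ value D i c.1 ≤ c.2.1) :=
        fun i hi hcm => mem_leftObs_iff_of_isComplete hi hcm
      have hLI := leftObs_subset D I c
      have ihL := ih k' (false :: v) (leftObs D I c) (leftCell A c) (hLI.trans hIS)
        (hIn.left hA1) (by omega) hqL (hb₁.left hLI hL) (hb₂.left hLI hL)
      have ihR := ih k' (true :: v) (rightObs D I c) (rightCell A c)
        ((rightObs_subset D I c).trans hIS) (hIn.right hA2) (by omega) hqR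
        (by rw [rightObs_eq]; exact hb₁.right hLI hL) (by rw [rightObs_eq]; exact hb₂.right hLI hL)
      have hsum : errorCount D g ξ I (.node c.1 c.2.1
            (grow rule q nodesize D dirs k' (false :: v) (leftObs D I c) (leftCell A c))
            (grow rule q nodesize D dirs k' (true :: v) (rightObs D I c) (rightCell A c))) =
          errorCount D g ξ (leftObs D I c)
            (grow rule q nodesize D dirs k' (false :: v) (leftObs D I c) (leftCell A c)) +
          errorCount D g ξ (rightObs D I c)
            (grow rule q nodesize D dirs k' (true :: v) (rightObs D I c) (rightCell A c)) := by
        have e := sum_complete_node hLI hL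
          (fun x => (grow rule q nodesize D dirs k' (false :: v) (leftObs D I c)
            (leftCell A c)).finalObs x)
          (fun x => (grow rule q nodesize D dirs k' (true :: v) (rightObs D I c)
            (rightCell A c)).finalObs x)
          (fun i J => if ξ < |meanResp D J - g (loc D i)| then (1 : ℝ) else 0)
        rw [← rightObs_eq] at e
        exact e
      rw [hsum]
      have hY := sum_left_add_sum_right D I c fun i => resp D i ^ 2
      have hcard' : ((leftObs D I c).card : ℝ) + (rightObs D I c).card = I.card := by
        exact_mod_cast hcard
      push_cast
      rw [← hY, ← hcard', pow_succ]
      have e : (β * ((leftObs D I c).card + (rightObs D I c).card +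
          (∑ i ∈ leftObs D I c, resp D i ^ 2 + ∑ i ∈ rightObs D I c, resp D i ^ 2)) +
            2 ^ K * 2 * ν') / ξ =
          (β * ((leftObs D I c).card + ∑ i ∈ leftObs D I c, resp D i ^ 2) + 2 ^ K * ν') / ξ +
          (β * ((rightObs D I c).card + ∑ i ∈ rightObs D I c, resp D i ^ 2) + 2 ^ K * ν') / ξ := by
        ring
      rw [e]
      linarith

end Grow

/-! ### Existence of admissible splits -/

section Admissible

variable {n p : ℕ} {D : Data n p} {q : ℕ} {I : Finset (Fin n)} {A : Cell p}

open Classical in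
lemma exists_threshold (hIn : IsInside D I A) {h : Fin p}
    (hinj : ∀ i ∈ I, ∀ j ∈ I, ¬ IsMissing D i h → ¬ IsMissing D j h →
      value D i h = value D j h → i = j) (k : ℕ)
    (hk : k ≤ (I.filter fun i => ¬ IsMissing D i h).card) :
    ∃ z, A.1 h ≤ z ∧ z ≤ A.2 h ∧
      (I.filter fun i => ¬ IsMissing D i h ∧ value D i h ≤ z).card = k := by
  induction k with
  | zero =>
    refine ⟨A.1 h, le_rfl, hIn.1 h, ?_⟩
    rw [Finset.card_eq_zero, Finset.filter_eq_empty_iff]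
    rintro i hi ⟨hm, hv⟩
    exact absurd hv (not_le.2 (hIn.2 i hi h hm).1)
  | succ k ih =>
    obtain ⟨z, hz1, hz2, hz⟩ := ih (by omega)
    have hne : (I.filter fun i => ¬ IsMissing D i h ∧ z < value D i h).Nonempty := by
      by_contra hne
      rw [Finset.not_nonempty_iff_eq_empty, Finset.filter_eq_empty_iff] at hne
      have : I.filter (fun i => ¬ IsMissing D i h ∧ value D i h ≤ z) =
          I.filter fun i => ¬ IsMissing D i h :=
        Finset.filter_congr fun i hi => ⟨fun h' => h'.1, fun h' =>
          ⟨h', not_lt.1 fun h'' => hne hi ⟨h', h''⟩⟩⟩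
      rw [this] at hz
      omega
    obtain ⟨i₀, hi₀, hmin⟩ := Finset.exists_min_image _ (fun i => value D i h) hne
    obtain ⟨hiI, hm, hv⟩ := Finset.mem_filter.1 hi₀
    refine ⟨value D i₀ h, (hIn.2 i₀ hiI h hm).1.le, (hIn.2 i₀ hiI h hm).2, ?_⟩
    have : I.filter (fun i => ¬ IsMissing D i h ∧ value D i h ≤ value D i₀ h) =
        insert i₀ (I.filter fun i => ¬ IsMissing D i h ∧ value D i h ≤ z) := by
      ext i
      simp only [Finset.mem_filter, Finset.mem_insert]
      constructor
      · rintro ⟨hi, hmi, hvi⟩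
        by_cases hzi : value D i h ≤ z
        · exact Or.inr ⟨hi, hmi, hzi⟩
        · have := hmin i (Finset.mem_filter.2 ⟨hi, hmi, not_le.1 hzi⟩)
          exact Or.inl (hinj i hi i₀ hiI hmi hm (le_antisymm hvi this))
      · rintro (rfl | ⟨hi, hmi, hvi⟩)
        · exact ⟨hiI, hm, le_rfl⟩
        · exact ⟨hi, hmi, hvi.trans hv.le⟩
    rw [this, Finset.card_insert_of_notMem, hz]
    simp only [Finset.mem_filter, not_and, not_le]
    exact fun _ _ => hv

/-- If the recorded values are distinct, a cell with `2q` observations can be split in every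
direction, into `q` observations on the left and the others on the right. -/
lemma exists_isAdmissible (hIn : IsInside D I A) {H : Finset (Fin p)} {h : Fin p} (hH : h ∈ H)
    (hinj : ∀ i ∈ I, ∀ j ∈ I, ¬ IsMissing D i h → ¬ IsMissing D j h →
      value D i h = value D j h → i = j) (hq : 2 * q ≤ I.card) :
    ∃ c, IsAdmissible q D I A H c := by
  classical
  have hcard := Finset.card_filter_add_card_filter_not (s := I) (fun i => IsMissing D i h)
  obtain ⟨W, hWs, hWc⟩ := Finset.exists_subset_card_eq
    (s := I.filter fun i => IsMissing D i h) (n := min q (I.filter fun i => IsMissing D i h).card)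
    (min_le_right _ _)
  obtain ⟨z, hz1, hz2, hz⟩ := exists_threshold hIn hinj (q - W.card) (by omega)
  have hW : ∀ i ∈ W, i ∈ I ∧ IsMissing D i h := fun i hi => Finset.mem_filter.1 (hWs hi)
  have hL : leftObs D I (h, z, W) =
      (I.filter fun i => ¬ IsMissing D i h ∧ value D i h ≤ z) ∪ W := by
    ext i
    simp only [leftObs, Finset.mem_filter, Finset.mem_union]
    constructor
    · rintro ⟨hi, h' | h'⟩
      · exact Or.inl ⟨hi, h'⟩
      · exact Or.inr h'.2
    · rintro (⟨hi, h'⟩ | h')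
      · exact ⟨hi, Or.inl h'⟩
      · exact ⟨(hW i h').1, Or.inr ⟨(hW i h').2, h'⟩⟩
  have hLc : (leftObs D I (h, z, W)).card = q := by
    rw [hL, Finset.card_union_of_disjoint, hz]
    · omega
    · rw [Finset.disjoint_left]
      intro i hi hiW
      exact (Finset.mem_filter.1 hi).2.1 (hW i hiW).2
  have := card_left_add_card_right D I (h, z, W)
  exact ⟨(h, z, W), hH, hz1, hz2, hW, hLc.ge, by omega⟩

end Admissible

/-! ### Random directions -/

section Directions

variable {n p : ℕ}

instance isProbabilityMeasure_uniformSubset (N k : ℕ) (hk : k ≤ N) :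
    IsProbabilityMeasure (uniformSubset N k hk) := by
  unfold uniformSubset
  infer_instance

lemma uniformSubset_singleton (N k : ℕ) (hk : k ≤ N) {H : Finset (Fin N)} (hH : H.card = k) :
    uniformSubset N k hk {H} = ((N.choose k : ℕ) : ℝ≥0∞)⁻¹ := by
  rw [uniformSubset, PMF.toMeasure_apply_singleton _ _ (measurableSet_singleton _),
    PMF.uniformOfFinset_apply_of_mem _ (by simpa using hH), Finset.card_powersetCard,
    Finset.card_univ, Fintype.card_fin]

lemma ae_uniformSubset_card (N k : ℕ) (hk : k ≤ N) :
    ∀ᵐ H ∂uniformSubset N k hk, H.card = k := by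
  rw [ae_iff, uniformSubset, PMF.toMeasure_apply_eq_zero_iff _ (MeasurableSet.of_discrete),
    Set.disjoint_left]
  intro H hH
  simpa using (PMF.mem_support_uniformOfFinset_iff _ _).1 hH

lemma inv_choose_le_uniformSubset {k : ℕ} (hk : k ≤ p) (hk1 : 1 ≤ k) (h : Fin p) :
    ((p.choose k : ℕ) : ℝ)⁻¹ ≤ (uniformSubset p k hk).real {H | h ∈ H} := by
  obtain ⟨H, hH1, -, hH2⟩ := Finset.exists_subsuperset_card_eq
    (Finset.subset_univ ({h} : Finset (Fin p))) (by simpa using hk1) (by simpa using hk)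
  have h1 : (uniformSubset p k hk).real {H} = ((p.choose k : ℕ) : ℝ)⁻¹ := by
    rw [measureReal_def, uniformSubset_singleton p k hk hH2, ENNReal.toReal_inv,
      ENNReal.toReal_natCast]
  rw [← h1]
  refine measureReal_mono ?_
  rintro _ rfl
  exact hH1 (Finset.mem_singleton_self h)

/-- The law of the candidate directions at all nodes. -/
noncomputable def dirLaw (p mtry : ℕ) (hm : mtry ≤ p) : Measure (List Bool → Finset (Fin p)) :=
  Measure.infinitePi fun _ : List Bool => uniformSubset p mtry hm

instance isProbabilityMeasure_dirLaw (p mtry : ℕ) (hm : mtry ≤ p) :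
    IsProbabilityMeasure (dirLaw p mtry hm) := by
  unfold dirLaw
  infer_instance

/-- Redrawing the candidate directions of one node does not change the law. -/
lemma measurePreserving_update_dirLaw (mtry : ℕ) (hm : mtry ≤ p) (v : List Bool) :
    MeasurePreserving (fun u : Finset (Fin p) × (List Bool → Finset (Fin p)) =>
      Function.update u.2 v u.1) ((uniformSubset p mtry hm).prod (dirLaw p mtry hm))
      (dirLaw p mtry hm) := by
  have hmeas : Measurable (fun u : Finset (Fin p) × (List Bool → Finset (Fin p)) =>
      Function.update u.2 v u.1) := by
    refine measurable_pi_iff.2 fun w => ?_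
    by_cases hw : w = v
    · subst hw
      simpa using measurable_fst
    · simp only [Function.update_of_ne hw]
      fun_prop
  refine ⟨hmeas, Measure.eq_infinitePi _ fun S t ht => ?_⟩
  rw [Measure.map_apply hmeas (MeasurableSet.pi S.countable_toSet fun i _ => ht i)]
  have hpre : (fun u : Finset (Fin p) × (List Bool → Finset (Fin p)) =>
      Function.update u.2 v u.1) ⁻¹' ((S : Set (List Bool)).pi t) =
      (if v ∈ S then t v else Set.univ) ×ˢ (((S.erase v : Finset (List Bool)) :
        Set (List Bool)).pi t) := by
    ext ⟨H, d⟩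
    simp only [Set.mem_preimage, Set.mem_pi, Finset.mem_coe, Set.mem_prod, Finset.mem_erase]
    constructor
    · intro hh
      refine ⟨?_, fun w hw => ?_⟩
      · split_ifs with hv
        · simpa using hh v hv
        · trivial
      · simpa [Function.update_of_ne hw.1] using hh w hw.2
    · rintro ⟨h1, h2⟩ w hw
      by_cases hwv : w = v
      · subst hwv
        simpa [hw] using h1
      · simpa [Function.update_of_ne hwv] using h2 w ⟨hwv, hw⟩
  rw [hpre, Measure.prod_prod, dirLaw, Measure.infinitePi_pi _ fun i _ => ht i]
  split_ifs with hv
  · exact Finset.mul_prod_erase S (fun i => uniformSubset p mtry hm (t i)) hv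
  · rw [measure_univ, one_mul, Finset.erase_eq_of_notMem hv]

variable {rule : SplitRule n p} {q s : ℕ} {η : ℝ} {D : Data n p}

lemma measurable_stray (K : ℕ) (v : List Bool) (I : Finset (Fin n)) (A : Cell p) :
    Measurable fun d : List Bool → Finset (Fin p) => stray rule q s η D d K v I A := by
  induction K generalizing v I A with
  | zero => exact measurable_const
  | succ K ih =>
    simp only [stray]
    split_ifs
    · exact measurable_const
    · exact measurable_const
    · have h1 : Measurable fun u : Finset (Fin p) × (List Bool → Finset (Fin p)) =>
          stray rule q s η D u.2 K (false :: v)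
              (leftObs D I (rule D I A u.1)) (leftCell A (rule D I A u.1)) +
            stray rule q s η D u.2 K (true :: v)
              (rightObs D I (rule D I A u.1)) (rightCell A (rule D I A u.1)) :=
        measurable_from_prod_countable_right fun H =>
          (ih (false :: v) (leftObs D I (rule D I A H)) (leftCell A (rule D I A H))).add
            (ih (true :: v) (rightObs D I (rule D I A H)) (rightCell A (rule D I A H)))
      have h2 : Measurable fun d : List Bool → Finset (Fin p) => (d v, d) :=
        (measurable_pi_apply v).prodMk measurable_id
      exact h1.comp h2

/-- The subtree below a node does not look at the directions drawn at a node of smaller depth. -/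
lemma stray_update (K : ℕ) {v w : List Bool} (hvw : v.length < w.length) (I : Finset (Fin n))
    (A : Cell p) (d : List Bool → Finset (Fin p)) (H : Finset (Fin p)) :
    stray rule q s η D (Function.update d v H) K w I A = stray rule q s η D d K w I A := by
  induction K generalizing w I A with
  | zero => rfl
  | succ K ih =>
    have hne : w ≠ v := by rintro rfl; exact lt_irrefl _ hvw
    simp only [stray, Function.update_of_ne hne]
    rw [ih (by simp only [List.length_cons]; omega), ih (by simp only [List.length_cons]; omega)]

lemma integrable_stray {mtry : ℕ} {hm : mtry ≤ p} (K : ℕ) (v : List Bool) (I : Finset (Fin n))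
    (A : Cell p) :
    Integrable (fun d => (stray rule q s η D d K v I A : ℝ)) (dirLaw p mtry hm) := by
  refine Integrable.of_bound (C := I.card)
    (measurable_from_nat.comp (measurable_stray K v I A)).aestronglyMeasurable ?_
  refine Eventually.of_forall fun d => ?_
  simpa using stray_le_card (rule := rule) (q := q) (D := D) (dirs := d) s η K v I A

lemma integral_stray_le_card {mtry : ℕ} {hm : mtry ≤ p} (K : ℕ) (v : List Bool)
    (I : Finset (Fin n)) (A : Cell p) :
    ∫ d, (stray rule q s η D d K v I A : ℝ) ∂dirLaw p mtry hm ≤ I.card := by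
  calc _ ≤ ∫ _, (I.card : ℝ) ∂dirLaw p mtry hm :=
        integral_mono (integrable_stray K v I A) (integrable_const _) fun d => by
          exact Nat.cast_le.2
            (stray_le_card (rule := rule) (q := q) (D := D) (dirs := d) s η K v I A)
    _ = I.card := by simp

/-- The expected number of stray observations of a split cell is the average, over the candidate
directions drawn at this cell, of those of the two daughters. -/
lemma integral_stray_succ {mtry : ℕ} {hm : mtry ≤ p} (K : ℕ) (v : List Bool)
    (I : Finset (Fin n)) (A : Cell p) (hs : ¬ I.card < s) (hset : ¬ IsSettled q η D I A) :
    ∫ d, (stray rule q s η D d (K + 1) v I A : ℝ) ∂dirLaw p mtry hm =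
      ∫ H, (∫ d, (stray rule q s η D d K (false :: v)
            (leftObs D I (rule D I A H)) (leftCell A (rule D I A H)) : ℝ) ∂dirLaw p mtry hm +
          ∫ d, (stray rule q s η D d K (true :: v)
            (rightObs D I (rule D I A H)) (rightCell A (rule D I A H)) : ℝ) ∂dirLaw p mtry hm)
        ∂uniformSubset p mtry hm := by
  have hmp := measurePreserving_update_dirLaw mtry hm v
  have hint := integrable_stray (rule := rule) (q := q) (s := s) (η := η) (D := D) (hm := hm)
    (K + 1) v I A
  have h1 : ∫ d, (stray rule q s η D d (K + 1) v I A : ℝ) ∂dirLaw p mtry hm =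
      ∫ u, (stray rule q s η D (Function.update u.2 v u.1) (K + 1) v I A : ℝ)
        ∂((uniformSubset p mtry hm).prod (dirLaw p mtry hm)) := by
    conv_lhs => rw [← hmp.map_eq]
    exact integral_map hmp.measurable.aemeasurable
      (by rw [hmp.map_eq]; exact hint.aestronglyMeasurable)
  have hint' : Integrable (fun u : Finset (Fin p) × (List Bool → Finset (Fin p)) =>
      (stray rule q s η D (Function.update u.2 v u.1) (K + 1) v I A : ℝ))
      ((uniformSubset p mtry hm).prod (dirLaw p mtry hm)) :=
    hmp.integrable_comp_of_integrable hint
  rw [h1, integral_prod _ hint']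
  refine integral_congr_ae (Eventually.of_forall fun H => ?_)
  simp only
  rw [← integral_add (integrable_stray _ _ _ _) (integrable_stray _ _ _ _)]
  refine integral_congr_ae (Eventually.of_forall fun d => ?_)
  simp only [stray, if_neg hs, if_neg hset, Function.update_self]
  rw [stray_update K (by simp) _ _ d H, stray_update K (by simp) _ _ d H]
  push_cast
  rfl

/-- **Few observations stray.** Every unsettled cell is split, with a probability bounded below, in
a direction where the residual sum of squares drops by `η` times its number of observations. As the
residual sum of squares is nonnegative, the average number of unsettled ancestors of an observation
is bounded, so that few observations have `K` of them. -/
lemma integral_stray_le (hrule : IsCartRule q rule) {mtry : ℕ} (hm : mtry ≤ p) (hm1 : 1 ≤ mtry)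
    (hη : 0 ≤ η)
    (hsplit : ∀ (H : Finset (Fin p)) I A, H.Nonempty → IsInside D I A → s ≤ I.card →
      ∃ c, IsAdmissible q D I A H c)
    (K : ℕ) (v : List Bool) (I : Finset (Fin n)) (A : Cell p) (hIn : IsInside D I A) :
    K * (((p.choose mtry : ℕ) : ℝ)⁻¹ * η) *
        ∫ d, (stray rule q s η D d K v I A : ℝ) ∂dirLaw p mtry hm ≤
      residual D I + K * (((p.choose mtry : ℕ) : ℝ)⁻¹ * η) * (2 ^ K * s) := by
  set w : ℝ := ((p.choose mtry : ℕ) : ℝ)⁻¹ with hw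
  have hw0 : 0 ≤ w := by positivity
  induction K generalizing v I A with
  | zero => simpa using residual_nonneg D I
  | succ K ih =>
    have hres := residual_nonneg D I
    by_cases hs : I.card < s
    · have h1 := integral_stray_le_card (rule := rule) (q := q) (s := s) (η := η) (D := D)
        (hm := hm) (K + 1) v I A
      have h2 : (I.card : ℝ) ≤ 2 ^ (K + 1) * s := by
        have : (I.card : ℝ) ≤ s := by exact_mod_cast hs.le
        have h3 : (1 : ℝ) ≤ 2 ^ (K + 1) := one_le_pow₀ (by norm_num)
        nlinarith
      have h3 : 0 ≤ ((K + 1 : ℕ) : ℝ) * (w * η) := by positivity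
      nlinarith [mul_le_mul_of_nonneg_left (h1.trans h2) h3]
    by_cases hset : IsSettled q η D I A
    · have : ∫ d, (stray rule q s η D d (K + 1) v I A : ℝ) ∂dirLaw p mtry hm = 0 := by
        simp [stray, hs, hset]
      rw [this, mul_zero]
      positivity
    have hcard := integral_stray_le_card (rule := rule) (q := q) (s := s) (η := η) (D := D)
      (hm := hm) (K + 1) v I A
    rw [integral_stray_succ K v I A hs hset] at hcard ⊢
    set Φ : Finset (Fin p) → ℝ := fun H =>
      ∫ d, (stray rule q s η D d K (false :: v)
            (leftObs D I (rule D I A H)) (leftCell A (rule D I A H)) : ℝ) ∂dirLaw p mtry hm +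
          ∫ d, (stray rule q s η D d K (true :: v)
            (rightObs D I (rule D I A H)) (rightCell A (rule D I A H)) : ℝ) ∂dirLaw p mtry hm
      with hΦ
    -- a direction with a good split
    obtain ⟨c, hc⟩ := not_forall.1 hset
    obtain ⟨hcadm, hcgain⟩ := Classical.not_imp.1 hc
    rw [not_le] at hcgain
    have hpt : ∀ H : Finset (Fin p), H.card = mtry → K * (w * η) * Φ H ≤
        residual D I - {H | c.1 ∈ H}.indicator (fun _ => η * I.card) H +
          2 * (K * (w * η) * (2 ^ K * s)) := by
      intro H hH
      have hex := hsplit H I A (Finset.card_pos.1 (by omega)) hIn (not_lt.1 hs)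
      obtain ⟨⟨hd, hA1, hA2, hW, hqL, hqR⟩, hmax⟩ := hrule D I A H hex
      have ihL := ih (false :: v) (leftObs D I (rule D I A H)) (leftCell A (rule D I A H))
        (hIn.left hA1)
      have ihR := ih (true :: v) (rightObs D I (rule D I A H)) (rightCell A (rule D I A H))
        (hIn.right hA2)
      have hdrop : residual D (leftObs D I (rule D I A H)) +
          residual D (rightObs D I (rule D I A H)) ≤
          residual D I - {H | c.1 ∈ H}.indicator (fun _ => η * I.card) H := by
        by_cases hcH : c.1 ∈ H
        · rw [Set.indicator_of_mem (show H ∈ {H | c.1 ∈ H} from hcH)]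
          have h1 := hmax c ⟨hcH, hcadm.2⟩
          have h2 := card_mul_cart D I (rule D I A H)
          have h3 : η * I.card ≤ I.card * cart D I (rule D I A H) := by
            rw [mul_comm]
            gcongr
            linarith
          linarith
        · rw [Set.indicator_of_notMem (show H ∉ {H | c.1 ∈ H} from hcH), sub_zero]
          exact residual_left_add_right_le D I _
      simp only [hΦ]
      linarith
    have hprob : w ≤ (uniformSubset p mtry hm).real {H | c.1 ∈ H} :=
      inv_choose_le_uniformSubset hm hm1 c.1
    have hint : ∀ f : Finset (Fin p) → ℝ, Integrable f (uniformSubset p mtry hm) :=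
      fun f => Integrable.of_finite
    have hI : K * (w * η) * ∫ H, Φ H ∂uniformSubset p mtry hm ≤
        residual D I - η * I.card * (uniformSubset p mtry hm).real {H | c.1 ∈ H} +
          2 * (K * (w * η) * (2 ^ K * s)) := by
      rw [← integral_const_mul]
      calc _ ≤ ∫ H, (residual D I - {H | c.1 ∈ H}.indicator (fun _ => η * I.card) H +
            2 * (K * (w * η) * (2 ^ K * s))) ∂uniformSubset p mtry hm :=
            integral_mono_ae (hint _) (hint _) (by
              filter_upwards [ae_uniformSubset_card p mtry hm] with H hH using hpt H hH)
        _ = _ := by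
            rw [integral_add (hint _) (hint _), integral_sub (hint _) (hint _),
              integral_indicator_const _ (MeasurableSet.of_discrete)]
            simp [mul_comm]
    have h1 : w * η * I.card ≤ η * I.card * (uniformSubset p mtry hm).real {H | c.1 ∈ H} := by
      calc w * η * I.card = η * I.card * w := by ring
        _ ≤ _ := by gcongr
    have h2 : w * η * ∫ H, Φ H ∂uniformSubset p mtry hm ≤ w * η * I.card := by gcongr
    have h3 : 0 ≤ w * η * (2 ^ K * s) := by positivity
    push_cast
    rw [pow_succ]
    nlinarith

end Directions

/-! ### Measurability of the tree estimate -/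

section Measurability

variable {n p : ℕ} {Ω : Type*} [MeasurableSpace Ω]

/-- A measurable family of measurable functions, indexed by a measurable countable parameter. -/
lemma measurable_apply_of_countable {α β : Type*} [Countable α] [MeasurableSpace α]
    [MeasurableSingletonClass α] [MeasurableSpace β] {F : α → Ω → β} {a : Ω → α}
    (hF : ∀ i, Measurable (F i)) (ha : Measurable a) : Measurable fun ω => F (a ω) ω := by
  have h1 : Measurable fun u : α × Ω => F u.1 u.2 := measurable_from_prod_countable_right hF
  have h2 : Measurable fun ω => (a ω, ω) := ha.prodMk measurable_id
  exact h1.comp h2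

lemma measurable_finset_of_mem {m : ℕ} {f : Ω → Finset (Fin m)}
    (hf : ∀ i, Measurable fun ω => i ∈ f ω) : Measurable f := by
  refine measurable_to_countable' fun J => ?_
  have : f ⁻¹' {J} = {ω | ∀ i, i ∈ f ω ↔ i ∈ J} := by
    ext ω
    simp [Finset.ext_iff]
  rw [this]
  exact measurableSet_setOfPred.2 (Measurable.forall fun i => (hf i).iff measurable_const)

variable {D : Ω → Data n p} {A : Ω → Cell p} {c : Ω → Split n p} {H : Ω → Finset (Fin p)}

lemma measurable_isMissing (hD : Measurable D) (hc : Measurable c) (i : Fin n) :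
    Measurable fun ω => IsMissing (D ω) i (c ω).1 := by
  refine measurable_apply_of_countable (F := fun h ω => IsMissing (D ω) i h) (fun h => ?_) hc.fst
  have : Measurable fun ω => ((D ω i).1 h).1 := by fun_prop
  exact measurableSet_setOfPred.1 (this (measurableSet_singleton true))

lemma measurable_value (hD : Measurable D) (hc : Measurable c) (i : Fin n) :
    Measurable fun ω => value (D ω) i (c ω).1 := by
  refine measurable_apply_of_countable (F := fun h ω => value (D ω) i h) (fun h => ?_) hc.fst
  unfold value
  fun_prop

lemma measurable_mem_assignation (hc : Measurable c) (i : Fin n) :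
    Measurable fun ω => i ∈ (c ω).2.2 :=
  (Measurable.of_discrete (f := fun J : Finset (Fin n) => i ∈ J)).comp hc.snd.snd

lemma measurable_leftObs (hD : Measurable D) (hc : Measurable c) (I : Finset (Fin n)) :
    Measurable fun ω => leftObs (D ω) I (c ω) := by
  refine measurable_finset_of_mem fun i => ?_
  simp only [leftObs, Finset.mem_filter]
  refine measurable_const.and (Measurable.or (Measurable.and ?_ ?_) (Measurable.and ?_ ?_))
  · exact (measurable_isMissing hD hc i).not
  · exact measurableSet_setOfPred.1
      (measurableSet_le (measurable_value hD hc i) hc.snd.fst)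
  · exact measurable_isMissing hD hc i
  · exact measurable_mem_assignation hc i

lemma measurable_rightObs (hD : Measurable D) (hc : Measurable c) (I : Finset (Fin n)) :
    Measurable fun ω => rightObs (D ω) I (c ω) := by
  simp_rw [rightObs_eq]
  exact (Measurable.of_discrete (f := fun J : Finset (Fin n) => I \ J)).comp
    (measurable_leftObs hD hc I)

lemma measurable_isAdmissible (q : ℕ) (hD : Measurable D) (hA : Measurable A) (hc : Measurable c)
    (hH : Measurable H) (I : Finset (Fin n)) :
    Measurable fun ω => IsAdmissible q (D ω) I (A ω) (H ω) (c ω) := by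
  have hA1 : Measurable fun ω => (A ω).1 (c ω).1 :=
    measurable_apply_of_countable (F := fun h ω => (A ω).1 h) (fun h => by fun_prop) hc.fst
  have hA2 : Measurable fun ω => (A ω).2 (c ω).1 :=
    measurable_apply_of_countable (F := fun h ω => (A ω).2 h) (fun h => by fun_prop) hc.fst
  unfold IsAdmissible
  refine Measurable.and ?_ (Measurable.and ?_ (Measurable.and ?_ (Measurable.and ?_
    (Measurable.and ?_ ?_))))
  · exact measurable_apply_of_countable (F := fun h ω => h ∈ H ω) (fun h =>
      (Measurable.of_discrete (f := fun J : Finset (Fin p) => h ∈ J)).comp hH) hc.fst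
  · exact measurableSet_setOfPred.1 (measurableSet_le hA1 hc.snd.fst)
  · exact measurableSet_setOfPred.1 (measurableSet_le hc.snd.fst hA2)
  · exact Measurable.forall fun i => (measurable_mem_assignation hc i).imp
      (measurable_const.and (measurable_isMissing hD hc i))
  · exact (Measurable.of_discrete (f := fun J : Finset (Fin n) => q ≤ J.card)).comp
      (measurable_leftObs hD hc I)
  · exact (Measurable.of_discrete (f := fun J : Finset (Fin n) => q ≤ J.card)).comp
      (measurable_rightObs hD hc I)

lemma measurable_update {f : Ω → Fin p → ℝ} {h : Ω → Fin p} {z : Ω → ℝ} (hf : Measurable f)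
    (hh : Measurable h) (hz : Measurable z) :
    Measurable fun ω => Function.update (f ω) (h ω) (z ω) := by
  refine measurable_pi_iff.2 fun j => ?_
  simp only [Function.update_apply]
  refine Measurable.ite ?_ hz (by fun_prop)
  exact hh (MeasurableSet.of_discrete (s := {i | j = i}))

lemma measurable_finalObs_grow {rule : SplitRule n p} {q : ℕ} (nodesize : ℕ)
    (hrule : IsCartRule q rule) (hmeas : IsMeasurableRule rule) (k : ℕ) (v : List Bool)
    (I : Finset (Fin n)) {D : Ω → Data n p} {A : Ω → Cell p} {x : Ω → Fin p → ℝ}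
    {d : Ω → List Bool → Finset (Fin p)} (hD : Measurable D) (hA : Measurable A)
    (hx : Measurable x) (hd : Measurable d) :
    Measurable fun ω => (grow rule q nodesize (D ω) (d ω) k v I (A ω)).finalObs (x ω) := by
  induction k generalizing v I A with
  | zero => exact measurable_const
  | succ k ih =>
    have hdv : Measurable fun ω => d ω v := by fun_prop
    have hc : Measurable fun ω => rule (D ω) I (A ω) (d ω v) :=
      measurable_apply_of_countable (F := fun H ω => rule (D ω) I (A ω) H)
        (fun H => (hmeas I H).comp (hD.prodMk hA)) hdv
    -- an admissible split exists if and only if the rule returns one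
    have hex : ∀ ω, (∃ c, IsAdmissible q (D ω) I (A ω) (d ω v) c) ↔
        IsAdmissible q (D ω) I (A ω) (d ω v) (rule (D ω) I (A ω) (d ω v)) :=
      fun ω => ⟨fun h => (hrule _ _ _ _ h).1, fun h => ⟨_, h⟩⟩
    have hfin : Measurable fun ω => (q ≤ I.card ∧ I.card ≤ nodesize) ∨
        ¬ ∃ c, IsAdmissible q (D ω) I (A ω) (d ω v) c := by
      simp_rw [hex]
      exact measurable_const.or (measurable_isAdmissible q hD hA hc hdv I).not
    have hL : Measurable fun ω => (grow rule q nodesize (D ω) (d ω) k (false :: v)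
        (leftObs (D ω) I (rule (D ω) I (A ω) (d ω v)))
        (leftCell (A ω) (rule (D ω) I (A ω) (d ω v)))).finalObs (x ω) := by
      refine measurable_apply_of_countable (F := fun J ω => (grow rule q nodesize (D ω) (d ω) k
        (false :: v) J (leftCell (A ω) (rule (D ω) I (A ω) (d ω v)))).finalObs (x ω))
        (fun J => ih (false :: v) J ?_) (measurable_leftObs hD hc I)
      exact hA.fst.prodMk (measurable_update hA.snd hc.fst hc.snd.fst)
    have hR : Measurable fun ω => (grow rule q nodesize (D ω) (d ω) k (true :: v)
        (rightObs (D ω) I (rule (D ω) I (A ω) (d ω v)))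
        (rightCell (A ω) (rule (D ω) I (A ω) (d ω v)))).finalObs (x ω) := by
      refine measurable_apply_of_countable (F := fun J ω => (grow rule q nodesize (D ω) (d ω) k
        (true :: v) J (rightCell (A ω) (rule (D ω) I (A ω) (d ω v)))).finalObs (x ω))
        (fun J => ih (true :: v) J ?_) (measurable_rightObs hD hc I)
      exact (measurable_update hA.fst hc.fst hc.snd.fst).prodMk hA.snd
    have hxc : Measurable fun ω => x ω (rule (D ω) I (A ω) (d ω v)).1 :=
      measurable_apply_of_countable (F := fun h ω => x ω h) (fun h => by fun_prop) hc.fst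
    classical
    have e : (fun ω => (grow rule q nodesize (D ω) (d ω) (k + 1) v I (A ω)).finalObs (x ω)) =
        fun ω => if (q ≤ I.card ∧ I.card ≤ nodesize) ∨
            ¬ ∃ c, IsAdmissible q (D ω) I (A ω) (d ω v) c then I
          else if x ω (rule (D ω) I (A ω) (d ω v)).1 ≤ (rule (D ω) I (A ω) (d ω v)).2.1 then
            (grow rule q nodesize (D ω) (d ω) k (false :: v)
              (leftObs (D ω) I (rule (D ω) I (A ω) (d ω v)))
              (leftCell (A ω) (rule (D ω) I (A ω) (d ω v)))).finalObs (x ω)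
          else (grow rule q nodesize (D ω) (d ω) k (true :: v)
            (rightObs (D ω) I (rule (D ω) I (A ω) (d ω v)))
            (rightCell (A ω) (rule (D ω) I (A ω) (d ω v)))).finalObs (x ω) := by
      ext1 ω
      rw [grow]
      by_cases h1 : (q ≤ I.card ∧ I.card ≤ nodesize) ∨
          ¬ ∃ c, IsAdmissible q (D ω) I (A ω) (d ω v) c
      · rw [if_pos h1, if_pos h1]
        rfl
      · rw [if_neg h1, if_neg h1]
        rfl
    rw [e]
    exact Measurable.ite (measurableSet_setOfPred.2 hfin) measurable_const
      (Measurable.ite (measurableSet_le hxc hc.snd.fst) hL hR)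

lemma measurable_meanResp (hD : Measurable D) (J : Finset (Fin n)) :
    Measurable fun ω => meanResp (D ω) J := by
  unfold meanResp resp
  fun_prop

lemma measurable_treeEstimate {rule : SplitRule n p} {q : ℕ} (nodesize : ℕ)
    (hrule : IsCartRule q rule) (hmeas : IsMeasurableRule rule) {D : Ω → Data n p}
    {x : Ω → Fin p → ℝ} {θ : Ω → Theta n p} (hD : Measurable D) (hx : Measurable x)
    (hθ : Measurable θ) :
    Measurable fun ω => treeEstimate rule q nodesize (D ω) (θ ω) (x ω) := by
  have h1 : Measurable fun ω => (buildTree rule q nodesize (D ω) (θ ω)).finalObs (x ω) :=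
    measurable_apply_of_countable (F := fun S ω => (grow rule q nodesize (D ω) (θ ω).2 n [] S
      (0, 1)).finalObs (x ω)) (fun S => measurable_finalObs_grow nodesize hrule hmeas n [] S hD
      measurable_const hx hθ.snd) hθ.fst
  exact measurable_apply_of_countable (F := fun J ω => meanResp (D ω) J)
    (fun J => measurable_meanResp hD J) h1

lemma measurable_observe {x : Ω → Fin n → Fin p → ℝ} {m : Ω → Fin n → Fin p → Bool}
    {y : Ω → Fin n → ℝ} (hx : Measurable x) (hm : Measurable m) (hy : Measurable y) :
    Measurable fun ω => observe (x ω) (m ω) (y ω) := by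
  refine measurable_pi_iff.2 fun i => Measurable.prodMk (measurable_pi_iff.2 fun h =>
    Measurable.prodMk (by fun_prop) ?_) (by fun_prop)
  have h1 : Measurable fun ω => m ω i h := by fun_prop
  exact Measurable.ite (h1 (measurableSet_singleton true)) measurable_const (by fun_prop)

end Measurability

/-! ### Symmetrization -/

section Symmetrization

/-- If a finite family of measure preserving maps sends every point into `E` for a fraction at most
`κ` of the maps, then `E` has measure at most `κ`. -/
lemma measure_le_of_card_le {Ω : Type*} [MeasurableSpace Ω] {μ : Measure Ω} [IsProbabilityMeasure μ]
    {n : ℕ} {φ : (Fin n → Bool) → Ω → Ω} (hφ : ∀ τ, MeasurePreserving (φ τ) μ μ) {E : Set Ω}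
    (hE : MeasurableSet E) {κ : ℝ}
    (hcard : ∀ ω, (Nat.card {τ | φ τ ω ∈ E} : ℝ) ≤ 2 ^ n * κ) : μ.real E ≤ κ := by
  classical
  have h1 : ∀ τ, ∫ ω, (φ τ ⁻¹' E).indicator (fun _ => (1 : ℝ)) ω ∂μ = μ.real E := by
    intro τ
    rw [integral_indicator_const _ ((hφ τ).measurable hE), measureReal_def,
      (hφ τ).measure_preimage hE.nullMeasurableSet]
    simp [measureReal_def]
  have hint : ∀ τ, Integrable ((φ τ ⁻¹' E).indicator fun _ => (1 : ℝ)) μ := fun τ =>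
    (integrable_const _).indicator ((hφ τ).measurable hE)
  have h2 : ∫ ω, ∑ τ, (φ τ ⁻¹' E).indicator (fun _ => (1 : ℝ)) ω ∂μ = 2 ^ n * μ.real E := by
    rw [integral_finsetSum _ fun τ _ => hint τ]
    simp [h1]
  have h3 : ∫ ω, ∑ τ, (φ τ ⁻¹' E).indicator (fun _ => (1 : ℝ)) ω ∂μ ≤ ∫ _, 2 ^ n * κ ∂μ := by
    refine integral_mono (integrable_finsetSum _ fun τ _ => hint τ) (integrable_const _) fun ω => ?_
    refine le_trans (le_of_eq ?_) (hcard ω)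
    rw [Nat.card_eq_fintype_card, Fintype.card_ofFinset]
    simp [Set.indicator_apply]
  rw [h2] at h3
  simp only [integral_const, probReal_univ, smul_eq_mul, one_mul] at h3
  exact le_of_mul_le_mul_left h3 (by positivity)

lemma card_exists_sign_le {n : ℕ} {ι : Type*} (𝒞 : Finset ι) (c : ι → Fin n → ℝ) {t V : ℝ}
    (ht : 0 ≤ t) (hV : 0 < V) (hc : ∀ C ∈ 𝒞, ∑ i, c C i ^ 2 ≤ V) {P : (Fin n → Bool) → Prop}
    (hP : ∀ τ, P τ → ∃ C ∈ 𝒞, t < |∑ i, if τ i then c C i else - c C i|) :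
    (Nat.card {τ | P τ} : ℝ) ≤ 2 ^ n * (𝒞.card * (2 * Real.exp (-(t ^ 2 / (2 * V))))) := by
  classical
  have h1 : {τ | P τ} ⊆ (𝒞.biUnion fun C => Finset.univ.filter fun τ : Fin n → Bool =>
      t < |∑ i, if τ i then c C i else - c C i| : Finset (Fin n → Bool)) := by
    intro τ hτ
    simpa using hP τ hτ
  have h2 := Set.ncard_le_ncard h1 (Finset.finite_toSet _)
  rw [Set.ncard_coe_finset] at h2
  calc (Nat.card {τ | P τ} : ℝ) ≤ ∑ C ∈ 𝒞, 2 ^ n * (2 * Real.exp (-(t ^ 2 / (2 * V)))) := by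
        refine le_trans (Nat.cast_le.2 (h2.trans Finset.card_biUnion_le)) ?_
        push_cast
        exact Finset.sum_le_sum fun C hC => card_sign_sum_gt_le (c C) ht hV (hc C hC)
    _ = _ := by
        rw [Finset.sum_const, nsmul_eq_mul]
        ring

variable {n p : ℕ}

instance isProbabilityMeasure_unifCube : IsProbabilityMeasure (unifCube p) := by
  refine ⟨?_⟩
  rw [unifCube, Measure.restrict_apply MeasurableSet.univ, Set.univ_inter, Real.volume_Icc_pi]
  simp

/-- The law of one observation: covariate, noise, missingness indicators. -/
noncomputable def obsLaw (p : ℕ) (σ2 : ℝ≥0) (miss : Measure (Fin p → Bool)) :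
    Measure ((Fin p → ℝ) × ℝ × (Fin p → Bool)) :=
  (unifCube p).prod ((gaussianReal 0 σ2).prod miss)

instance isProbabilityMeasure_obsLaw (σ2 : ℝ≥0) (miss : Measure (Fin p → Bool))
    [IsProbabilityMeasure miss] : IsProbabilityMeasure (obsLaw p σ2 miss) := by
  unfold obsLaw
  infer_instance

instance isProbabilityMeasure_sampleLaw (σ2 : ℝ≥0) (miss : Measure (Fin p → Bool))
    [IsProbabilityMeasure miss] : IsProbabilityMeasure (sampleLaw n p σ2 miss) := by
  unfold sampleLaw
  infer_instance

/-- Missingness indicators of a complete observation. -/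
def NoneMissing (M : Fin p → Bool) : Prop := ∀ h, M h = false

lemma measurable_noneMissing : Measurable (NoneMissing (p := p)) := Measurable.of_discrete

lemma measurePreserving_pi_map {α : Type*} [MeasurableSpace α] {ν : Measure α}
    [IsProbabilityMeasure ν] {f : Fin n → α → α} (hf : ∀ i, MeasurePreserving (f i) ν ν) :
    MeasurePreserving (fun (ω : Fin n → α) i => f i (ω i)) (Measure.pi fun _ => ν)
      (Measure.pi fun _ => ν) := by
  have : ∀ i, SigmaFinite (Measure.map (f i) ν) := fun i => by
    rw [(hf i).map_eq]; infer_instance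
  refine ⟨measurable_pi_iff.2 fun i => (hf i).measurable.comp (measurable_pi_apply i), ?_⟩
  rw [Measure.pi_map_pi fun i => (hf i).measurable.aemeasurable]
  simp_rw [fun i => (hf i).map_eq]

/-- Change the sign of the noise of the observations with `τ i = false`. -/
def flipNoise (τ : Fin n → Bool) (ω : Fin n → (Fin p → ℝ) × ℝ × (Fin p → Bool)) :
    Fin n → (Fin p → ℝ) × ℝ × (Fin p → Bool) :=
  fun i => ((ω i).1, if τ i then (ω i).2.1 else - (ω i).2.1, (ω i).2.2)

lemma measurePreserving_flipNoise (σ2 : ℝ≥0) (miss : Measure (Fin p → Bool))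
    [IsProbabilityMeasure miss] (τ : Fin n → Bool) :
    MeasurePreserving (flipNoise (p := p) τ) (sampleLaw n p σ2 miss) (sampleLaw n p σ2 miss) := by
  have hneg : MeasurePreserving (fun x : ℝ => -x) (gaussianReal 0 σ2) (gaussianReal 0 σ2) :=
    ⟨measurable_neg, by rw [gaussianReal_map_neg, neg_zero]⟩
  have hi : ∀ i, MeasurePreserving (fun o : (Fin p → ℝ) × ℝ × (Fin p → Bool) =>
      (o.1, if τ i then o.2.1 else - o.2.1, o.2.2)) (obsLaw p σ2 miss) (obsLaw p σ2 miss) := by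
    intro i
    cases τ i
    · exact (MeasurePreserving.id _).prod (hneg.prod (MeasurePreserving.id _))
    · simp only [if_true]
      exact MeasurePreserving.id (obsLaw p σ2 miss)
  exact measurePreserving_pi_map hi

/-- The set of samples whose noise has a sum of squares at most `V` over `S` and, weighted by `ψ`,
is not balanced on some union of leaves of a cut tree with at most `k` leaves. -/
def noiseEvent (S : Finset (Fin n)) (k : ℕ) (ψ : (Fin p → ℝ) → ℝ) (V t : ℝ) :
    Set (Fin n → (Fin p → ℝ) × ℝ × (Fin p → Bool)) :=
  {ω | ∑ i ∈ S, (ω i).2.1 ^ 2 ≤ V ∧ ∃ C : Finset (Fin n), ∃ k' : ℕ, k' ≤ k ∧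
    IsTrace (fun i => (ω i).1) k' S C ∧
    t < |∑ i, {i | i ∈ C ∧ NoneMissing (ω i).2.2}.indicator (fun i => ψ (ω i).1 * (ω i).2.1) i|}

lemma measurableSet_noiseEvent (S : Finset (Fin n)) (k : ℕ) {ψ : (Fin p → ℝ) → ℝ}
    (hψ : Measurable ψ) (V t : ℝ) : MeasurableSet (noiseEvent S k ψ V t) := by
  classical
  unfold noiseEvent
  refine measurableSet_setOfPred.2 (Measurable.and ?_ (Measurable.exists fun C =>
    Measurable.exists fun k' => measurable_const.and (Measurable.and ?_ ?_)))
  · exact measurableSet_setOfPred.1 (measurableSet_le (by fun_prop) measurable_const)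
  · exact (measurable_isTrace k' S C).comp (by fun_prop : Measurable
      fun (ω : Fin n → (Fin p → ℝ) × ℝ × (Fin p → Bool)) i => (ω i).1)
  · refine measurableSet_setOfPred.1 (measurableSet_lt measurable_const ?_)
    refine measurable_abs.comp (Finset.measurable_sum _ fun i _ => ?_)
    simp only [Set.indicator_apply, Set.mem_ofPred_eq]
    refine Measurable.ite (measurableSet_setOfPred.2 (measurable_const.and ?_)) (by fun_prop)
      measurable_const
    exact measurable_noneMissing.comp (by fun_prop)

/-- The noise is independent of the covariates, hence of the `exp(o(|S|))` traces, and symmetric;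
so it is balanced on all of them. -/
lemma measureReal_noiseEvent_le (hp : 1 ≤ p) (σ2 : ℝ≥0) (miss : Measure (Fin p → Bool))
    [IsProbabilityMeasure miss] (S : Finset (Fin n)) (k : ℕ) {ψ : (Fin p → ℝ) → ℝ}
    (hψ : Measurable ψ) {B : ℝ} (hB : 0 < B) (hψB : ∀ x, |ψ x| ≤ B) {V t : ℝ} (hV : 0 < V)
    (ht : 0 ≤ t) {θ : ℝ} (hθ0 : 0 < θ) (hθ1 : θ < 1) :
    (sampleLaw n p σ2 miss).real (noiseEvent S k ψ V t) ≤
      ((1 - θ)⁻¹) ^ S.card * (8 * p / θ) ^ k * (2 * Real.exp (-(t ^ 2 / (2 * (B ^ 2 * V))))) := by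
  classical
  have h1θ : 0 < 1 - θ := by linarith
  refine measure_le_of_card_le (measurePreserving_flipNoise σ2 miss)
    (measurableSet_noiseEvent S k hψ V t) fun ω => ?_
  set w : Fin n → Fin p → ℝ := fun i => (ω i).1 with hw
  by_cases hVω : ∑ i ∈ S, (ω i).2.1 ^ 2 ≤ V
  swap
  · have : {τ | flipNoise τ ω ∈ noiseEvent S k ψ V t} = ∅ := by
      refine Set.eq_empty_of_forall_notMem fun τ hτ => hVω ?_
      refine le_trans (le_of_eq (Finset.sum_congr rfl fun i _ => ?_)) hτ.1
      simp only [flipNoise]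
      split_ifs <;> simp
    rw [this]
    simp only [Nat.card_eq_fintype_card, Fintype.card_of_isEmpty, Nat.cast_zero]
    positivity
  set coef : Finset (Fin n) → Fin n → ℝ := fun C =>
    {i | i ∈ C ∧ NoneMissing (ω i).2.2}.indicator (fun i => ψ (ω i).1 * (ω i).2.1) with hcoef
  have hsub : ∀ τ, flipNoise τ ω ∈ noiseEvent S k ψ V t → ∃ C ∈ tracesLE w k S,
      t < |∑ i, if τ i then coef C i else - coef C i| := by
    rintro τ ⟨-, C, k', hk', hC, hgt⟩
    refine ⟨C, mem_tracesLE.2 ⟨k', hk', hC⟩, ?_⟩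
    convert hgt using 3 with i
    simp only [hcoef, flipNoise, Set.indicator_apply, Set.mem_ofPred_eq]
    split_ifs <;> simp
  have hcoefV : ∀ C ∈ tracesLE w k S, ∑ i, coef C i ^ 2 ≤ B ^ 2 * V := by
    intro C hC
    obtain ⟨k', -, hk'⟩ := mem_tracesLE.1 hC
    calc ∑ i, coef C i ^ 2 ≤ ∑ i, if i ∈ S then B ^ 2 * (ω i).2.1 ^ 2 else 0 := by
          refine Finset.sum_le_sum fun i _ => ?_
          simp only [hcoef, Set.indicator_apply, Set.mem_ofPred_eq]
          by_cases hi : i ∈ C ∧ NoneMissing (ω i).2.2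
          · rw [if_pos hi, if_pos (hk'.subset hi.1), mul_pow, ← sq_abs (ψ _)]
            gcongr
            exact hψB _
          · rw [if_neg hi, zero_pow two_ne_zero]
            split_ifs
            · positivity
            · exact le_rfl
      _ = B ^ 2 * ∑ i ∈ S, (ω i).2.1 ^ 2 := by
          rw [Finset.mul_sum]; simp
      _ ≤ _ := by gcongr
  refine (card_exists_sign_le (tracesLE w k S) coef ht (by positivity) hcoefV hsub).trans ?_
  gcongr
  exact card_tracesLE_le hp w k S hθ0 hθ1

/-- Exchange the covariate and the ghost point of the observations with `τ i = false`. -/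
def swapGhost (τ : Fin n → Bool)
    (u : (Fin n → (Fin p → ℝ) × ℝ × (Fin p → Bool)) × (Fin n → Fin p → ℝ)) :
    (Fin n → (Fin p → ℝ) × ℝ × (Fin p → Bool)) × (Fin n → Fin p → ℝ) :=
  (fun i => (if τ i then (u.1 i).1 else u.2 i, (u.1 i).2),
    fun i => if τ i then u.2 i else (u.1 i).1)

/-- The law of `n` ghost points. -/
noncomputable def ghostLaw (n p : ℕ) : Measure (Fin n → Fin p → ℝ) :=
  Measure.pi fun _ => unifCube p

instance isProbabilityMeasure_ghostLaw : IsProbabilityMeasure (ghostLaw n p) := by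
  unfold ghostLaw
  infer_instance

lemma measurePreserving_swapGhost (σ2 : ℝ≥0) (miss : Measure (Fin p → Bool))
    [IsProbabilityMeasure miss] (τ : Fin n → Bool) :
    MeasurePreserving (swapGhost (p := p) τ) ((sampleLaw n p σ2 miss).prod (ghostLaw n p))
      ((sampleLaw n p σ2 miss).prod (ghostLaw n p)) := by
  set ν := (obsLaw p σ2 miss).prod (unifCube p) with hν
  have hswap : MeasurePreserving (fun o : ((Fin p → ℝ) × ℝ × (Fin p → Bool)) × (Fin p → ℝ) =>
      ((o.2, o.1.2), o.1.1)) ν ν := by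
    -- the exchange of two coordinates of a product of three measures
    have h1 : MeasurePreserving MeasurableEquiv.prodAssoc ν
        ((unifCube p).prod (((gaussianReal 0 σ2).prod miss).prod (unifCube p))) :=
      measurePreserving_prodAssoc _ _ _
    have h2 : MeasurePreserving Prod.swap (((gaussianReal 0 σ2).prod miss).prod (unifCube p))
      ((unifCube p).prod ((gaussianReal 0 σ2).prod miss)) := Measure.measurePreserving_swap
    have h3 := (MeasurePreserving.id (unifCube p)).prod h2
    have h4 : MeasurePreserving Prod.swap
        ((unifCube p).prod ((unifCube p).prod ((gaussianReal 0 σ2).prod miss)))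
        (((unifCube p).prod ((gaussianReal 0 σ2).prod miss)).prod (unifCube p)) :=
      Measure.measurePreserving_swap
    exact h4.comp (h3.comp h1)
  have hi : ∀ i, MeasurePreserving (fun o : ((Fin p → ℝ) × ℝ × (Fin p → Bool)) × (Fin p → ℝ) =>
      ((if τ i then o.1.1 else o.2, o.1.2), if τ i then o.2 else o.1.1)) ν ν := by
    intro i
    cases τ i
    · exact hswap
    · simp only [if_true]
      exact MeasurePreserving.id ν
  have hpi := measurePreserving_pi_map (n := n) hi
  have he := measurePreserving_arrowProdEquivProdArrow ((Fin p → ℝ) × ℝ × (Fin p → Bool))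
    (Fin p → ℝ) (Fin n) (fun _ => obsLaw p σ2 miss) (fun _ => unifCube p)
  exact he.comp (hpi.comp (he.symm _))

/-- The covariates (`true`) and the ghost points (`false`). -/
def ghostPoints (u : (Fin n → (Fin p → ℝ) × ℝ × (Fin p → Bool)) × (Fin n → Fin p → ℝ)) :
    Fin n × Bool → Fin p → ℝ :=
  fun j => if j.2 then (u.1 j.1).1 else u.2 j.1

lemma measurable_ghostPoints : Measurable (ghostPoints (n := n) (p := p)) := by
  refine measurable_pi_iff.2 fun j => ?_
  unfold ghostPoints
  split_ifs <;> fun_prop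

lemma IsTrace.image {J J' : Type*} [DecidableEq J] [DecidableEq J'] {w : J' → Fin p → ℝ}
    (σ : J → J') {k : ℕ} {S C : Finset J} (h : IsTrace (fun j => w (σ j)) k S C) :
    IsTrace w k (S.image σ) (C.image σ) := by
  induction h with
  | empty S => exact .empty _
  | full S => exact .full _
  | node h hlt h₁ h₂ ih₁ ih₂ =>
    rw [Finset.image_union, Finset.image_union]
    refine .node h ?_ ih₁ ih₂
    intro i hi j hj
    obtain ⟨i', hi', rfl⟩ := Finset.mem_image.1 hi
    obtain ⟨j', hj', rfl⟩ := Finset.mem_image.1 hj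
    exact hlt i' hi' j' hj'

open Classical in
/-- The contribution of the point `j` to the number of complete observations, or of the
corresponding ghosts, that lie in `Q` and in the trace `C`. -/
noncomputable def traceMass
    (u : (Fin n → (Fin p → ℝ) × ℝ × (Fin p → Bool)) × (Fin n → Fin p → ℝ))
    (Q : Set (Fin p → ℝ)) (C : Finset (Fin n × Bool)) (j : Fin n × Bool) : ℝ :=
  if j ∈ C ∧ ghostPoints u j ∈ Q ∧ NoneMissing (u.1 j.1).2.2 then 1 else 0

/-- The set of samples and ghosts that disagree on some union of leaves of a cut tree with at most
`k` leaves, intersected with `Q`. -/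
def ghostEvent (S : Finset (Fin n)) (k : ℕ) (Q : Set (Fin p → ℝ)) (t : ℝ) :
    Set ((Fin n → (Fin p → ℝ) × ℝ × (Fin p → Bool)) × (Fin n → Fin p → ℝ)) :=
  {u | ∃ C : Finset (Fin n × Bool), ∃ k' : ℕ, k' ≤ k ∧
    IsTrace (ghostPoints u) k' (S ×ˢ Finset.univ) C ∧
    t < |∑ i, (traceMass u Q C (i, true) - traceMass u Q C (i, false))|}

lemma measurableSet_ghostEvent (S : Finset (Fin n)) (k : ℕ) {Q : Set (Fin p → ℝ)}
    (hQ : MeasurableSet Q) (t : ℝ) : MeasurableSet (ghostEvent S k Q t) := by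
  classical
  unfold ghostEvent
  have hmass : ∀ C j, Measurable fun u :
      (Fin n → (Fin p → ℝ) × ℝ × (Fin p → Bool)) × (Fin n → Fin p → ℝ) => traceMass u Q C j := by
    intro C j
    unfold traceMass
    refine Measurable.ite (measurableSet_setOfPred.2 (measurable_const.and (Measurable.and ?_ ?_)))
      measurable_const measurable_const
    · exact measurableSet_setOfPred.1
        (((measurable_pi_apply j).comp measurable_ghostPoints) hQ)
    · exact measurable_noneMissing.comp (by fun_prop)
  refine measurableSet_setOfPred.2 (Measurable.exists fun C =>
    Measurable.exists fun k' => measurable_const.and (Measurable.and ?_ ?_))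
  · exact (measurable_isTrace k' _ C).comp measurable_ghostPoints
  · refine measurableSet_setOfPred.1 (measurableSet_lt measurable_const ?_)
    exact measurable_abs.comp (Finset.measurable_sum _ fun i _ => (hmass _ _).sub (hmass _ _))

/-- Complete observations and their ghosts are exchangeable, hence agree on the `exp(o(|S|))` traces
of the set of all these points. -/
lemma measureReal_ghostEvent_le (hp : 1 ≤ p) (σ2 : ℝ≥0) (miss : Measure (Fin p → Bool))
    [IsProbabilityMeasure miss] (S : Finset (Fin n)) (hS : 0 < S.card) (k : ℕ)
    {Q : Set (Fin p → ℝ)} (hQ : MeasurableSet Q) {t : ℝ} (ht : 0 ≤ t) {θ : ℝ} (hθ0 : 0 < θ)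
    (hθ1 : θ < 1) :
    ((sampleLaw n p σ2 miss).prod (ghostLaw n p)).real (ghostEvent S k Q t) ≤
      ((1 - θ)⁻¹) ^ (2 * S.card) * (8 * p / θ) ^ k *
        (2 * Real.exp (-(t ^ 2 / (2 * S.card)))) := by
  classical
  have h1θ : 0 < 1 - θ := by linarith
  have hS' : (0 : ℝ) < S.card := by exact_mod_cast hS
  refine measure_le_of_card_le (measurePreserving_swapGhost σ2 miss)
    (measurableSet_ghostEvent S k hQ t) fun u => ?_
  set w := ghostPoints u with hw
  set S₂ : Finset (Fin n × Bool) := S ×ˢ Finset.univ with hS₂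
  set coef : Finset (Fin n × Bool) → Fin n → ℝ := fun C i =>
    traceMass u Q C (i, true) - traceMass u Q C (i, false) with hcoef
  have hsub : ∀ τ, swapGhost τ u ∈ ghostEvent S k Q t → ∃ C ∈ tracesLE w k S₂,
      t < |∑ i, if τ i then coef C i else - coef C i| := by
    rintro τ ⟨C, k', hk', hC, hgt⟩
    -- swapping permutes the indices of the points
    set σ : Fin n × Bool → Fin n × Bool := fun j => (j.1, if τ j.1 then j.2 else !j.2) with hσ
    have hσσ : ∀ j, σ (σ j) = j := by
      rintro ⟨i, b⟩
      simp only [hσ]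
      cases τ i <;> simp
    have hpts : ghostPoints (swapGhost τ u) = fun j => w (σ j) := by
      ext1 ⟨i, b⟩
      simp only [hσ, hw, ghostPoints, swapGhost]
      cases τ i <;> cases b <;> simp
    rw [hpts] at hC
    have hC' := hC.image σ
    have himg : S₂.image σ = S₂ := by
      ext ⟨i, b⟩
      simp only [Finset.mem_image]
      constructor
      · rintro ⟨j, hj, hji⟩
        have : j.1 = i := congrArg Prod.fst hji
        rw [hS₂, Finset.mem_product] at hj ⊢
        exact ⟨this ▸ hj.1, Finset.mem_univ _⟩
      · intro hi
        refine ⟨σ (i, b), ?_, hσσ _⟩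
        rw [hS₂, Finset.mem_product] at hi ⊢
        exact ⟨hi.1, Finset.mem_univ _⟩
    rw [himg] at hC'
    refine ⟨C.image σ, mem_tracesLE.2 ⟨k', hk', hC'⟩, ?_⟩
    have hmass : ∀ j, traceMass (swapGhost τ u) Q C j = traceMass u Q (C.image σ) (σ j) := by
      intro j
      have hmem : σ j ∈ C.image σ ↔ j ∈ C := by
        rw [Finset.mem_image]
        constructor
        · rintro ⟨j', hj', he⟩
          rwa [← hσσ j, ← he, hσσ]
        · exact fun hj => ⟨j, hj, rfl⟩
      have hpt : ghostPoints (swapGhost τ u) j = ghostPoints u (σ j) := congrFun hpts j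
      unfold traceMass
      refine if_congr (and_congr hmem.symm ?_) rfl rfl
      rw [hpt]
      rfl
    convert hgt using 3 with i
    rw [hmass, hmass]
    simp only [hcoef, hσ]
    cases τ i <;> simp
  have hcoefV : ∀ C ∈ tracesLE w k S₂, ∑ i, coef C i ^ 2 ≤ S.card := by
    intro C hC
    obtain ⟨k', -, hk'⟩ := mem_tracesLE.1 hC
    have hm01 : ∀ j, 0 ≤ traceMass u Q C j ∧ traceMass u Q C j ≤ 1 := by
      intro j
      unfold traceMass
      split_ifs <;> norm_num
    calc ∑ i, coef C i ^ 2 ≤ ∑ i : Fin n, if i ∈ S then (1 : ℝ) else 0 := by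
          refine Finset.sum_le_sum fun i _ => ?_
          split_ifs with hi
          · have h1 := hm01 (i, true)
            have h2 := hm01 (i, false)
            simp only [hcoef]
            nlinarith
          · have hnot : ∀ b, traceMass u Q C (i, b) = 0 := by
              intro b
              unfold traceMass
              rw [if_neg]
              rintro ⟨hj, -⟩
              exact hi (Finset.mem_product.1 (hk'.subset hj)).1
            simp [hcoef, hnot]
      _ = S.card := by simp
  refine (card_exists_sign_le (tracesLE w k S₂) coef ht hS' hcoefV hsub).trans ?_
  gcongr
  refine (card_tracesLE_le hp w k S₂ hθ0 hθ1).trans (le_of_eq ?_)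
  rw [hS₂, Finset.card_product]
  simp [mul_comm]

end Symmetrization

/-! ### Error on the ghost points for balanced data -/

section GhostError

variable {n p : ℕ}

/-- The observed data of a sample with regression function `m`. -/
noncomputable def sampleData (m : (Fin p → ℝ) → ℝ)
    (ω : Fin n → (Fin p → ℝ) × ℝ × (Fin p → Bool)) : Data n p :=
  observe (fun i => (ω i).1) (fun i => (ω i).2.2) (fun i => m (ω i).1 + (ω i).2.1)

variable {m : (Fin p → ℝ) → ℝ} {ω : Fin n → (Fin p → ℝ) × ℝ × (Fin p → Bool)}

lemma isMissing_sampleData (i : Fin n) (h : Fin p) :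
    IsMissing (sampleData m ω) i h ↔ (ω i).2.2 h = true := Iff.rfl

lemma value_sampleData {i : Fin n} {h : Fin p} (hh : ¬ IsMissing (sampleData m ω) i h) :
    value (sampleData m ω) i h = (ω i).1 h :=
  if_neg hh

lemma isComplete_sampleData (i : Fin n) :
    IsComplete (sampleData m ω) i ↔ NoneMissing (ω i).2.2 := by
  simp [IsComplete, isMissing_sampleData, NoneMissing]

lemma loc_sampleData {i : Fin n} (hi : NoneMissing (ω i).2.2) :
    loc (sampleData m ω) i = (ω i).1 := by
  ext h
  exact value_sampleData ((isComplete_sampleData i).2 hi h)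

lemma resp_sampleData (i : Fin n) : resp (sampleData m ω) i = m (ω i).1 + (ω i).2.1 := rfl

lemma isBalanced_of_notMem_noiseEvent {S : Finset (Fin n)} {k : ℕ} {ψ : (Fin p → ℝ) → ℝ}
    {V t : ℝ} (hV : ∑ i ∈ S, (ω i).2.1 ^ 2 ≤ V) (hω : ω ∉ noiseEvent S k ψ V t) :
    IsBalanced (sampleData m ω) S k t fun i => ψ (loc (sampleData m ω) i) *
      (resp (sampleData m ω) i - m (loc (sampleData m ω) i)) := by
  classical
  intro T hT
  by_contra! hlt
  refine hω ⟨hV, _, T.leaves, hT, isTrace_filter_eval _ T S, lt_of_lt_of_eq hlt ?_⟩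
  congr 1
  rw [← Finset.sum_subset (Finset.subset_univ (completeObs (sampleData m ω) S))]
  · refine Finset.sum_congr rfl fun i hi => ?_
    obtain ⟨hiS, hic⟩ := mem_completeObs.1 hi
    rw [isComplete_sampleData] at hic
    simp only [Set.indicator_apply, Set.mem_ofPred_eq, Finset.mem_filter, hiS, hic, true_and,
      and_true, loc_sampleData hic, resp_sampleData, add_sub_cancel_left]
  · intro i _ hi
    refine Set.indicator_of_notMem ?_ _
    rintro ⟨hiC, hc⟩
    exact hi (mem_completeObs.2 ⟨(Finset.mem_filter.1 hiC).1, (isComplete_sampleData i).2 hc⟩)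

/-- The points where `⌊m / w⌋ = r`. -/
def levelBin (m : (Fin p → ℝ) → ℝ) (w : ℝ) (r : ℤ) : Set (Fin p → ℝ) := {x | ⌊m x / w⌋ = r}

lemma measurableSet_levelBin (hm : Measurable m) (w : ℝ) (r : ℤ) :
    MeasurableSet (levelBin m w r) :=
  (Int.measurable_floor.comp (hm.div_const w)) (measurableSet_singleton r)

lemma abs_sub_le_of_mem_levelBin {w : ℝ} (hw : 0 < w) {r : ℤ} {x : Fin p → ℝ}
    (hx : x ∈ levelBin m w r) : |m x - r * w| ≤ w := by
  have h1 : ⌊m x / w⌋ = r := hx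
  have h2 : (r : ℝ) * w ≤ m x := by
    rw [← le_div_iff₀ hw, ← h1]; exact Int.floor_le _
  have h3 : m x ≤ ((r : ℝ) + 1) * w := by
    rw [← div_le_iff₀ hw, ← h1]; exact (Int.lt_floor_add_one _).le
  rw [abs_le]
  constructor <;> linarith

open Classical in
/-- The number of observations of `S` that are complete and whose ghost point is badly predicted
by the tree `T`. -/
noncomputable def ghostErrorCount (m : (Fin p → ℝ) → ℝ)
    (ω : Fin n → (Fin p → ℝ) × ℝ × (Fin p → Bool)) (g : Fin n → Fin p → ℝ) (ξ : ℝ)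
    (S : Finset (Fin n)) (T : CartTree n p) : ℝ :=
  ∑ i ∈ S, if NoneMissing (ω i).2.2 ∧
    ξ < |meanResp (sampleData m ω) (T.finalObs (g i)) - m (g i)| then 1 else 0

/-- If the complete observations and their ghosts agree on the traces of cut trees in each level
bin of `m`, then the errors at the ghosts are controlled by the errors at the observations. The
tree depends on the data, but the set of its leaves whose mean is far from a given level is a
union of leaves of a cut tree. -/
lemma ghostErrorCount_le {g : Fin n → Fin p → ℝ} {ξ t : ℝ} (hξ : 0 < ξ) {S : Finset (Fin n)}
    {k : ℕ} {bins : Finset ℤ} (hbins : ∀ x, ⌊m x / (ξ / 4)⌋ ∈ bins)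
    (hg : ∀ r ∈ bins, (ω, g) ∉ ghostEvent S k (levelBin m (ξ / 4) r) t) {T : CartTree n p}
    (hT : T.numLeaves ≤ k) :
    ghostErrorCount m ω g ξ S T ≤ errorCount (sampleData m ω) m (ξ / 2) S T + bins.card * t := by
  classical
  set D := sampleData m ω with hD
  set b : ℤ → Finset (Fin n) → Bool := fun r J => decide (3 * ξ / 4 < |meanResp D J - r * (ξ / 4)|)
    with hb
  set C : ℤ → Finset (Fin n × Bool) := fun r => (S ×ˢ Finset.univ).filter fun j =>
    (T.label (b r)).eval (ghostPoints (ω, g) j) = true with hC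
  set tm : ℤ → Fin n × Bool → ℝ := fun r j =>
    traceMass (ω, g) (levelBin m (ξ / 4) r) (C r) j with htm
  have hw : 0 < ξ / 4 := by positivity
  have hmemC : ∀ r j, j ∈ C r ↔ j.1 ∈ S ∧
      3 * ξ / 4 < |meanResp D (T.finalObs (ghostPoints (ω, g) j)) - r * (ξ / 4)| := by
    intro r j
    simp [hC, CartTree.eval_label, hb]
  have hagree : ∀ r ∈ bins, ∑ i, tm r (i, false) ≤ ∑ i, tm r (i, true) + t := by
    intro r hr
    have h1 : ¬ (t < |∑ i, (tm r (i, true) - tm r (i, false))|) := fun hlt =>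
      hg r hr ⟨C r, _, (CartTree.leaves_label (b r) T).le.trans hT, isTrace_filter_eval _ _ _, hlt⟩
    rw [not_lt, Finset.sum_sub_distrib] at h1
    linarith [(abs_le.1 h1).1]
  have htm0 : ∀ r j, 0 ≤ tm r j := by
    intro r j
    simp only [htm, traceMass]
    split_ifs <;> norm_num
  have hleft : ghostErrorCount m ω g ξ S T ≤ ∑ i, ∑ r ∈ bins, tm r (i, false) := by
    rw [ghostErrorCount, ← Finset.sum_filter_add_sum_filter_not Finset.univ (· ∈ S)]
    refine le_add_of_le_of_nonneg ?_ (Finset.sum_nonneg fun i _ => Finset.sum_nonneg fun r _ =>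
      htm0 r _)
    rw [Finset.filter_mem_eq_inter, Finset.univ_inter]
    refine Finset.sum_le_sum fun i hi => ?_
    split_ifs with hbad
    · obtain ⟨hnm, hlt⟩ := hbad
      refine le_trans (le_of_eq ?_) (Finset.single_le_sum (fun r _ => htm0 r _) (hbins (g i)))
      have hx : g i ∈ levelBin m (ξ / 4) ⌊m (g i) / (ξ / 4)⌋ := rfl
      have h1 := abs_sub_le_of_mem_levelBin hw hx
      have h2 := abs_sub_le (meanResp D (T.finalObs (g i))) (⌊m (g i) / (ξ / 4)⌋ * (ξ / 4))
        (m (g i))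
      rw [abs_sub_comm (_ * _) (m (g i))] at h2
      change ξ < |meanResp D (T.finalObs (g i)) - m (g i)| at hlt
      refine (if_pos ⟨(hmemC _ _).2 ⟨hi, ?_⟩, hx, hnm⟩).symm
      change 3 * ξ / 4 < |meanResp D (T.finalObs (g i)) - ⌊m (g i) / (ξ / 4)⌋ * (ξ / 4)|
      linarith
    · exact Finset.sum_nonneg fun r _ => htm0 r _
  have hright : ∑ i, ∑ r ∈ bins, tm r (i, true) ≤ errorCount D m (ξ / 2) S T := by
    rw [errorCount, ← Finset.sum_filter_add_sum_filter_not Finset.univ (· ∈ completeObs D S)]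
    have hzero : ∑ i ∈ Finset.univ.filter (· ∉ completeObs D S),
        ∑ r ∈ bins, tm r (i, true) = 0 := by
      refine Finset.sum_eq_zero fun i hi => Finset.sum_eq_zero fun r _ => if_neg ?_
      rintro ⟨h1, -, h3⟩
      exact (Finset.mem_filter.1 hi).2 (mem_completeObs.2
        ⟨((hmemC _ _).1 h1).1, (isComplete_sampleData i).2 h3⟩)
    rw [hzero, add_zero, Finset.filter_mem_eq_inter, Finset.univ_inter]
    refine Finset.sum_le_sum fun i hi => ?_
    have hnm := (isComplete_sampleData i).1 (mem_completeObs.1 hi).2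
    have hloc : loc D i = (ω i).1 := loc_sampleData hnm
    rw [Finset.sum_eq_single_of_mem ⌊m (ω i).1 / (ξ / 4)⌋ (hbins _)]
    · simp only [htm, traceMass]
      split_ifs with h1 h2
      · exact le_rfl
      · refine absurd ?_ h2
        have h3 := ((hmemC _ _).1 h1.1).2
        change 3 * ξ / 4 < |meanResp D (T.finalObs (ω i).1) -
          ⌊m (ω i).1 / (ξ / 4)⌋ * (ξ / 4)| at h3
        have h4 := abs_sub_le_of_mem_levelBin hw
          (show (ω i).1 ∈ levelBin m (ξ / 4) ⌊m (ω i).1 / (ξ / 4)⌋ from rfl)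
        have h5 := abs_sub_le (meanResp D (T.finalObs (ω i).1)) (m (ω i).1)
          (⌊m (ω i).1 / (ξ / 4)⌋ * (ξ / 4))
        rw [hloc]
        linarith
      · norm_num
      · exact le_rfl
    · intro r _ hr
      refine if_neg ?_
      rintro ⟨-, h2, -⟩
      exact hr (h2 : ⌊m (ω i).1 / (ξ / 4)⌋ = r).symm
  calc ghostErrorCount m ω g ξ S T ≤ ∑ i, ∑ r ∈ bins, tm r (i, false) := hleft
    _ = ∑ r ∈ bins, ∑ i, tm r (i, false) := Finset.sum_comm
    _ ≤ ∑ r ∈ bins, (∑ i, tm r (i, true) + t) := Finset.sum_le_sum hagree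
    _ = ∑ i, ∑ r ∈ bins, tm r (i, true) + bins.card * t := by
        rw [Finset.sum_add_distrib, Finset.sum_comm]
        simp
    _ ≤ _ := by gcongr

end GhostError

/-! ### Error of a tree with a fixed subsample -/

section FixedSubsample

variable {n p : ℕ}

/-- The rate of the total error in a settled cell (`IsSettled.sum_error_le`); it is small when `ζ`,
then `ω`, then `η` are small. -/
noncomputable def settledRate (p : ℕ) (η ζ ω Λ : ℝ) : ℝ :=
  2 * p * √η + 2 * ζ + 2 / ζ * (p * (Λ * (1 + 2 * p)) * √η + 2 * p * ω + 2 * p * √η)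

/-- The sample covariates lie in `(0,1]ᵖ` and are distinct in each coordinate. -/
def IsGeneric (o : Fin n → (Fin p → ℝ) × ℝ × (Fin p → Bool)) : Prop :=
  (∀ i h, 0 < (o i).1 h ∧ (o i).1 h ≤ 1) ∧
    ∀ h i j, (o i).1 h = (o j).1 h → i = j

/-- `mc h` is within `ω` on `(0,1]` of the step function `∑ j < N, α h j 1{x ≤ t j}`, and the
absolute values of the coefficients `α h j` sum to at most `Λ`. -/
def IsStepApprox (mc : Fin p → ℝ → ℝ) (N : ℕ) (t : ℕ → ℝ) (α : Fin p → ℕ → ℝ) (ω Λ : ℝ) : Prop :=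
  (∀ h, ∑ j ∈ Finset.range N, |α h j| ≤ Λ) ∧ ∀ h x, 0 < x → x ≤ 1 →
    |mc h x - ∑ j ∈ Finset.range N, if x ≤ t j then α h j else 0| ≤ ω

variable {rule : SplitRule n p} {q nodesize s : ℕ} {mc : Fin p → ℝ → ℝ}
  {o : Fin n → (Fin p → ℝ) × ℝ × (Fin p → Bool)}

lemma sum_resp_sq_le {m : (Fin p → ℝ) → ℝ} {B V : ℝ} (hB : ∀ x, |m x| ≤ B) {S : Finset (Fin n)}
    (hV : ∑ i ∈ S, (o i).2.1 ^ 2 ≤ V) :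
    ∑ i ∈ S, resp (sampleData m o) i ^ 2 ≤ 2 * B ^ 2 * S.card + 2 * V := by
  calc ∑ i ∈ S, resp (sampleData m o) i ^ 2 ≤ ∑ i ∈ S, (2 * B ^ 2 + 2 * (o i).2.1 ^ 2) := by
        refine Finset.sum_le_sum fun i _ => ?_
        rw [resp_sampleData]
        have h1 : m (o i).1 ^ 2 ≤ B ^ 2 := sq_le_sq' (neg_le_of_abs_le (hB _)) (le_of_abs_le (hB _))
        nlinarith [sq_nonneg (m (o i).1 - (o i).2.1)]
    _ = 2 * B ^ 2 * S.card + 2 * ∑ i ∈ S, (o i).2.1 ^ 2 := by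
        rw [Finset.sum_add_distrib, Finset.mul_sum]
        simp [mul_comm]
    _ ≤ _ := by gcongr

lemma IsGeneric.isInside {m : (Fin p → ℝ) → ℝ} (ho : IsGeneric o) (S : Finset (Fin n)) :
    IsInside (sampleData m o) S (0, 1) := by
  refine ⟨fun h => zero_le_one, fun i _ h hh => ?_⟩
  rw [value_sampleData hh]
  exact ho.1 i h

lemma IsGeneric.exists_isAdmissible {m : (Fin p → ℝ) → ℝ} (ho : IsGeneric o) (hqs : 2 * q ≤ s)
    {H : Finset (Fin p)} {I : Finset (Fin n)} {A : Cell p} (hH : H.Nonempty)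
    (hIn : IsInside (sampleData m o) I A) (hs : s ≤ I.card) :
    ∃ c, IsAdmissible q (sampleData m o) I A H c := by
  obtain ⟨h, hh⟩ := hH
  refine MissingForest.exists_isAdmissible hIn hh ?_ (hqs.trans hs)
  intro i _ j _ hi hj hij
  rw [value_sampleData hi, value_sampleData hj] at hij
  exact ho.2 h i j hij

/-- For generic balanced data, few complete observations outside the stray ones are badly
predicted. -/
lemma errorCount_buildTree_le (hrule : IsCartRule q rule) (hq1 : 1 ≤ q) (hns : nodesize < s)
    (hqs : 2 * q ≤ s) {S : Finset (Fin n)} (hsS : s ≤ S.card) {k₀ : ℕ} (hk₀ : 1 ≤ k₀)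
    (hS : S.card < (k₀ + 1) * q) {N : ℕ} {t : ℕ → ℝ} {α : Fin p → ℕ → ℝ} {ω Λ : ℝ}
    (happ : IsStepApprox mc N t α ω Λ) (hΛ : 0 ≤ Λ) (hω : 0 ≤ ω) {η ζ : ℝ} (hη : 0 ≤ η)
    (hζ : 0 < ζ) {K : ℕ} {C : ℝ} (hC : 0 ≤ C) (hCq : q * (C * S.card) ≤ η * (s : ℝ) ^ 2)
    {ν : ℝ} (hν : 0 ≤ ν) (ho : IsGeneric o)
    (hY : ∑ i ∈ S, resp (sampleData (fun x => ∑ h, mc h (x h)) o) i ^ 2 ≤ C * S.card)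
    {V : ℝ} (hV : ∑ i ∈ S, (o i).2.1 ^ 2 ≤ V)
    (h₁ : o ∉ noiseEvent S (k₀ + K) (fun _ => 1) V ν)
    (h₂ : o ∉ noiseEvent S (k₀ + K) (fun x => ∑ h, mc h (x h)) V ν)
    {d : List Bool → Finset (Fin p)} (hd : ∀ v, (d v).Nonempty) {ξ : ℝ} (hξ : 0 < ξ) :
    errorCount (sampleData (fun x => ∑ h, mc h (x h)) o) (fun x => ∑ h, mc h (x h)) ξ S
        (buildTree rule q nodesize (sampleData (fun x => ∑ h, mc h (x h)) o) (S, d)) ≤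
      stray rule q s η (sampleData (fun x => ∑ h, mc h (x h)) o) d K [] S (0, 1) +
        (settledRate p η ζ ω Λ * (1 + C) * S.card +
          2 ^ K * (ν * (2 + 2 / ζ * (1 + (1 + C * S.card / s))))) / ξ := by
  set m : (Fin p → ℝ) → ℝ := fun x => ∑ h, mc h (x h) with hm
  set D := sampleData m o with hD
  have hs0 : 0 < s := by omega
  have hs0' : (0 : ℝ) < s := by exact_mod_cast hs0
  have hrate : 0 ≤ settledRate p η ζ ω Λ := by
    unfold settledRate
    positivity
  have hb₁ := isBalanced_of_notMem_noiseEvent (m := m) hV h₁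
  have hb₂ := isBalanced_of_notMem_noiseEvent (m := m) hV h₂
  simp only [one_mul] at hb₁
  have hmain := errorCount_grow_le (rule := rule) (nodesize := nodesize) (D := D) (dirs := d) hrule
    hq1 hns (η := η) (β := settledRate p η ζ ω Λ)
    (ν' := ν * (2 + 2 / ζ * (1 + (1 + C * S.card / s)))) hξ hrate (by positivity) (k₀ := k₀) m
    (fun i => resp D i - m (loc D i)) (fun i => m (loc D i) * (resp D i - m (loc D i)))
    (S := S) ?_ (fun v I A hIn hs => ho.exists_isAdmissible hqs (hd v) hIn hs) hS K n [] S (0, 1)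
    subset_rfl (ho.isInside S) (by simpa using S.card_le_univ) (by omega) hb₁ hb₂
  · refine hmain.trans ?_
    rw [mul_assoc]
    gcongr
    linarith
  · intro I A T hIS hset hIn hsI hbal₁ hbal₂ hT hTk
    have hsI' : (s : ℝ) ≤ I.card := by exact_mod_cast hsI
    have hYI : ∑ i ∈ I, resp D i ^ 2 ≤ C * S.card :=
      (Finset.sum_le_sum_of_subset_of_nonneg hIS fun _ _ _ => sq_nonneg _).trans hY
    refine hset.sum_error_le hη hIn ?_ mc t α happ.1 hΛ hω hζ hν ?_ hk₀ hbal₁ hbal₂ ?_ hT hTk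
    · calc (q : ℝ) * ∑ i ∈ I, resp D i ^ 2 ≤ q * (C * S.card) := by gcongr
        _ ≤ η * (s : ℝ) ^ 2 := hCq
        _ ≤ _ := by gcongr
    · intro i hi h
      have hh := hIn.2 i (completeObs_subset hi) h ((mem_completeObs.1 hi).2 h)
      have hv : value D i h = (o i).1 h := value_sampleData ((mem_completeObs.1 hi).2 h)
      rw [hv]
      exact happ.2 h _ (ho.1 i h).1 (ho.1 i h).2
    · have h1 := card_mul_abs_meanResp_le (D := D) (I := I)
      have hI0 : (0 : ℝ) < I.card := lt_of_lt_of_le hs0' hsI'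
      have h2 : |meanResp D I| ≤ (I.card + C * S.card) / I.card := by
        rw [le_div_iff₀ hI0]
        linarith
      refine h2.trans ?_
      rw [add_div, div_self hI0.ne']
      gcongr

/-- The expected number, over the candidate directions, of badly predicted ghosts. -/
lemma integral_ghostErrorCount_le (hrule : IsCartRule q rule) (hq1 : 1 ≤ q) (hns : nodesize < s)
    (hqs : 2 * q ≤ s) {S : Finset (Fin n)} (hsS : s ≤ S.card) {k₀ : ℕ} (hk₀ : 1 ≤ k₀)
    (hS : S.card < (k₀ + 1) * q) {N : ℕ} {t : ℕ → ℝ} {α : Fin p → ℕ → ℝ} {ω Λ : ℝ}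
    (happ : IsStepApprox mc N t α ω Λ) (hΛ : 0 ≤ Λ) (hω : 0 ≤ ω) {η ζ : ℝ} (hη : 0 < η)
    (hζ : 0 < ζ) {K : ℕ} (hK : 1 ≤ K) {C : ℝ} (hC : 0 ≤ C)
    (hCq : q * (C * S.card) ≤ η * (s : ℝ) ^ 2)
    {ν : ℝ} (hν : 0 ≤ ν) (ho : IsGeneric o)
    (hY : ∑ i ∈ S, resp (sampleData (fun x => ∑ h, mc h (x h)) o) i ^ 2 ≤ C * S.card)
    {V : ℝ} (hV : ∑ i ∈ S, (o i).2.1 ^ 2 ≤ V)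
    (h₁ : o ∉ noiseEvent S (k₀ + K) (fun _ => 1) V ν)
    (h₂ : o ∉ noiseEvent S (k₀ + K) (fun x => ∑ h, mc h (x h)) V ν)
    {mtry : ℕ} (hm1 : 1 ≤ mtry) (hmp : mtry ≤ p) {ξ : ℝ} (hξ : 0 < ξ) {bins : Finset ℤ}
    (hbins : ∀ x : Fin p → ℝ, ⌊(∑ h, mc h (x h)) / (ξ / 4)⌋ ∈ bins) {g : Fin n → Fin p → ℝ}
    {t₀ : ℝ} (hg : ∀ r ∈ bins,
      (o, g) ∉ ghostEvent S (k₀ + K) (levelBin (fun x => ∑ h, mc h (x h)) (ξ / 4) r) t₀) :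
    ∫ d, ghostErrorCount (fun x => ∑ h, mc h (x h)) o g ξ S
        (buildTree rule q nodesize (sampleData (fun x => ∑ h, mc h (x h)) o) (S, d))
        ∂dirLaw p mtry hmp ≤
      C * S.card / (K * (((p.choose mtry : ℕ) : ℝ)⁻¹ * η)) + 2 ^ K * s +
        (settledRate p η ζ ω Λ * (1 + C) * S.card +
          2 ^ K * (ν * (2 + 2 / ζ * (1 + (1 + C * S.card / s))))) / (ξ / 2) + bins.card * t₀ := by
  set m : (Fin p → ℝ) → ℝ := fun x => ∑ h, mc h (x h) with hm
  set D := sampleData m o with hD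
  set E : ℝ := (settledRate p η ζ ω Λ * (1 + C) * S.card +
          2 ^ K * (ν * (2 + 2 / ζ * (1 + (1 + C * S.card / s))))) / (ξ / 2) with hE
  have hd : ∀ᵐ d ∂dirLaw p mtry hmp, ∀ v, (d v).Nonempty := by
    rw [ae_all_iff]
    intro v
    have h1 := (measurePreserving_eval_infinitePi
      (fun _ : List Bool => uniformSubset p mtry hmp) v).quasiMeasurePreserving.ae
      (ae_uniformSubset_card p mtry hmp)
    filter_upwards [h1] with d hd
    rw [← Finset.card_pos, hd]
    omega
  have hint := integrable_stray (rule := rule) (q := q) (s := s) (η := η) (D := D) (hm := hmp)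
    K [] S (0, 1)
  have hle : ∀ᵐ d ∂dirLaw p mtry hmp, ghostErrorCount m o g ξ S
      (buildTree rule q nodesize D (S, d)) ≤
        stray rule q s η D d K [] S (0, 1) + (E + bins.card * t₀) := by
    filter_upwards [hd] with d hd
    have hleaves : (buildTree rule q nodesize D (S, d)).numLeaves ≤ k₀ + K := by
      have h1 := numLeaves_grow_mul_le (nodesize := nodesize) (D := D) (dirs := d) hrule n [] S
        (0, 1) (by omega)
      have h2 := lt_of_mul_lt_mul_right (h1.trans_lt hS) (Nat.zero_le q)
      change (grow rule q nodesize D d n [] S (0, 1)).numLeaves ≤ _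
      omega
    have h1 := ghostErrorCount_le (m := m) hξ hbins hg hleaves
    have h2 := errorCount_buildTree_le hrule hq1 hns hqs hsS hk₀ hS happ hΛ hω hη.le hζ hC hCq hν ho
      hY hV h₁ h₂ hd (half_pos hξ)
    linarith
  have hstray := integral_stray_le hrule hmp hm1 hη.le
    (fun H I A hH hIn hs => ho.exists_isAdmissible (m := m) hqs hH hIn hs) K [] S (0, 1)
    (ho.isInside S)
  have hres : residual D S ≤ C * S.card := (residual_le_sum_sq D S).trans hY
  have hw : (0 : ℝ) < ((p.choose mtry : ℕ) : ℝ)⁻¹ := by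
    have := Nat.choose_pos hmp
    positivity
  have hK' : (0 : ℝ) < K := by exact_mod_cast hK
  have hden : (0 : ℝ) < K * (((p.choose mtry : ℕ) : ℝ)⁻¹ * η) := by positivity
  calc _ ≤ ∫ d, ((stray rule q s η D d K [] S (0, 1) : ℝ) + (E + bins.card * t₀))
        ∂dirLaw p mtry hmp := by
        refine integral_mono_of_nonneg (Eventually.of_forall fun d => ?_)
          (hint.add (integrable_const _)) hle
        exact Finset.sum_nonneg fun i _ => by split_ifs <;> norm_num
    _ = ∫ d, (stray rule q s η D d K [] S (0, 1) : ℝ) ∂dirLaw p mtry hmp +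
        (E + bins.card * t₀) := by
        rw [integral_add hint (integrable_const _)]
        simp
    _ ≤ (C * S.card / (K * (((p.choose mtry : ℕ) : ℝ)⁻¹ * η)) + 2 ^ K * s) +
        (E + bins.card * t₀) := by
        gcongr
        rw [← sub_le_iff_le_add, le_div_iff₀ hden]
        linarith
    _ = _ := by ring

end FixedSubsample

/-! ### Typical samples -/

section Typical

variable {n p : ℕ}

lemma integral_comp_of_measurePreserving {α β : Type*} [MeasurableSpace α] [MeasurableSpace β]
    {μ : Measure α} {ν : Measure β} {f : α → β} (hf : MeasurePreserving f μ ν) {g : β → ℝ}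
    (hg : Measurable g) : ∫ x, g (f x) ∂μ = ∫ y, g y ∂ν := by
  rw [← hf.map_eq, integral_map hf.measurable.aemeasurable hg.aestronglyMeasurable]

lemma measurePreserving_eval_sampleLaw (σ2 : ℝ≥0) (miss : Measure (Fin p → Bool))
    [IsProbabilityMeasure miss] (i : Fin n) :
    MeasurePreserving (fun o : Fin n → (Fin p → ℝ) × ℝ × (Fin p → Bool) => o i)
      (sampleLaw n p σ2 miss) (obsLaw p σ2 miss) :=
  measurePreserving_eval (fun _ => obsLaw p σ2 miss) i

lemma unifCube_coord_eq (h : Fin p) (c : ℝ) : unifCube p {x | x h = c} = 0 := by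
  refine Measure.restrict_le_self.absolutelyContinuous ?_
  rw [volume_pi]
  exact Measure.pi_hyperplane (fun _ : Fin p => (volume : Measure ℝ)) h c

lemma ae_mem_cube : ∀ᵐ x ∂unifCube p, x ∈ Set.Icc (0 : Fin p → ℝ) 1 :=
  ae_restrict_mem measurableSet_Icc

lemma ae_coord_mem (h : Fin p) : ∀ᵐ x ∂unifCube p, 0 < x h ∧ x h ≤ 1 := by
  have h1 : ∀ᵐ x ∂unifCube p, x h ≠ 0 := by
    rw [ae_iff]
    simpa using unifCube_coord_eq h 0
  filter_upwards [h1, ae_mem_cube] with x hx hx'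
  exact ⟨lt_of_le_of_ne (hx'.1 h) hx.symm, hx'.2 h⟩

lemma ae_isGeneric (σ2 : ℝ≥0) (miss : Measure (Fin p → Bool)) [IsProbabilityMeasure miss] :
    ∀ᵐ o ∂sampleLaw n p σ2 miss, IsGeneric o := by
  set ν := obsLaw p σ2 miss with hν
  have hfst : MeasurePreserving (Prod.fst : _ → Fin p → ℝ) ν (unifCube p) :=
    measurePreserving_fst
  refine Eventually.and ?_ ?_
  · simp only [ae_all_iff]
    intro i h
    exact (hfst.comp (measurePreserving_eval_sampleLaw σ2 miss i)).quasiMeasurePreserving.ae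
      (ae_coord_mem h)
  · simp only [ae_all_iff]
    intro h i j
    by_cases hij : i = j
    · exact Eventually.of_forall fun o _ => hij
    have hind : IndepFun (fun o : Fin n → (Fin p → ℝ) × ℝ × (Fin p → Bool) => o i) (fun o => o j)
        (sampleLaw n p σ2 miss) :=
      (iIndepFun_pi (μ := fun _ : Fin n => ν) (X := fun _ x => x)
        fun _ => aemeasurable_id).indepFun hij
    have hmap := (indepFun_iff_map_prod_eq_prod_map_map (measurable_pi_apply i).aemeasurable
      (measurable_pi_apply j).aemeasurable).1 hind
    rw [(measurePreserving_eval_sampleLaw σ2 miss i).map_eq,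
      (measurePreserving_eval_sampleLaw σ2 miss j).map_eq] at hmap
    have hset : MeasurableSet {u : ((Fin p → ℝ) × ℝ × (Fin p → Bool)) ×
        ((Fin p → ℝ) × ℝ × (Fin p → Bool)) | u.1.1 h = u.2.1 h} :=
      measurableSet_eq_fun (by fun_prop) (by fun_prop)
    have hnull : (ν.prod ν) {u | u.1.1 h = u.2.1 h} = 0 := by
      rw [Measure.measure_prod_null hset]
      refine Eventually.of_forall fun u => ?_
      have h1 := hfst.measure_preimage (s := {x | x h = u.1 h})
        (measurableSet_eq_fun (by fun_prop) measurable_const).nullMeasurableSet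
      rw [unifCube_coord_eq] at h1
      refine measure_mono_null ?_ h1
      intro v hv
      exact Eq.symm hv
    have h2 : ∀ᵐ u ∂(ν.prod ν), u.1.1 h ≠ u.2.1 h := by
      rw [ae_iff]
      simpa using hnull
    rw [← hmap] at h2
    have h3 := ae_of_ae_map ((measurable_pi_apply i).prodMk (measurable_pi_apply j)).aemeasurable h2
    filter_upwards [h3] with o ho heq
    exact absurd heq ho

lemma integral_noise_sq (σ2 : ℝ≥0) (miss : Measure (Fin p → Bool)) [IsProbabilityMeasure miss]
    (i : Fin n) : Integrable (fun o : Fin n → (Fin p → ℝ) × ℝ × (Fin p → Bool) => (o i).2.1 ^ 2)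
      (sampleLaw n p σ2 miss) ∧ ∫ o, (o i).2.1 ^ 2 ∂sampleLaw n p σ2 miss = σ2 := by
  have hsnd : MeasurePreserving (fun o : (Fin p → ℝ) × ℝ × (Fin p → Bool) => o.2.1)
      (obsLaw p σ2 miss) (gaussianReal 0 σ2) :=
    (measurePreserving_fst (μ := gaussianReal 0 σ2) (ν := miss)).comp
      (measurePreserving_snd (μ := unifCube p) (ν := (gaussianReal 0 σ2).prod miss))
  have hmp := hsnd.comp (measurePreserving_eval_sampleLaw σ2 miss i)
  have hL : MemLp (id : ℝ → ℝ) 2 (gaussianReal 0 σ2) := by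
    simpa using memLp_id_gaussianReal (μ := 0) (v := σ2) 2
  have hvar : ∫ x, x ^ 2 ∂gaussianReal 0 σ2 = σ2 := by
    have h1 := variance_eq_sub hL
    rw [variance_id_gaussianReal] at h1
    simpa [integral_id_gaussianReal] using h1.symm
  refine ⟨hmp.integrable_comp_of_integrable (g := fun x : ℝ => x ^ 2) hL.integrable_sq, ?_⟩
  rw [← hvar]
  exact integral_comp_of_measurePreserving hmp (by fun_prop : Measurable fun x : ℝ => x ^ 2)

lemma measureReal_noise_sq_gt_le (σ2 : ℝ≥0) (miss : Measure (Fin p → Bool))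
    [IsProbabilityMeasure miss] (S : Finset (Fin n)) {V : ℝ} (hV : 0 < V) :
    (sampleLaw n p σ2 miss).real {o | V < ∑ i ∈ S, (o i).2.1 ^ 2} ≤ S.card * σ2 / V := by
  have h1 := mul_meas_ge_le_integral_of_nonneg (μ := sampleLaw n p σ2 miss)
    (f := fun o => ∑ i ∈ S, (o i).2.1 ^ 2)
    (Eventually.of_forall fun o => Finset.sum_nonneg fun i _ => sq_nonneg _)
    (integrable_finsetSum _ fun i _ => (integral_noise_sq σ2 miss i).1) V
  rw [integral_finsetSum _ fun i _ => (integral_noise_sq σ2 miss i).1,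
    Finset.sum_congr rfl fun i _ => (integral_noise_sq σ2 miss i).2, Finset.sum_const,
    nsmul_eq_mul] at h1
  rw [le_div_iff₀ hV, mul_comm]
  refine le_trans ?_ h1
  refine mul_le_mul_of_nonneg_left ?_ hV.le
  exact measureReal_mono fun o ho => le_of_lt (show V < ∑ i ∈ S, (o i).2.1 ^ 2 from ho)

open Classical in
/-- The number of complete observations in `S`. -/
noncomputable def numComplete (S : Finset (Fin n))
    (o : Fin n → (Fin p → ℝ) × ℝ × (Fin p → Bool)) : ℝ :=
  ∑ i ∈ S, if NoneMissing (o i).2.2 then 1 else 0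

lemma measurable_numComplete (S : Finset (Fin n)) : Measurable (numComplete (p := p) S) := by
  classical
  refine Finset.measurable_sum _ fun i _ => Measurable.ite (measurableSet_setOfPred.2 ?_)
    measurable_const measurable_const
  exact measurable_noneMissing.comp (by fun_prop)

lemma measureReal_numComplete_lt_le (σ2 : ℝ≥0) (miss : Measure (Fin p → Bool))
    [IsProbabilityMeasure miss] (S : Finset (Fin n)) (hS : 0 < S.card) {δ : ℝ} (hδ : 0 < δ)
    (hmiss : δ ≤ miss.real {M | ∀ h, M h = false}) :
    (sampleLaw n p σ2 miss).real {o | numComplete S o < δ * S.card / 2} ≤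
      1 / (δ ^ 2 * S.card) := by
  classical
  set ν := obsLaw p σ2 miss with hν
  set f : (Fin p → ℝ) × ℝ × (Fin p → Bool) → ℝ := fun o => if NoneMissing o.2.2 then 1 else 0
    with hf
  have hfm : Measurable f := Measurable.ite
    (measurableSet_setOfPred.2 (measurable_noneMissing.comp (by fun_prop)))
    measurable_const measurable_const
  set X : Fin n → (Fin p → ℝ) × ℝ × (Fin p → Bool) → ℝ := fun i => if i ∈ S then f else 0 with hX
  have hXm : ∀ i, Measurable (X i) := by
    intro i
    simp only [hX]
    split_ifs
    · exact hfm
    · exact measurable_zero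
  have hX01 : ∀ i o, X i o ∈ Set.Icc (0 : ℝ) 1 := by
    intro i o
    simp only [hX]
    split_ifs
    · simp only [hf]
      split_ifs <;> simp
    · simp
  have hXL : ∀ i, MemLp (X i) 2 ν := fun i =>
    memLp_of_bounded (a := 0) (b := 1) (Eventually.of_forall (hX01 i))
      (hXm i).aestronglyMeasurable 2
  have hsum : (∑ i, fun o : Fin n → (Fin p → ℝ) × ℝ × (Fin p → Bool) => X i (o i)) =
      numComplete S := by
    ext o
    rw [Finset.sum_apply, numComplete, ← Finset.sum_filter_add_sum_filter_not Finset.univ (· ∈ S),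
      Finset.filter_mem_eq_inter, Finset.univ_inter, Finset.sum_eq_zero (s := Finset.filter _ _),
      add_zero]
    · exact Finset.sum_congr rfl fun i hi => by simp [hX, hi, hf]
    · intro i hi
      simp [hX, (Finset.mem_filter.1 hi).2]
  have hvar : Var[numComplete S; sampleLaw n p σ2 miss] ≤ S.card / 4 := by
    rw [← hsum, sampleLaw]
    refine (variance_sum_pi (μ := fun _ : Fin n => ν) hXL).le.trans ?_
    calc ∑ i, Var[X i; ν] ≤ ∑ i : Fin n, if i ∈ S then (1 / 4 : ℝ) else 0 := by
          refine Finset.sum_le_sum fun i _ => ?_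
          split_ifs with hi
          · have := variance_le_sq_of_bounded (μ := ν) (Eventually.of_forall (hX01 i))
              (hXm i).aemeasurable
            norm_num at this ⊢
            exact this
          · simp [hX, hi]
      _ = _ := by simp [div_eq_mul_inv]
  have hmp : MeasurePreserving (fun o : (Fin p → ℝ) × ℝ × (Fin p → Bool) => o.2.2)
      (obsLaw p σ2 miss) miss :=
    (measurePreserving_snd (μ := gaussianReal 0 σ2) (ν := miss)).comp
      (measurePreserving_snd (μ := unifCube p) (ν := (gaussianReal 0 σ2).prod miss))
  have hfi : ∀ i : Fin n, Integrable (fun o : Fin n → (Fin p → ℝ) × ℝ × (Fin p → Bool) =>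
      if NoneMissing (o i).2.2 then (1 : ℝ) else 0) (sampleLaw n p σ2 miss) := by
    intro i
    refine Integrable.of_bound (C := 1)
      (hfm.comp (measurable_pi_apply i)).aestronglyMeasurable (Eventually.of_forall fun o => ?_)
    split_ifs <;> simp
  have hE : δ * S.card ≤ ∫ o, numComplete S o ∂sampleLaw n p σ2 miss := by
    unfold numComplete
    rw [integral_finsetSum _ fun i _ => hfi i]
    have h1 : ∀ i : Fin n, ∫ o, (if NoneMissing (o i).2.2 then (1 : ℝ) else 0)
        ∂sampleLaw n p σ2 miss = miss.real {M | ∀ h, M h = false} := by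
      intro i
      have hmp' := hmp.comp (measurePreserving_eval_sampleLaw (n := n) σ2 miss i)
      have h2 : ∫ M, (Set.indicator {M : Fin p → Bool | ∀ h, M h = false} fun _ => (1 : ℝ)) M ∂miss
          = miss.real {M | ∀ h, M h = false} := by
        rw [integral_indicator_const _ (MeasurableSet.of_discrete)]
        simp
      rw [← h2, ← integral_comp_of_measurePreserving hmp' Measurable.of_discrete]
      refine integral_congr_ae (Eventually.of_forall fun o => ?_)
      by_cases ho : ∀ h, (o i).2.2 h = false
      · simp [NoneMissing, ho]
      · simp only [Set.indicator_apply, Function.comp_apply, Set.mem_ofPred_eq, NoneMissing,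
          if_neg ho]
        exact if_neg ho
    rw [Finset.sum_congr rfl fun i _ => h1 i, Finset.sum_const, nsmul_eq_mul, mul_comm]
    gcongr
  have hS' : (0 : ℝ) < S.card := by exact_mod_cast hS
  have hL : MemLp (numComplete (p := p) S) 2 (sampleLaw n p σ2 miss) := by
    refine memLp_of_bounded (a := 0) (b := S.card) (Eventually.of_forall fun o => ⟨?_, ?_⟩)
      (measurable_numComplete S).aestronglyMeasurable 2
    · exact Finset.sum_nonneg fun i _ => by split_ifs <;> norm_num
    · refine (Finset.sum_le_sum (g := fun _ => (1 : ℝ)) fun i _ => ?_).trans (by simp)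
      split_ifs <;> norm_num
  have hc : 0 < δ * S.card / 2 := by positivity
  have hcheb := meas_ge_le_variance_div_sq hL hc
  have hsub : {o | numComplete (p := p) S o < δ * S.card / 2} ⊆
      {o | δ * S.card / 2 ≤ |numComplete S o - ∫ o, numComplete S o ∂sampleLaw n p σ2 miss|} := by
    intro o ho
    have ho' : numComplete S o < δ * S.card / 2 := ho
    have h1 := neg_le_abs (numComplete S o - ∫ o, numComplete S o ∂sampleLaw n p σ2 miss)
    rw [Set.mem_ofPred_eq]
    linarith
  calc _ ≤ (ENNReal.ofReal (Var[numComplete S; sampleLaw n p σ2 miss] /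
        (δ * S.card / 2) ^ 2)).toReal :=
        ENNReal.toReal_mono ENNReal.ofReal_ne_top ((measure_mono hsub).trans hcheb)
    _ = Var[numComplete S; sampleLaw n p σ2 miss] / (δ * S.card / 2) ^ 2 :=
        ENNReal.toReal_ofReal (div_nonneg (variance_nonneg _ _) (by positivity))
    _ ≤ (S.card / 4) / (δ * S.card / 2) ^ 2 := by gcongr
    _ = _ := by
        field_simp
        norm_num

end Typical

/-! ### From ghosts to the query point -/

section Query

variable {n p : ℕ} {rule : SplitRule n p} {q nodesize : ℕ} {m : (Fin p → ℝ) → ℝ}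
  {σ2 : ℝ≥0} {miss : Measure (Fin p → Bool)} {mtry : ℕ}

lemma measurable_sampleData (hm : Measurable m) : Measurable (sampleData (n := n) m) := by
  unfold sampleData
  exact measurable_observe (by fun_prop) (by fun_prop) (by fun_prop)

/-- The samples, query points and candidate directions for which the tree grown on the subsample
`S` has an error above `ξ` at the query point. -/
def badEvent (rule : SplitRule n p) (q nodesize : ℕ) (m : (Fin p → ℝ) → ℝ) (ξ : ℝ)
    (S : Finset (Fin n)) :
    Set (((Fin n → (Fin p → ℝ) × ℝ × (Fin p → Bool)) × (Fin p → ℝ)) ×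
      (List Bool → Finset (Fin p))) :=
  {z | ξ < |treeEstimate rule q nodesize (sampleData m z.1.1) (S, z.2) z.1.2 - m z.1.2|}

lemma measurableSet_badEvent (hrule : IsCartRule q rule) (hmeas : IsMeasurableRule rule)
    (hm : Measurable m) (ξ : ℝ) (S : Finset (Fin n)) :
    MeasurableSet (badEvent rule q nodesize m ξ S) := by
  refine measurableSet_lt measurable_const (measurable_abs.comp (Measurable.sub ?_ ?_))
  · exact measurable_treeEstimate nodesize hrule hmeas
      ((measurable_sampleData hm).comp (by fun_prop)) (by fun_prop) (by fun_prop)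
  · exact hm.comp (by fun_prop)

lemma ghostErrorCount_nonneg (o : Fin n → (Fin p → ℝ) × ℝ × (Fin p → Bool))
    (g : Fin n → Fin p → ℝ) (ξ : ℝ) (S : Finset (Fin n)) (T : CartTree n p) :
    0 ≤ ghostErrorCount m o g ξ S T :=
  Finset.sum_nonneg fun i _ => by split_ifs <;> norm_num

lemma ghostErrorCount_le_card (o : Fin n → (Fin p → ℝ) × ℝ × (Fin p → Bool))
    (g : Fin n → Fin p → ℝ) (ξ : ℝ) (S : Finset (Fin n)) (T : CartTree n p) :
    ghostErrorCount m o g ξ S T ≤ S.card := by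
  refine (Finset.sum_le_sum (g := fun _ => (1 : ℝ)) fun i _ => ?_).trans (by simp)
  split_ifs <;> norm_num

/-- Each ghost point is distributed like the query point, so the expected number of complete
observations with a badly predicted ghost controls the probability of a bad prediction. -/
lemma mul_measureReal_badEvent_le [IsProbabilityMeasure miss] (hrule : IsCartRule q rule)
    (hmeas : IsMeasurableRule rule) (hm : Measurable m) (hmp : mtry ≤ p) (ξ : ℝ)
    (S : Finset (Fin n)) {c : ℝ} (hc : 0 ≤ c) :
    c * (((sampleLaw n p σ2 miss).prod (unifCube p)).prod (dirLaw p mtry hmp)).real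
        (badEvent rule q nodesize m ξ S) ≤
      c * (sampleLaw n p σ2 miss).real {o | numComplete S o < c} +
        ∫ u, ∫ d, ghostErrorCount m u.1 u.2 ξ S
          (buildTree rule q nodesize (sampleData m u.1) (S, d)) ∂dirLaw p mtry hmp
          ∂((sampleLaw n p σ2 miss).prod (ghostLaw n p)) := by
  classical
  set μ := sampleLaw n p σ2 miss with hμ
  set lam := dirLaw p mtry hmp with hlam
  set E := badEvent rule q nodesize m ξ S with hE
  have hEm : MeasurableSet E := measurableSet_badEvent hrule hmeas hm ξ S
  set H : Fin n → ((Fin n → (Fin p → ℝ) × ℝ × (Fin p → Bool)) × (Fin p → ℝ)) ×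
      (List Bool → Finset (Fin p)) → ℝ := fun i z =>
    if NoneMissing (z.1.1 i).2.2 ∧ z ∈ E then 1 else 0 with hH
  have hHm : ∀ i, Measurable (H i) := by
    intro i
    refine Measurable.ite (measurableSet_setOfPred.2 (Measurable.and ?_ ?_)) measurable_const
      measurable_const
    · exact measurable_noneMissing.comp (by fun_prop)
    · exact measurableSet_setOfPred.1 hEm
  have hH1 : ∀ i z, ‖H i z‖ ≤ 1 := by
    intro i z
    simp only [hH]
    split_ifs <;> simp
  -- replacing the query point by the `i`-th ghost
  have hmp_i : ∀ i : Fin n, MeasurePreserving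
      (fun z : ((Fin n → (Fin p → ℝ) × ℝ × (Fin p → Bool)) × (Fin n → Fin p → ℝ)) ×
        (List Bool → Finset (Fin p)) => ((z.1.1, z.1.2 i), z.2))
      ((μ.prod (ghostLaw n p)).prod lam) ((μ.prod (unifCube p)).prod lam) := fun i =>
    ((MeasurePreserving.id μ).prod (measurePreserving_eval (fun _ : Fin n => unifCube p) i)).prod
      (MeasurePreserving.id lam)
  have hHg : ∀ i, Integrable (fun z => H i ((z.1.1, z.1.2 i), z.2))
      ((μ.prod (ghostLaw n p)).prod lam) := fun i =>
    Integrable.of_bound ((hHm i).comp (hmp_i i).measurable).aestronglyMeasurable 1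
      (Eventually.of_forall fun z => hH1 _ _)
  have hHi : ∀ i, Integrable (H i) ((μ.prod (unifCube p)).prod lam) := fun i =>
    Integrable.of_bound (hHm i).aestronglyMeasurable 1 (Eventually.of_forall fun z => hH1 _ _)
  have hcount : ∀ z : ((Fin n → (Fin p → ℝ) × ℝ × (Fin p → Bool)) × (Fin n → Fin p → ℝ)) ×
        (List Bool → Finset (Fin p)), ghostErrorCount m z.1.1 z.1.2 ξ S
          (buildTree rule q nodesize (sampleData m z.1.1) (S, z.2)) =
        ∑ i ∈ S, H i ((z.1.1, z.1.2 i), z.2) := by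
    intro z
    refine Finset.sum_congr rfl fun i _ => ?_
    simp only [hH, hE, badEvent, treeEstimate, Set.mem_ofPred_eq]
  have hdouble : ∫ u, ∫ d, ghostErrorCount m u.1 u.2 ξ S
      (buildTree rule q nodesize (sampleData m u.1) (S, d)) ∂lam ∂(μ.prod (ghostLaw n p)) =
      ∫ z, ∑ i ∈ S, H i z ∂((μ.prod (unifCube p)).prod lam) := by
    rw [← integral_prod (fun z : ((Fin n → (Fin p → ℝ) × ℝ × (Fin p → Bool)) ×
        (Fin n → Fin p → ℝ)) × (List Bool → Finset (Fin p)) => ghostErrorCount m z.1.1 z.1.2 ξ S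
          (buildTree rule q nodesize (sampleData m z.1.1) (S, z.2)))]
    · simp_rw [hcount]
      rw [integral_finsetSum _ fun i _ => hHg i, integral_finsetSum _ fun i _ => hHi i]
      exact Finset.sum_congr rfl fun i _ => integral_comp_of_measurePreserving (hmp_i i) (hHm i)
    · simp_rw [hcount]
      exact integrable_finsetSum _ fun i _ => hHg i
  rw [hdouble]
  set F : Set (((Fin n → (Fin p → ℝ) × ℝ × (Fin p → Bool)) × (Fin p → ℝ)) ×
      (List Bool → Finset (Fin p))) := {z | numComplete S z.1.1 < c} with hF
  have hFo : MeasurableSet {o : Fin n → (Fin p → ℝ) × ℝ × (Fin p → Bool) | numComplete S o < c} :=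
    measurableSet_lt (measurable_numComplete S) measurable_const
  have hmpF : MeasurePreserving (fun z : ((Fin n → (Fin p → ℝ) × ℝ × (Fin p → Bool)) ×
      (Fin p → ℝ)) × (List Bool → Finset (Fin p)) => z.1.1)
      ((μ.prod (unifCube p)).prod lam) μ :=
    (measurePreserving_fst (μ := μ) (ν := unifCube p)).comp
      (measurePreserving_fst (μ := μ.prod (unifCube p)) (ν := lam))
  have hFm : MeasurableSet F := hmpF.measurable hFo
  have hFr : ((μ.prod (unifCube p)).prod lam).real F = μ.real {o | numComplete S o < c} := by
    rw [measureReal_def, measureReal_def, ← hmpF.measure_preimage hFo.nullMeasurableSet]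
    rfl
  have hEi : Integrable (E.indicator fun _ => (1 : ℝ)) ((μ.prod (unifCube p)).prod lam) :=
    (integrable_const _).indicator hEm
  have hFi : Integrable (F.indicator fun _ => (1 : ℝ)) ((μ.prod (unifCube p)).prod lam) :=
    (integrable_const _).indicator hFm
  have hkey : ∫ z, c * (E.indicator (fun _ => (1 : ℝ)) z - F.indicator (fun _ => (1 : ℝ)) z)
      ∂((μ.prod (unifCube p)).prod lam) ≤
        ∫ z, ∑ i ∈ S, H i z ∂((μ.prod (unifCube p)).prod lam) := by
    refine integral_mono ((hEi.sub hFi).const_mul c) (integrable_finsetSum _ fun i _ => hHi i)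
      fun z => ?_
    have hnn : 0 ≤ ∑ i ∈ S, H i z := Finset.sum_nonneg fun i _ => by
      simp only [hH]
      split_ifs <;> norm_num
    change c * (E.indicator (fun _ => (1 : ℝ)) z - F.indicator (fun _ => (1 : ℝ)) z) ≤ _
    by_cases hzE : z ∈ E
    · by_cases hzF : z ∈ F
      · simpa [hzE, hzF] using hnn
      · have h1 : ∑ i ∈ S, H i z = numComplete S z.1.1 :=
          Finset.sum_congr rfl fun i _ => by simp [hH, hzE]
        rw [h1]
        simpa [hzE, hzF] using not_lt.1 hzF
    · refine le_trans ?_ hnn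
      by_cases hzF : z ∈ F <;> simp [hzE, hzF, hc]
  rw [integral_const_mul, integral_sub hEi hFi, integral_indicator_const _ hEm,
    integral_indicator_const _ hFm, hFr] at hkey
  simp only [smul_eq_mul, mul_one] at hkey
  linarith

/-- The expected number of badly predicted ghosts, split according to an exceptional event. -/
lemma integral_integral_ghostErrorCount_le [IsProbabilityMeasure miss] (hmp : mtry ≤ p) (ξ : ℝ)
    (S : Finset (Fin n)) {L : ℝ} (hL : 0 ≤ L)
    {bad : Set ((Fin n → (Fin p → ℝ) × ℝ × (Fin p → Bool)) × (Fin n → Fin p → ℝ))}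
    (hbad : MeasurableSet bad)
    (hgood : ∀ o g, IsGeneric o → (o, g) ∉ bad → ∫ d, ghostErrorCount m o g ξ S
          (buildTree rule q nodesize (sampleData m o) (S, d)) ∂dirLaw p mtry hmp ≤ L) :
    ∫ u, ∫ d, ghostErrorCount m u.1 u.2 ξ S
        (buildTree rule q nodesize (sampleData m u.1) (S, d)) ∂dirLaw p mtry hmp
        ∂((sampleLaw n p σ2 miss).prod (ghostLaw n p)) ≤
      L + S.card * ((sampleLaw n p σ2 miss).prod (ghostLaw n p)).real bad := by
  set μγ := (sampleLaw n p σ2 miss).prod (ghostLaw n p) with hμγ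
  have hgen : ∀ᵐ u ∂μγ, IsGeneric u.1 :=
    (measurePreserving_fst (μ := sampleLaw n p σ2 miss)
      (ν := ghostLaw n p)).quasiMeasurePreserving.ae (ae_isGeneric σ2 miss)
  have hi : Integrable (bad.indicator fun _ => (S.card : ℝ)) μγ :=
    (integrable_const _).indicator hbad
  have hnn : ∀ u : (Fin n → (Fin p → ℝ) × ℝ × (Fin p → Bool)) × (Fin n → Fin p → ℝ),
      0 ≤ ∫ d, ghostErrorCount m u.1 u.2 ξ S
        (buildTree rule q nodesize (sampleData m u.1) (S, d)) ∂dirLaw p mtry hmp := fun u =>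
    integral_nonneg fun d => ghostErrorCount_nonneg _ _ _ _ _
  calc _ ≤ ∫ u, (L + bad.indicator (fun _ => (S.card : ℝ)) u) ∂μγ := by
        refine integral_mono_of_nonneg (Eventually.of_forall hnn) ((integrable_const _).add hi) ?_
        filter_upwards [hgen] with u hu
        by_cases hub : u ∈ bad
        · rw [Set.indicator_of_mem hub]
          refine le_add_of_nonneg_of_le hL ?_
          refine (integral_mono_of_nonneg (Eventually.of_forall fun d =>
            ghostErrorCount_nonneg _ _ _ _ _) (integrable_const (S.card : ℝ))
            (Eventually.of_forall fun d => ghostErrorCount_le_card _ _ _ _ _)).trans ?_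
          simp
        · rw [Set.indicator_of_notMem hub, add_zero]
          exact hgood u.1 u.2 hu hub
    _ = _ := by
        rw [integral_add (integrable_const _) hi, integral_indicator_const _ hbad]
        simp [mul_comm]

end Query

/-! ### The error bound of a tree -/

section Bound

variable {n p : ℕ} {rule : SplitRule n p} {q nodesize s mtry : ℕ} {mc : Fin p → ℝ → ℝ}
  {σ2 : ℝ≥0} {miss : Measure (Fin p → Bool)}

/-- The union bound for the events of deviation `exp (-e)` over the traces of `2 * A` points. -/
noncomputable def entropyBound (p A k : ℕ) (θ e : ℝ) : ℝ :=
  ((1 - θ)⁻¹) ^ (2 * A) * (8 * p / θ) ^ k * (2 * Real.exp (-e))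

lemma entropyBound_anti {A k : ℕ} {θ e e' : ℝ} (hθ0 : 0 < θ) (hθ1 : θ < 1) (he : e ≤ e') :
    entropyBound p A k θ e' ≤ entropyBound p A k θ e := by
  have : 0 < 1 - θ := by linarith
  unfold entropyBound
  gcongr

lemma measureReal_noiseEvent_le_entropyBound [IsProbabilityMeasure miss] (hp : 1 ≤ p)
    (S : Finset (Fin n)) (k : ℕ) {ψ : (Fin p → ℝ) → ℝ} (hψ : Measurable ψ) {B : ℝ} (hB : 0 < B)
    (hψB : ∀ x, |ψ x| ≤ B) {V t : ℝ} (hV : 0 < V) (ht : 0 ≤ t) {θ : ℝ} (hθ0 : 0 < θ) (hθ1 : θ < 1)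
    {e : ℝ} (he : e ≤ t ^ 2 / (2 * (B ^ 2 * V))) :
    (sampleLaw n p σ2 miss).real (noiseEvent S k ψ V t) ≤ entropyBound p S.card k θ e := by
  have h1θ : 0 < 1 - θ := by linarith
  have h2 : 1 ≤ (1 - θ)⁻¹ := (one_le_inv₀ h1θ).2 (by linarith)
  refine (measureReal_noiseEvent_le hp σ2 miss S k hψ hB hψB hV ht hθ0 hθ1).trans ?_
  refine le_trans ?_ (entropyBound_anti hθ0 hθ1 he)
  unfold entropyBound
  gcongr
  omega

/-- The samples and ghosts for which the noise is too large, not balanced, or some ghost count is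
too different from the corresponding count of observations. -/
def exceptionalEvent (m : (Fin p → ℝ) → ℝ) (S : Finset (Fin n)) (k : ℕ) (V t w : ℝ)
    (bins : Finset ℤ) :
    Set ((Fin n → (Fin p → ℝ) × ℝ × (Fin p → Bool)) × (Fin n → Fin p → ℝ)) :=
  (Prod.fst ⁻¹' {o | V < ∑ i ∈ S, (o i).2.1 ^ 2} ∪
    Prod.fst ⁻¹' noiseEvent S k (fun _ => 1) V t ∪ Prod.fst ⁻¹' noiseEvent S k m V t) ∪
    ⋃ r ∈ bins, ghostEvent S k (levelBin m w r) t

lemma measurableSet_noise_sq_gt (S : Finset (Fin n)) (V : ℝ) :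
    MeasurableSet {o : Fin n → (Fin p → ℝ) × ℝ × (Fin p → Bool) |
      V < ∑ i ∈ S, (o i).2.1 ^ 2} := measurableSet_lt measurable_const (by fun_prop)

lemma measurableSet_exceptionalEvent {m : (Fin p → ℝ) → ℝ} (hm : Measurable m)
    (S : Finset (Fin n)) (k : ℕ) (V t w : ℝ) (bins : Finset ℤ) :
    MeasurableSet (exceptionalEvent m S k V t w bins) :=
  (((measurable_fst (measurableSet_noise_sq_gt S V)).union
    (measurable_fst (measurableSet_noiseEvent S k measurable_const V t))).union
    (measurable_fst (measurableSet_noiseEvent S k hm V t))).union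
      (Finset.measurableSet_biUnion _ fun r _ =>
        measurableSet_ghostEvent S k (measurableSet_levelBin hm _ r) _)

lemma measureReal_exceptionalEvent_le [IsProbabilityMeasure miss] (hp : 1 ≤ p)
    {m : (Fin p → ℝ) → ℝ} (hm : Measurable m) {S : Finset (Fin n)} (hS : 0 < S.card) (k : ℕ)
    {B : ℝ} (hB : 1 ≤ B) (hmB : ∀ x, |m x| ≤ B) {C₀ : ℝ} (hC₀ : 0 < C₀) {τ : ℝ} (hτ : 0 ≤ τ)
    (w : ℝ) (bins : Finset ℤ) {θ : ℝ} (hθ0 : 0 < θ) (hθ1 : θ < 1) {γ : ℝ} (hγ : γ ≤ τ ^ 2 / 2)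
    (hγ' : γ ≤ τ ^ 2 / (2 * (B ^ 2 * C₀))) :
    ((sampleLaw n p σ2 miss).prod (ghostLaw n p)).real
        (exceptionalEvent m S k (C₀ * S.card) (τ * S.card) w bins) ≤
      σ2 / C₀ + (2 + bins.card) * entropyBound p S.card k θ (γ * S.card) := by
  set a : ℝ := (S.card : ℝ) with ha
  have ha0 : 0 < a := Nat.cast_pos.2 hS
  have hB0 : 0 < B := by linarith
  have hV : 0 < C₀ * a := by positivity
  set Ent := entropyBound p S.card k θ (γ * a) with hEnt
  have hfst : ∀ U : Set (Fin n → (Fin p → ℝ) × ℝ × (Fin p → Bool)), MeasurableSet U →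
      ((sampleLaw n p σ2 miss).prod (ghostLaw n p)).real (Prod.fst ⁻¹' U) =
        (sampleLaw n p σ2 miss).real U := by
    intro U hU
    rw [measureReal_def, (measurePreserving_fst (μ := sampleLaw n p σ2 miss)
      (ν := ghostLaw n p)).measure_preimage hU.nullMeasurableSet, measureReal_def]
  have e0 : (sampleLaw n p σ2 miss).real {o | C₀ * a < ∑ i ∈ S, (o i).2.1 ^ 2} ≤ σ2 / C₀ := by
    refine (measureReal_noise_sq_gt_le σ2 miss S hV).trans (le_of_eq ?_)
    rw [← ha]
    field_simp
  have e1 : (sampleLaw n p σ2 miss).real (noiseEvent S k (fun _ => 1) (C₀ * a) (τ * a)) ≤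
      Ent := by
    refine measureReal_noiseEvent_le_entropyBound hp S k measurable_const one_pos (by simp) hV
      (by positivity) hθ0 hθ1 ?_
    have h1 : τ ^ 2 / (2 * (B ^ 2 * C₀)) ≤ τ ^ 2 / (2 * (1 ^ 2 * C₀)) := by gcongr
    calc γ * a ≤ τ ^ 2 / (2 * (1 ^ 2 * C₀)) * a := by gcongr; linarith
      _ = _ := by field_simp
  have e2 : (sampleLaw n p σ2 miss).real (noiseEvent S k m (C₀ * a) (τ * a)) ≤ Ent := by
    refine measureReal_noiseEvent_le_entropyBound hp S k hm hB0 hmB hV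
      (by positivity) hθ0 hθ1 ?_
    calc γ * a ≤ τ ^ 2 / (2 * (B ^ 2 * C₀)) * a := by gcongr
      _ = _ := by field_simp
  have e3 : ∀ r ∈ bins, ((sampleLaw n p σ2 miss).prod (ghostLaw n p)).real
      (ghostEvent S k (levelBin m w r) (τ * a)) ≤ Ent := by
    intro r _
    refine (measureReal_ghostEvent_le hp σ2 miss S hS k (measurableSet_levelBin hm _ r)
      (by positivity) hθ0 hθ1).trans (entropyBound_anti hθ0 hθ1 ?_)
    calc γ * a ≤ τ ^ 2 / 2 * a := by gcongr
      _ = _ := by rw [← ha]; field_simp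
  have e4 := measureReal_biUnion_finset_le (μ := (sampleLaw n p σ2 miss).prod (ghostLaw n p)) bins
    fun r => ghostEvent S k (levelBin m w r) (τ * a)
  have e5 := Finset.sum_le_sum e3
  rw [Finset.sum_const, nsmul_eq_mul] at e5
  rw [← hfst _ (measurableSet_noise_sq_gt S _)] at e0
  rw [← hfst _ (measurableSet_noiseEvent S k measurable_const _ _)] at e1
  rw [← hfst _ (measurableSet_noiseEvent S k hm _ _)] at e2
  refine (measureReal_union_le _ _).trans ?_
  have e6 := measureReal_union_le (μ := (sampleLaw n p σ2 miss).prod (ghostLaw n p))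
    (Prod.fst ⁻¹' {o | C₀ * a < ∑ i ∈ S, (o i).2.1 ^ 2} ∪
    Prod.fst ⁻¹' noiseEvent S k (fun _ => 1) (C₀ * a) (τ * a))
    (Prod.fst ⁻¹' noiseEvent S k m (C₀ * a) (τ * a))
  have e7 := measureReal_union_le (μ := (sampleLaw n p σ2 miss).prod (ghostLaw n p))
    (Prod.fst ⁻¹' {o | C₀ * a < ∑ i ∈ S, (o i).2.1 ^ 2})
    (Prod.fst ⁻¹' noiseEvent S k (fun _ => 1) (C₀ * a) (τ * a))
  linarith

lemma budget_eq {a ξ : ℝ} (ha : a ≠ 0) (hξ : ξ ≠ 0) (C D P Q K s R b τ : ℝ) :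
    C * a / (K * D) + P * s + (R * (1 + C) * a + P * (τ * a * Q)) / (ξ / 2) + b * (τ * a) =
      a * (C / D / K + P * (s / a) + 2 / ξ * (1 + C) * R + (2 / ξ * P * Q + b) * τ) := by
  have h1 : C * a / (K * D) = a * (C / D / K) := by
    rw [div_div, mul_comm K D, mul_comm C a, mul_div_assoc]
  have h2 : P * s = a * (P * (s / a)) := by field_simp
  have h3 : (R * (1 + C) * a + P * (τ * a * Q)) / (ξ / 2) =
      a * (2 / ξ * (1 + C) * R) + a * (2 / ξ * P * Q * τ) := by field_simp
  rw [h1, h3]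
  nth_rw 1 [h2]
  ring

/-- The probability that a tree grown on a given subsample has an error above `ξ` at the query
point. -/
lemma measureReal_badEvent_le [IsProbabilityMeasure miss] (hp : 1 ≤ p)
    (hrule : IsCartRule q rule) (hmeas : IsMeasurableRule rule) (hq1 : 1 ≤ q) (hns : nodesize < s)
    (hqs : 2 * q ≤ s) {S : Finset (Fin n)} (hsS : s ≤ S.card) {k₀ : ℕ} (hk₀ : 1 ≤ k₀)
    (hS : S.card < (k₀ + 1) * q) (hmc : ∀ h, Measurable (mc h)) {B : ℝ} (hB : 1 ≤ B)
    (hmB : ∀ x : Fin p → ℝ, |∑ h, mc h (x h)| ≤ B)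
    {N : ℕ} {t : ℕ → ℝ} {α : Fin p → ℕ → ℝ} {ω Λ : ℝ}
    (happ : IsStepApprox mc N t α ω Λ) (hΛ : 0 ≤ Λ) (hω : 0 ≤ ω) {η ζ : ℝ} (hη : 0 < η)
    (hζ : 0 < ζ) {K : ℕ} (hK : 1 ≤ K) {C₀ C : ℝ} (hC₀ : 0 < C₀) (hC : C = 2 * B ^ 2 + 2 * C₀)
    (hCq : q * (C * S.card) ≤ η * (s : ℝ) ^ 2) {τ : ℝ} (hτ : 0 ≤ τ)
    (hm1 : 1 ≤ mtry) (hmp : mtry ≤ p) {ξ : ℝ} (hξ : 0 < ξ) {bins : Finset ℤ}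
    (hbins : ∀ x : Fin p → ℝ, ⌊(∑ h, mc h (x h)) / (ξ / 4)⌋ ∈ bins)
    {δ : ℝ} (hδ : 0 < δ) (hmiss : δ ≤ miss.real {M | ∀ h, M h = false})
    {θ : ℝ} (hθ0 : 0 < θ) (hθ1 : θ < 1) {γ : ℝ} (hγ : γ ≤ τ ^ 2 / 2)
    (hγ' : γ ≤ τ ^ 2 / (2 * (B ^ 2 * C₀))) {κ : ℝ} (hκ : 0 < κ) (hκs : κ * S.card ≤ s) :
    (((sampleLaw n p σ2 miss).prod (unifCube p)).prod (dirLaw p mtry hmp)).real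
        (badEvent rule q nodesize (fun x => ∑ h, mc h (x h)) ξ S) ≤
      1 / (δ ^ 2 * S.card) + 2 / δ * (C / (((p.choose mtry : ℕ) : ℝ)⁻¹ * η) / K +
        2 ^ K * (s / S.card) + 2 / ξ * (1 + C) * settledRate p η ζ ω Λ +
        (2 / ξ * 2 ^ K * (2 + 2 / ζ * (2 + C / κ)) + bins.card) * τ + σ2 / C₀ +
        (2 + bins.card) * entropyBound p S.card (k₀ + K) θ (γ * S.card)) := by
  set m : (Fin p → ℝ) → ℝ := fun x => ∑ h, mc h (x h) with hm
  set a : ℝ := (S.card : ℝ) with ha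
  have hS0 : 0 < S.card := by omega
  have ha0 : 0 < a := Nat.cast_pos.2 hS0
  have hs0 : (0 : ℝ) < s := by
    have : 0 < s := by omega
    exact_mod_cast this
  have hB0 : 0 < B := by linarith
  have hC0 : 0 ≤ C := by rw [hC]; positivity
  have hmm : Measurable m := by
    refine Finset.measurable_sum _ fun h _ => (hmc h).comp (measurable_pi_apply h)
  set w : ℝ := ((p.choose mtry : ℕ) : ℝ)⁻¹ with hw
  have hw0 : 0 < w := by
    have := Nat.choose_pos hmp
    positivity
  have hK0 : (0 : ℝ) < K := by exact_mod_cast hK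
  have hV : 0 < C₀ * a := by positivity
  have hrate : 0 ≤ settledRate p η ζ ω Λ := by
    unfold settledRate
    positivity
  set k := k₀ + K with hk
  set bad := exceptionalEvent m S k (C₀ * a) (τ * a) (ξ / 4) bins with hbad
  have hbadm : MeasurableSet bad := measurableSet_exceptionalEvent hmm S k _ _ _ bins
  have hbadP := measureReal_exceptionalEvent_le (σ2 := σ2) (miss := miss) hp hmm hS0 k hB hmB hC₀
    hτ (ξ / 4) bins hθ0 hθ1 hγ hγ'
  set Ent := entropyBound p S.card k θ (γ * a) with hEnt
  set L : ℝ := C * a / (K * (w * η)) + 2 ^ K * s +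
        (settledRate p η ζ ω Λ * (1 + C) * a +
          2 ^ K * (τ * a * (2 + 2 / ζ * (1 + (1 + C * a / s))))) / (ξ / 2) +
            bins.card * (τ * a) with hL
  have hL0 : 0 ≤ L := by positivity
  have hgood : ∀ o g, IsGeneric o → (o, g) ∉ bad → ∫ d, ghostErrorCount m o g ξ S
      (buildTree rule q nodesize (sampleData m o) (S, d)) ∂dirLaw p mtry hmp ≤ L := by
    intro o g ho hog
    simp only [hbad, exceptionalEvent, Set.mem_union, Set.mem_preimage, Set.mem_iUnion, not_or,
      not_exists,
      Set.mem_ofPred_eq, not_lt] at hog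
    obtain ⟨⟨⟨h0, h1⟩, h2⟩, h3⟩ := hog
    have hY := sum_resp_sq_le (m := m) hmB h0
    refine integral_ghostErrorCount_le hrule hq1 hns hqs hsS hk₀ hS happ hΛ hω hη hζ hK hC0 hCq
      (by positivity) ho (hY.trans (le_of_eq ?_)) h0 h1 h2 hm1 hmp hξ hbins h3
    rw [hC, ← ha]
    ring
  have hmain := (mul_measureReal_badEvent_le (nodesize := nodesize) (σ2 := σ2) (miss := miss) hrule
    hmeas hmm hmp ξ S (c := δ * a / 2) (by positivity)).trans
    (add_le_add (mul_le_mul_of_nonneg_left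
      (measureReal_numComplete_lt_le σ2 miss S hS0 hδ hmiss) (by positivity))
      ((integral_integral_ghostErrorCount_le (σ2 := σ2) (miss := miss) hmp ξ S hL0 hbadm
        hgood).trans (add_le_add_right (mul_le_mul_of_nonneg_left hbadP (by positivity)) L)))
  have hc : 0 < δ * a / 2 := by positivity
  rw [mul_comm, ← le_div_iff₀ hc] at hmain
  refine hmain.trans ?_
  have hLle : L ≤ a * (C / (w * η) / K + 2 ^ K * (s / a) +
      2 / ξ * (1 + C) * settledRate p η ζ ω Λ +
        (2 / ξ * 2 ^ K * (2 + 2 / ζ * (2 + C / κ)) + bins.card) * τ) := by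
    have h1 : C * a / s ≤ C / κ := by
      rw [div_le_div_iff₀ hs0 hκ]
      calc C * a * κ = C * (κ * a) := by ring
        _ ≤ C * s := by gcongr
    calc L ≤ C * a / (K * (w * η)) + 2 ^ K * s +
        (settledRate p η ζ ω Λ * (1 + C) * a +
          2 ^ K * (τ * a * (2 + 2 / ζ * (1 + (1 + C / κ))))) / (ξ / 2) +
            bins.card * (τ * a) := by
          rw [hL]
          gcongr
      _ = _ := by
          have h2 : 2 + 2 / ζ * (2 + C / κ) = 2 + 2 / ζ * (1 + (1 + C / κ)) := by ring
          rw [h2]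
          exact budget_eq ha0.ne' hξ.ne' _ _ _ _ _ _ _ _ _
  have e : ∀ X Y : ℝ, (δ * a / 2 * (1 / (δ ^ 2 * a)) + (a * X + a * Y)) / (δ * a / 2) =
      1 / (δ ^ 2 * a) + 2 / δ * (X + Y) := by
    intro X Y
    field_simp
  rw [add_assoc _ ((σ2 : ℝ) / C₀), ← e]
  gcongr

end Bound

/-! ### Choice of the constants -/

section Constants

variable {p : ℕ}

/-- With `o(a)` leaves, the entropy of the traces is negligible against `γ a`. -/
lemma exists_tendsto_entropyBound (hp : 1 ≤ p) {γ : ℝ} (hγ : 0 < γ) (K : ℕ) {a q : ℕ → ℕ}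
    (ha : Tendsto a atTop atTop) (hq : Tendsto q atTop atTop) :
    ∃ θ : ℝ, 0 < θ ∧ θ < 1 ∧
      Tendsto (fun n => entropyBound p (a n) (a n / q n + K) θ (γ * a n)) atTop (𝓝 0) := by
  obtain ⟨θ, hθ, hθ0, hθ1⟩ : ∃ θ : ℝ, ((1 - θ)⁻¹) ^ 2 < Real.exp (γ / 4) ∧ 0 < θ ∧ θ < 1 := by
    have hc : ContinuousAt (fun θ : ℝ => ((1 - θ)⁻¹) ^ 2) 0 := by
      refine ContinuousAt.pow (ContinuousAt.inv₀ (by fun_prop) (by norm_num)) 2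
    have h1 : ∀ᶠ θ in 𝓝 (0 : ℝ), ((1 - θ)⁻¹) ^ 2 < Real.exp (γ / 4) := by
      refine hc.eventually_lt_const ?_
      simpa using hγ
    have h2 : ∀ᶠ θ in 𝓝[>] (0 : ℝ), θ < 1 :=
      (eventually_lt_nhds one_pos).filter_mono nhdsWithin_le_nhds
    exact ((h1.filter_mono nhdsWithin_le_nhds).and
      ((eventually_mem_nhdsWithin (s := Set.Ioi (0 : ℝ))).and h2)).exists
  refine ⟨θ, hθ0, hθ1, ?_⟩
  have hp' : (1 : ℝ) ≤ p := by exact_mod_cast hp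
  have h1θ : 0 < 1 - θ := by linarith
  set A : ℝ := 8 * p / θ with hA
  have hA1 : 1 ≤ A := by
    rw [hA, le_div_iff₀ hθ0]
    linarith
  have hA0 : 0 < A := by linarith
  have haR : Tendsto (fun n => (a n : ℝ)) atTop atTop := tendsto_natCast_atTop_atTop.comp ha
  have hqR : Tendsto (fun n => (q n : ℝ)) atTop atTop := tendsto_natCast_atTop_atTop.comp hq
  have hlim : Tendsto (fun n => A ^ K * 2 * Real.exp (-(γ / 2 * a n))) atTop (𝓝 0) := by
    rw [← mul_zero (A ^ K * 2)]
    refine Tendsto.const_mul _ (Real.tendsto_exp_neg_atTop_nhds_zero.comp ?_)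
    exact haR.const_mul_atTop (by positivity)
  have hlog : Tendsto (fun n => Real.log A / q n) atTop (𝓝 0) := hqR.const_div_atTop _
  refine squeeze_zero' (Eventually.of_forall fun n => ?_) ?_ hlim
  · unfold entropyBound
    positivity
  filter_upwards [hlog.eventually (eventually_le_nhds (show 0 < γ / 4 by positivity))] with n hn
  unfold entropyBound
  have e1 : ((1 - θ)⁻¹) ^ (2 * a n) ≤ Real.exp (γ / 4 * a n) := by
    rw [pow_mul, mul_comm, Real.exp_nat_mul]
    gcongr
  have e2 : A ^ (a n / q n) ≤ Real.exp (γ / 4 * a n) := by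
    rw [← Real.exp_log (pow_pos hA0 _), Real.log_pow, Real.exp_le_exp]
    calc ((a n / q n : ℕ) : ℝ) * Real.log A ≤ ((a n : ℝ) / q n) * Real.log A := by
          have := Real.log_nonneg hA1
          gcongr
          exact Nat.cast_div_le
      _ = Real.log A / q n * a n := by ring
      _ ≤ _ := by gcongr
  calc ((1 - θ)⁻¹) ^ (2 * a n) * A ^ (a n / q n + K) * (2 * Real.exp (-(γ * a n)))
      ≤ Real.exp (γ / 4 * a n) * (Real.exp (γ / 4 * a n) * A ^ K) *
          (2 * Real.exp (-(γ * a n))) := by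
        rw [pow_add]
        gcongr
    _ = A ^ K * 2 * (Real.exp (γ / 4 * a n) * Real.exp (γ / 4 * a n) *
          Real.exp (-(γ * a n))) := by ring
    _ = _ := by
        rw [← Real.exp_add, ← Real.exp_add]
        ring_nf

lemma sum_ite_le_sub (F : ℕ → ℝ) {i N : ℕ} (hi : i ≤ N) :
    (∑ j ∈ Finset.range N, if i ≤ j then F j - F (j + 1) else 0) = F i - F N := by
  induction N with
  | zero => simp [Nat.le_zero.1 hi]
  | succ N ih =>
    rw [Finset.sum_range_succ]
    rcases Nat.lt_or_ge N i with h | h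
    · have hiN : i = N + 1 := by omega
      subst hiN
      rw [if_neg (by omega), add_zero, sub_self]
      refine Finset.sum_eq_zero fun j hj => if_neg ?_
      have := Finset.mem_range.1 hj
      omega
    · rw [ih h, if_pos h]
      ring

lemma exists_isStepApprox {mc : Fin p → ℝ → ℝ} (hmc : ∀ h, Continuous (mc h)) {ω : ℝ}
    (hω : 0 < ω) : ∃ (N : ℕ) (t : ℕ → ℝ) (α : Fin p → ℕ → ℝ) (Λ : ℝ), 0 ≤ Λ ∧
      IsStepApprox mc N t α ω Λ := by
  have hN : ∀ h, ∀ᶠ N : ℕ in atTop, ∀ x ∈ Set.Icc (0 : ℝ) 1, ∀ y ∈ Set.Icc (0 : ℝ) 1,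
      |x - y| ≤ 1 / (N : ℝ) → |mc h x - mc h y| ≤ ω := by
    intro h
    have huc := isCompact_Icc.uniformContinuousOn_of_continuous
      ((hmc h).continuousOn (s := Set.Icc (0 : ℝ) 1))
    obtain ⟨d, hd, hd'⟩ := Metric.uniformContinuousOn_iff_le.1 huc ω hω
    have h1 : Tendsto (fun N : ℕ => 1 / (N : ℝ)) atTop (𝓝 0) := tendsto_one_div_atTop_nhds_zero_nat
    filter_upwards [h1.eventually (eventually_le_nhds hd)] with N hN x hx y hy hxy
    exact hd' x hx y hy (by rw [Real.dist_eq]; linarith)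
  obtain ⟨N, hN, hN1⟩ := ((eventually_all.2 hN).and (eventually_ge_atTop 1)).exists
  have hN0 : (0 : ℝ) < N := by exact_mod_cast hN1
  -- values at the grid, extended by zero so that the differences telescope
  set F : Fin p → ℕ → ℝ := fun h j => if j < N then mc h ((j + 1) / N) else 0 with hF
  refine ⟨N, fun j => (j + 1) / N, fun h j => F h j - F h (j + 1),
    ∑ h, ∑ j ∈ Finset.range N, |F h j - F h (j + 1)|,
    Finset.sum_nonneg fun h _ => Finset.sum_nonneg fun j _ => abs_nonneg _, fun h => ?_,
    fun h x hx0 hx1 => ?_⟩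
  · exact Finset.single_le_sum (f := fun h => ∑ j ∈ Finset.range N, |F h j - F h (j + 1)|)
      (fun h _ => Finset.sum_nonneg fun j _ => abs_nonneg _) (Finset.mem_univ h)
  -- `i` is the index of the grid interval of `x`
  obtain ⟨i, hi⟩ : ∃ i, ⌈x * N⌉₊ = i + 1 :=
    Nat.exists_eq_succ_of_ne_zero (Nat.ceil_pos.2 (by positivity)).ne'
  have hiN : i < N := by
    have : ⌈x * N⌉₊ ≤ N := Nat.ceil_le.2 (by nlinarith)
    omega
  have hiff : ∀ j : ℕ, x ≤ ((j : ℝ) + 1) / N ↔ i ≤ j := by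
    intro j
    rw [le_div_iff₀ hN0]
    have h1 : x * N ≤ ((j + 1 : ℕ) : ℝ) ↔ ⌈x * N⌉₊ ≤ j + 1 := Nat.ceil_le.symm
    push_cast at h1
    rw [h1, hi]
    omega
  simp only [hiff]
  rw [sum_ite_le_sub (F h) hiN.le]
  have hFN : F h N = 0 := by simp [hF]
  have hFi : F h i = mc h ((i + 1) / N) := by simp [hF, hiN]
  rw [hFN, sub_zero, hFi]
  have hiN' : (i : ℝ) + 1 ≤ N := by exact_mod_cast hiN
  have hx2 : x ≤ ((i : ℝ) + 1) / N := (hiff i).2 le_rfl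
  have hx3 : (i : ℝ) < x * N := by
    rw [← Nat.lt_ceil, hi]
    omega
  refine hN h x ⟨hx0.le, hx1⟩ _ ⟨by positivity, (div_le_one hN0).2 hiN'⟩ ?_
  rw [abs_sub_comm, abs_of_nonneg (by linarith), sub_le_iff_le_add, div_add' _ _ _ hN0.ne']
  exact div_le_div_of_nonneg_right (by linarith) hN0.le

lemma exists_settledRate_le (p : ℕ) {e : ℝ} (he : 0 < e) : ∃ ζ : ℝ, 0 < ζ ∧ ∃ ω : ℝ, 0 < ω ∧
    ∀ Λ : ℝ, ∃ η : ℝ, 0 < η ∧ settledRate p η ζ ω Λ ≤ e := by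
  set ζ : ℝ := e / (2 * (2 + 4 * p)) with hζ
  have hζ0 : 0 < ζ := by positivity
  refine ⟨ζ, hζ0, ζ ^ 2, by positivity, fun Λ => ?_⟩
  have hc : Continuous fun η => settledRate p η ζ (ζ ^ 2) Λ := by
    unfold settledRate
    fun_prop
  have h0 : settledRate p 0 ζ (ζ ^ 2) Λ < e := by
    have : settledRate p 0 ζ (ζ ^ 2) Λ = (2 + 4 * p) * ζ := by
      simp only [settledRate, Real.sqrt_zero]
      field_simp
      ring
    rw [this, hζ]
    field_simp
    linarith
  have h1 : ∀ᶠ η in 𝓝 (0 : ℝ), settledRate p η ζ (ζ ^ 2) Λ < e :=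
    hc.continuousAt.eventually_lt_const h0
  obtain ⟨η, hη, hη0⟩ := ((h1.filter_mono nhdsWithin_le_nhds).and
    (eventually_mem_nhdsWithin (s := Set.Ioi (0 : ℝ)))).exists
  exact ⟨η, hη0, hη.le⟩

lemma exists_bins {m : (Fin p → ℝ) → ℝ} {B : ℝ} (hB : ∀ x, |m x| ≤ B) {w : ℝ} (hw : 0 < w) :
    ∃ bins : Finset ℤ, ∀ x, ⌊m x / w⌋ ∈ bins := by
  refine ⟨Finset.Icc ⌊-B / w⌋ ⌊B / w⌋, fun x => Finset.mem_Icc.2 ⟨?_, ?_⟩⟩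
  · exact Int.floor_le_floor (by have := neg_le_of_abs_le (hB x); gcongr)
  · exact Int.floor_le_floor (by have := le_of_abs_le (hB x); gcongr)

/-- For a bounded continuous regression function, the probability of a bad prediction by one tree
tends to zero, uniformly in the subsample. -/
lemma eventually_measureReal_badEvent_le (hp : 1 ≤ p) {mc : Fin p → ℝ → ℝ}
    (hmc : ∀ h, Continuous (mc h)) {B : ℝ} (hB : 1 ≤ B)
    (hmB : ∀ x : Fin p → ℝ, |∑ h, mc h (x h)| ≤ B) (σ2 : ℝ≥0)
    {miss : ℕ → Measure (Fin p → Bool)} (hprob : ∀ n, IsProbabilityMeasure (miss n))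
    {δ : ℝ} (hδ : 0 < δ) (hcomplete : ∀ᶠ n in atTop, δ ≤ (miss n).real {M | ∀ h, M h = false})
    {mtry : ℕ} (hm1 : 1 ≤ mtry) (hmp : mtry ≤ p) {a nodesize q : ℕ → ℕ}
    (hpar : ∀ᶠ n in atTop, 1 ≤ q n ∧ 2 * q n ≤ a n ∧ 2 * q n ≤ nodesize n + 1 ∧ nodesize n ≤ a n)
    (hq : Tendsto q atTop atTop)
    (hnode : Tendsto (fun n => (nodesize n : ℝ) / (a n : ℝ)) atTop (𝓝 0))
    {rule : ∀ n, SplitRule n p} (hrule : ∀ n, IsCartRule (q n) (rule n))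
    (hmeas : ∀ n, IsMeasurableRule (rule n)) {ξ : ℝ} (hξ : 0 < ξ) {r : ℝ} (hr : 0 < r) :
    ∀ᶠ n in atTop, ∀ S : Finset (Fin n), S.card = a n →
      (((sampleLaw n p σ2 (miss n)).prod (unifCube p)).prod (dirLaw p mtry hmp)).real
        (badEvent (rule n) (q n) (nodesize n) (fun x => ∑ h, mc h (x h)) ξ S) ≤ r := by
  have ha : Tendsto a atTop atTop := by
    refine tendsto_atTop_mono' _ ?_ hq
    filter_upwards [hpar] with n hn
    omega
  have haR : Tendsto (fun n => (a n : ℝ)) atTop atTop := tendsto_natCast_atTop_atTop.comp ha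
  -- the first term of the error bound will be at most `r / 8`, each of the other six at most `e`
  -- before the factor `2 / δ`
  set e : ℝ := r * δ / 16 with he
  have he0 : 0 < e := by positivity
  obtain ⟨bins, hbins⟩ := exists_bins hmB (show 0 < ξ / 4 by positivity)
  set C₀ : ℝ := (σ2 + 1) / e with hC₀
  have hC₀0 : 0 < C₀ := by positivity
  set C : ℝ := 2 * B ^ 2 + 2 * C₀ with hC
  have hC0 : 0 < C := by positivity
  obtain ⟨ζ, hζ, ω, hω, hηex⟩ := exists_settledRate_le p
    (show 0 < e / (2 / ξ * (1 + C)) by positivity)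
  obtain ⟨N, t, α, Λ, hΛ, happ⟩ := exists_isStepApprox hmc hω
  obtain ⟨η, hη, hrate⟩ := hηex Λ
  have hw0 : (0 : ℝ) < ((p.choose mtry : ℕ) : ℝ)⁻¹ := by
    have := Nat.choose_pos hmp
    positivity
  obtain ⟨K, hKe, hK⟩ : ∃ K : ℕ, C / (((p.choose mtry : ℕ) : ℝ)⁻¹ * η) / K ≤ e ∧ 1 ≤ K := by
    have h1 : Tendsto (fun K : ℕ => C / (((p.choose mtry : ℕ) : ℝ)⁻¹ * η) / K) atTop (𝓝 0) :=
      tendsto_const_div_atTop_nhds_zero_nat _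
    exact ((h1.eventually (eventually_le_nhds he0)).and (eventually_ge_atTop 1)).exists
  set κ : ℝ := min (1 / 2) (e / (2 ^ K * 2)) with hκ
  have hκ0 : 0 < κ := by positivity
  have hκ1 : κ ≤ 1 / 2 := min_le_left _ _
  have hκ2 : 2 ^ K * (2 * κ) ≤ e := by
    have h1 : κ ≤ e / (2 ^ K * 2) := min_le_right _ _
    rw [le_div_iff₀ (by positivity)] at h1
    linarith
  set G : ℝ := 2 / ξ * 2 ^ K * (2 + 2 / ζ * (2 + C / κ)) + bins.card with hG
  have hG0 : 0 < G := by positivity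
  set τ : ℝ := e / G with hτ
  have hτ0 : 0 < τ := by positivity
  set γ : ℝ := min (τ ^ 2 / 2) (τ ^ 2 / (2 * (B ^ 2 * C₀))) with hγ
  have hγ0 : 0 < γ := by positivity
  obtain ⟨θ, hθ0, hθ1, hent⟩ := exists_tendsto_entropyBound hp hγ0 K ha hq
  have hent' : Tendsto (fun n => (2 + (bins.card : ℝ)) *
      entropyBound p (a n) (a n / q n + K) θ (γ * a n)) atTop (𝓝 0) := by
    simpa using hent.const_mul (2 + (bins.card : ℝ))
  have hinv : Tendsto (fun n => 1 / (δ ^ 2 * (a n : ℝ))) atTop (𝓝 0) :=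
    (haR.const_mul_atTop (by positivity)).const_div_atTop 1
  have hnode' := hnode.eventually (eventually_le_nhds hκ0)
  have hnode'' := hnode.eventually (eventually_le_nhds
    (show 0 < η * κ ^ 2 / C by positivity))
  have hbig : ∀ᶠ n in atTop, 1 / κ ≤ a n := haR.eventually_ge_atTop _
  filter_upwards [hpar, hcomplete, hnode', hnode'', hbig, ha.eventually_ge_atTop 2,
    hent'.eventually (eventually_le_nhds he0),
    hinv.eventually (eventually_le_nhds (show 0 < r / 8 by positivity)),
    hq.eventually_ge_atTop 1] with
    n hpn hδn hκn hCn hbn ha2 hentn hinvn hq1 S hS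
  have ha0 : (0 : ℝ) < a n := by
    have : 0 < a n := by omega
    exact_mod_cast this
  set s : ℕ := ⌊κ * a n⌋₊ + 1 with hs
  have hs_lo : κ * a n ≤ s := by
    rw [hs]; push_cast; exact (Nat.lt_floor_add_one _).le
  have hκa : 1 ≤ κ * a n := by
    rw [div_le_iff₀ hκ0] at hbn
    linarith
  have hs_hi : (s : ℝ) ≤ 2 * κ * a n := by
    have := Nat.floor_le (show 0 ≤ κ * a n by positivity)
    rw [hs]; push_cast; linarith
  have hns : nodesize n < s := by
    rw [div_le_iff₀ ha0] at hκn
    rw [hs, Nat.lt_succ_iff]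
    exact Nat.le_floor hκn
  have hsa : s ≤ a n := by
    have h1 : (s : ℝ) ≤ a n := by
      exact hs_hi.trans (mul_le_of_le_one_left ha0.le (by linarith))
    exact_mod_cast h1
  have hqa : q n ≤ a n := by omega
  have hprobn := hprob n
  have hCq : (q n : ℝ) * (C * S.card) ≤ η * (s : ℝ) ^ 2 := by
    rw [hS]
    rw [div_le_div_iff₀ ha0 hC0] at hCn
    have hqn : (q n : ℝ) ≤ nodesize n := by
      have : q n ≤ nodesize n := by omega
      exact_mod_cast this
    calc (q n : ℝ) * (C * a n) ≤ nodesize n * (C * a n) := by gcongr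
      _ = (nodesize n * C) * a n := by ring
      _ ≤ (η * κ ^ 2 * a n) * a n := by gcongr
      _ = η * (κ * a n) ^ 2 := by ring
      _ ≤ _ := by gcongr
  have hmain := measureReal_badEvent_le (σ2 := σ2) (miss := miss n) (nodesize := nodesize n)
    (k₀ := a n / q n) hp (hrule n) (hmeas n) hq1 hns (by omega) (by omega : s ≤ S.card)
    ((Nat.one_le_div_iff (by omega)).2 hqa)
    (by rw [hS, mul_comm]; exact Nat.lt_mul_div_succ _ (by omega))
    (fun h => (hmc h).measurable) hB hmB happ hΛ hω.le hη hζ hK hC₀0 hC hCq hτ0.le hm1 hmp hξ hbins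
    hδ hδn hθ0 hθ1 (min_le_left _ _ : γ ≤ _) (min_le_right _ _ : γ ≤ _) hκ0 (by rwa [hS])
  rw [hS] at hmain
  have t2 : 2 ^ K * ((s : ℝ) / a n) ≤ e := by
    refine le_trans ?_ hκ2
    gcongr
    rwa [div_le_iff₀ ha0]
  have t3 : 2 / ξ * (1 + C) * settledRate p η ζ ω Λ ≤ e := by
    rw [le_div_iff₀ (by positivity)] at hrate
    linarith
  have t4 : G * τ = e := by
    rw [hτ]
    field_simp
  have t5 : (σ2 : ℝ) / C₀ ≤ e := by
    rw [hC₀, div_div_eq_mul_div, div_le_iff₀ (by positivity)]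
    linarith
  refine hmain.trans ((add_le_add hinvn (mul_le_mul_of_nonneg_left (add_le_add (add_le_add
    (add_le_add (add_le_add (add_le_add hKe t2) t3) t4.le) t5) hentn)
    (show 0 ≤ 2 / δ by positivity))).trans ?_)
  have hsum : 2 / δ * (e + e + e + e + e + e) = 3 / 4 * r := by
    rw [he]
    field_simp
    ring
  rw [hsum]
  linarith

end Constants

/-! ### From trees to the forest -/

section Forest

variable {n p T : ℕ} {rule : SplitRule n p} {q nodesize a mtry : ℕ} {m : (Fin p → ℝ) → ℝ}
  {σ2 : ℝ≥0} {miss : Measure (Fin p → Bool)}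

/-- The event that the `k`-th tree of the forest has an error above `ξ` at the query point. -/
def treeBadEvent (rule : SplitRule n p) (q nodesize : ℕ) (m : (Fin p → ℝ) → ℝ) (ξ : ℝ)
    (k : Fin T) :
    Set ((Fin n → (Fin p → ℝ) × ℝ × (Fin p → Bool)) × (Fin T → Theta n p) × (Fin p → ℝ)) :=
  {u | ξ < |treeEstimate rule q nodesize (sampleData m u.1) (u.2.1 k) u.2.2 - m u.2.2|}

lemma measurableSet_treeBadEvent (hrule : IsCartRule q rule) (hmeas : IsMeasurableRule rule)
    (hm : Measurable m) (ξ : ℝ) (k : Fin T) :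
    MeasurableSet (treeBadEvent rule q nodesize m ξ k) := by
  refine measurableSet_lt measurable_const (measurable_abs.comp (Measurable.sub ?_ ?_))
  · exact measurable_treeEstimate nodesize hrule hmeas
      ((measurable_sampleData hm).comp (by fun_prop)) (by fun_prop) (by fun_prop)
  · exact hm.comp (by fun_prop)

instance isProbabilityMeasure_thetaLaw (ha : a ≤ n) (hmp : mtry ≤ p) :
    IsProbabilityMeasure (thetaLaw n p a mtry ha hmp) := by
  unfold thetaLaw
  infer_instance

/-- One tree of the forest: a subsample, and independently of it a sample, a query point and
candidate directions. -/
lemma measurePreserving_singleTree [IsProbabilityMeasure miss] (ha : a ≤ n) (hmp : mtry ≤ p)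
    (k : Fin T) :
    MeasurePreserving
      (fun u : (Fin n → (Fin p → ℝ) × ℝ × (Fin p → Bool)) × (Fin T → Theta n p) × (Fin p → ℝ) =>
        ((u.2.1 k).1, ((u.1, u.2.2), (u.2.1 k).2)))
      (forestLaw n p T a mtry ha hmp σ2 miss)
      ((uniformSubset n a ha).prod
        (((sampleLaw n p σ2 miss).prod (unifCube p)).prod (dirLaw p mtry hmp))) := by
  set μ := sampleLaw n p σ2 miss with hμ
  set ν := unifCube p with hν
  set lam := dirLaw p mtry hmp with hlam
  set υ := uniformSubset n a ha with hυ
  have h1 : MeasurePreserving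
      (Prod.map id (Prod.map (fun θ : Fin T → Theta n p => θ k) id))
      (forestLaw n p T a mtry ha hmp σ2 miss) (μ.prod ((υ.prod lam).prod ν)) :=
    (MeasurePreserving.id μ).prod
      ((measurePreserving_eval (fun _ : Fin T => thetaLaw n p a mtry ha hmp) k).prod
        (MeasurePreserving.id ν))
  have h2 : MeasurePreserving MeasurableEquiv.prodAssoc ((υ.prod lam).prod ν)
      (υ.prod (lam.prod ν)) := measurePreserving_prodAssoc _ _ _
  have h3 : MeasurePreserving Prod.swap (lam.prod ν) (ν.prod lam) :=
    Measure.measurePreserving_swap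
  have h4 := (MeasurePreserving.id μ).prod (((MeasurePreserving.id υ).prod h3).comp h2)
  have h5 : MeasurePreserving MeasurableEquiv.prodAssoc ((μ.prod υ).prod (ν.prod lam))
      (μ.prod (υ.prod (ν.prod lam))) := measurePreserving_prodAssoc _ _ _
  have h6 : MeasurePreserving Prod.swap (μ.prod υ) (υ.prod μ) := Measure.measurePreserving_swap
  have h7 := h6.prod (MeasurePreserving.id (ν.prod lam))
  have h8 : MeasurePreserving MeasurableEquiv.prodAssoc ((υ.prod μ).prod (ν.prod lam))
      (υ.prod (μ.prod (ν.prod lam))) := measurePreserving_prodAssoc _ _ _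
  have h9 : MeasurePreserving MeasurableEquiv.prodAssoc ((μ.prod ν).prod lam)
      (μ.prod (ν.prod lam)) := measurePreserving_prodAssoc _ _ _
  have h10 := (MeasurePreserving.id υ).prod (h9.symm _)
  exact h10.comp (h8.comp (h7.comp ((h5.symm _).comp (h4.comp h1))))

lemma measureReal_treeBadEvent_le [IsProbabilityMeasure miss] (hrule : IsCartRule q rule)
    (hmeas : IsMeasurableRule rule) (hm : Measurable m) (ha : a ≤ n) (hmp : mtry ≤ p)
    {ξ : ℝ} (k : Fin T) {r : ℝ} (hr0 : 0 ≤ r)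
    (hr : ∀ S : Finset (Fin n), S.card = a →
      (((sampleLaw n p σ2 miss).prod (unifCube p)).prod (dirLaw p mtry hmp)).real
        (badEvent rule q nodesize m ξ S) ≤ r) :
    (forestLaw n p T a mtry ha hmp σ2 miss).real (treeBadEvent rule q nodesize m ξ k) ≤ r := by
  set P' := ((sampleLaw n p σ2 miss).prod (unifCube p)).prod (dirLaw p mtry hmp) with hP'
  set U : Set (Finset (Fin n) × (((Fin n → (Fin p → ℝ) × ℝ × (Fin p → Bool)) × (Fin p → ℝ)) ×
      (List Bool → Finset (Fin p)))) := {v | v.2 ∈ badEvent rule q nodesize m ξ v.1} with hU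
  have hUm : MeasurableSet U := by
    refine measurableSet_setOfPred.2 (measurable_from_prod_countable_right fun S => ?_)
    exact measurableSet_setOfPred.1 (measurableSet_badEvent hrule hmeas hm ξ S)
  have hpre : treeBadEvent rule q nodesize m ξ k =
      (fun u : (Fin n → (Fin p → ℝ) × ℝ × (Fin p → Bool)) × (Fin T → Theta n p) × (Fin p → ℝ) =>
        ((u.2.1 k).1, ((u.1, u.2.2), (u.2.1 k).2))) ⁻¹' U := rfl
  rw [measureReal_def, hpre, (measurePreserving_singleTree ha hmp k).measure_preimage
    hUm.nullMeasurableSet, Measure.prod_apply hUm]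
  refine ENNReal.toReal_le_of_le_ofReal hr0 ?_
  calc ∫⁻ S, P' (Prod.mk S ⁻¹' U) ∂uniformSubset n a ha
      ≤ ∫⁻ _, ENNReal.ofReal r ∂uniformSubset n a ha := by
        refine lintegral_mono_ae ?_
        filter_upwards [ae_uniformSubset_card n a ha] with S hS
        exact (ENNReal.le_ofReal_iff_toReal_le (measure_ne_top _ _) hr0).2 (hr S hS)
    _ = ENNReal.ofReal r := by simp

lemma ae_forestLaw_mem_cube [IsProbabilityMeasure miss] (ha : a ≤ n) (hmp : mtry ≤ p) :
    ∀ᵐ u ∂forestLaw n p T a mtry ha hmp σ2 miss,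
      (∀ i, (u.1 i).1 ∈ Set.Icc (0 : Fin p → ℝ) 1) ∧ u.2.2 ∈ Set.Icc (0 : Fin p → ℝ) 1 := by
  set ϑ := Measure.pi fun _ : Fin T => thetaLaw n p a mtry ha hmp with hϑ
  refine Eventually.and (ae_all_iff.2 fun i => ?_) ?_
  · have h1 : MeasurePreserving (Prod.fst : _ → Fin p → ℝ) (obsLaw p σ2 miss) (unifCube p) :=
      measurePreserving_fst
    exact ((h1.comp (measurePreserving_eval_sampleLaw σ2 miss i)).comp
      (measurePreserving_fst (μ := sampleLaw n p σ2 miss)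
        (ν := ϑ.prod (unifCube p)))).quasiMeasurePreserving.ae ae_mem_cube
  · exact ((measurePreserving_snd (μ := ϑ) (ν := unifCube p)).comp
      (measurePreserving_snd (μ := sampleLaw n p σ2 miss)
        (ν := ϑ.prod (unifCube p)))).quasiMeasurePreserving.ae ae_mem_cube

lemma abs_forestEstimate_sub_le (hT : 1 ≤ T) {D : Data n p} {θ : Fin T → Theta n p}
    {x : Fin p → ℝ} {y ξ : ℝ}
    (h : ∀ k, |treeEstimate rule q nodesize D (θ k) x - y| ≤ ξ) :
    |forestEstimate rule q nodesize D θ x - y| ≤ ξ := by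
  have hT0 : (0 : ℝ) < T := by exact_mod_cast hT
  have e : forestEstimate rule q nodesize D θ x - y =
      (∑ k, (treeEstimate rule q nodesize D (θ k) x - y)) / T := by
    rw [forestEstimate, Finset.sum_sub_distrib, sub_div]
    simp [hT0.ne']
  rw [e, abs_div, Nat.abs_cast, div_le_iff₀ hT0]
  refine (Finset.abs_sum_le_sum_abs _ _).trans ((Finset.sum_le_sum fun k _ => h k).trans ?_)
  simp [mul_comm]

end Forest
end MissingForest

open MissingForest
theorem theorem1 {p : ℕ}
    -- the additive regression function and the variance of the noise
    (mc : Fin p → ℝ → ℝ) (hmc : ∀ j, ContinuousOn (mc j) (Set.Icc 0 1))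
    (σ2 : ℝ≥0) (hσ : 0 < σ2)
    -- the law of the missingness indicators of one observation, for sample size n
    (miss : ℕ → Measure (Fin p → Bool)) (hprob : ∀ n, IsProbabilityMeasure (miss n))
    (c : Fin p → ℝ) (hc : ∀ h, 0 < c h ∧ c h < 1)
    (hmiss : ∀ h, Tendsto (fun n => (miss n).real {M | M h = true}) atTop (𝓝 (c h)))
    (hcomplete : ∃ δ : ℝ, 0 < δ ∧ ∀ᶠ n in atTop, δ ≤ (miss n).real {M | ∀ h, M h = false})
    -- the parameters of the forest
    (T : ℕ) (hT : 1 ≤ T) (mtry : ℕ) (hmtry : 1 ≤ mtry) (hmp : mtry ≤ p)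
    (a nodesize q : ℕ → ℕ) (ha : ∀ n, a n ≤ n)
    (hpar : ∀ᶠ n in atTop, 1 ≤ q n ∧ 2 * q n ≤ a n ∧ 2 * q n ≤ nodesize n + 1 ∧ nodesize n ≤ a n)
    (hq : Tendsto q atTop atTop)
    (hnode : Tendsto (fun n => (nodesize n : ℝ) / (a n : ℝ)) atTop (𝓝 0))
    -- the CART rule, with its way of breaking ties
    (rule : ∀ n, SplitRule n p) (hrule : ∀ n, IsCartRule (q n) (rule n))
    (hrule_meas : ∀ n, IsMeasurableRule (rule n))
    -- for each sample size n: covariates, noise, missingness, tree randomizations, query point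
    {Ω : ℕ → Type*} [∀ n, MeasurableSpace (Ω n)] (P : ∀ n, Measure (Ω n))
    [∀ n, IsProbabilityMeasure (P n)]
    (X : ∀ n, Fin n → Ω n → Fin p → ℝ) (ε : ∀ n, Fin n → Ω n → ℝ)
    (M : ∀ n, Fin n → Ω n → Fin p → Bool) (Θ : ∀ n, Fin T → Ω n → Theta n p)
    (X₀ : ∀ n, Ω n → Fin p → ℝ)
    (hlaw : ∀ n, HasLaw
      (fun ω => ((fun i => (X n i ω, ε n i ω, M n i ω)), (fun k => Θ n k ω), X₀ n ω))
      (forestLaw n p T (a n) mtry (ha n) hmp σ2 (miss n)) (P n)) :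
    ∀ ξ : ℝ, 0 < ξ → ∀ ρ : ℝ, 0 < ρ → ∃ N : ℕ, ∀ n : ℕ, N < n →
      1 - ρ ≤ (P n).real {ω |
        |forestEstimate (rule n) (q n) (nodesize n)
            (observe (fun i => X n i ω) (fun i => M n i ω)
              (fun i => (∑ j, mc j (X n i ω j)) + ε n i ω))
            (fun k => Θ n k ω) (X₀ n ω)
          - ∑ j, mc j (X₀ n ω j)| ≤ ξ} := by
  classical
  intro ξ hξ ρ hρ
  obtain ⟨δ, hδ, hδm⟩ := hcomplete
  have hp : 1 ≤ p := hmtry.trans hmp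
  -- continuous bounded extension of the components
  set mc' : Fin p → ℝ → ℝ := fun h x => mc h (Set.projIcc 0 1 zero_le_one x) with hmc'
  have hcont : ∀ h, Continuous (mc' h) := fun h =>
    (hmc h).comp_continuous (continuous_subtype_val.comp continuous_projIcc) fun x =>
      (Set.projIcc 0 1 zero_le_one x).2
  obtain ⟨B, hB1, hB⟩ : ∃ B : ℝ, 1 ≤ B ∧ ∀ x : Fin p → ℝ, |∑ h, mc' h (x h)| ≤ B := by
    have h1 : ∀ h, ∃ b : ℝ, ∀ x ∈ Set.Icc (0 : ℝ) 1, |mc h x| ≤ b := fun h =>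
      isCompact_Icc.exists_bound_of_continuousOn (hmc h)
    choose b hb using h1
    refine ⟨max 1 (∑ h, b h), le_max_left _ _, fun x => le_trans ?_ (le_max_right _ _)⟩
    exact (Finset.abs_sum_le_sum_abs _ _).trans
      (Finset.sum_le_sum fun h _ => hb h _ (Set.projIcc 0 1 zero_le_one (x h)).2)
  set m : (Fin p → ℝ) → ℝ := fun x => ∑ h, mc' h (x h) with hm
  have hmm : Measurable m :=
    Finset.measurable_sum _ fun h _ => (hcont h).measurable.comp (measurable_pi_apply h)
  have hmeq : ∀ x ∈ Set.Icc (0 : Fin p → ℝ) 1, ∑ j, mc j (x j) = m x := by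
    intro x hx
    refine Finset.sum_congr rfl fun h _ => ?_
    simp only [hmc']
    rw [Set.projIcc_of_mem zero_le_one ⟨hx.1 h, hx.2 h⟩]
  have hT0 : (0 : ℝ) < T := by exact_mod_cast hT
  have hev := eventually_measureReal_badEvent_le hp hcont hB1 hB σ2 hprob hδ hδm hmtry hmp hpar hq
    hnode hrule hrule_meas hξ (show 0 < ρ / T by positivity)
  obtain ⟨N, hN⟩ := eventually_atTop.1 hev
  refine ⟨N, fun n hn => ?_⟩
  have hprobn := hprob n
  have hr := hN n hn.le
  set Z : Ω n → _ := fun ω => ((fun i => (X n i ω, ε n i ω, M n i ω)), (fun k => Θ n k ω), X₀ n ω)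
    with hZ
  have hZm : AEMeasurable Z (P n) := (hlaw n).aemeasurable
  set W := ⋃ k : Fin T, treeBadEvent (T := T) (rule n) (q n) (nodesize n) m ξ k with hW
  have hWm : MeasurableSet W :=
    MeasurableSet.iUnion fun k => measurableSet_treeBadEvent (hrule n) (hrule_meas n) hmm ξ k
  have hWr : (P n).real (Z ⁻¹' W) ≤ ρ := by
    have h1 : (P n).real (Z ⁻¹' W) =
        (forestLaw n p T (a n) mtry (ha n) hmp σ2 (miss n)).real W := by
      rw [measureReal_def, measureReal_def, ← (hlaw n).map_eq,
        Measure.map_apply_of_aemeasurable hZm hWm]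
    rw [h1]
    refine (measureReal_iUnion_fintype_le _).trans ?_
    refine (Finset.sum_le_sum fun k _ => measureReal_treeBadEvent_le (nodesize := nodesize n)
      (hrule n) (hrule_meas n) hmm (ha n) hmp k (by positivity) hr).trans (le_of_eq ?_)
    rw [Finset.sum_const, Finset.card_univ, Fintype.card_fin, nsmul_eq_mul]
    field_simp
  have hcube : ∀ᵐ ω ∂P n, (∀ i, X n i ω ∈ Set.Icc (0 : Fin p → ℝ) 1) ∧
      X₀ n ω ∈ Set.Icc (0 : Fin p → ℝ) 1 := by
    have h1 := ae_forestLaw_mem_cube (T := T) (σ2 := σ2) (miss := miss n) (ha n) hmp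
    rw [← (hlaw n).map_eq] at h1
    exact ae_of_ae_map hZm h1
  set good : Set (Ω n) := {ω | |forestEstimate (rule n) (q n) (nodesize n)
            (observe (fun i => X n i ω) (fun i => M n i ω)
              (fun i => (∑ j, mc j (X n i ω j)) + ε n i ω))
            (fun k => Θ n k ω) (X₀ n ω)
          - ∑ j, mc j (X₀ n ω j)| ≤ ξ} with hgood
  have hsub : ∀ᵐ ω ∂P n, ω ∈ goodᶜ → ω ∈ Z ⁻¹' W := by
    filter_upwards [hcube] with ω hω hbad
    by_contra hWω
    refine hbad ?_
    have hdata : observe (fun i => X n i ω) (fun i => M n i ω)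
        (fun i => (∑ j, mc j (X n i ω j)) + ε n i ω) = sampleData m (Z ω).1 := by
      simp only [sampleData, hZ]
      congr 1
      ext i
      rw [hmeq _ (hω.1 i)]
    rw [hgood, Set.mem_ofPred_eq, hdata, hmeq _ hω.2]
    refine abs_forestEstimate_sub_le hT fun k => not_lt.1 fun hlt => hWω ?_
    exact Set.mem_iUnion.2 ⟨k, hlt⟩
  have hle : (P n).real goodᶜ ≤ (P n).real (Z ⁻¹' W) :=
    ENNReal.toReal_mono (measure_ne_top _ _) (measure_mono_ae hsub)
  have hone : (1 : ℝ) ≤ (P n).real good + (P n).real goodᶜ := by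
    have h1 := measureReal_union_le (μ := P n) good goodᶜ
    rwa [Set.union_compl_self, probReal_univ] at h1
  linarith
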